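/- **Instance.** Let $A$ be a matrix of full row rank over a field $\mathbf K$ with row set $U$ and column set $V$. The set $V$ is partitioned into pairs $\{v,\bar v\}$, called lines, and each line $\ell$ has a weight $w_\ell\in\mathbb R$. A base is a base of the column matroid of $A$; a parity base is a base that is a union of lines. **Data.** Consider a family $\Lambda$ of sets $H_i$ (blossoms), sets $B^*\subseteq V^*$, a matrix $C^*$ with row set $B^*$ and column set $V^*\setminus B^*$, functions $p:V^*\to\mathbb R$, $q:\Lambda\to\mathbb R_{\ge0}$, and for each $H_i\in\Lambda$ a total order $<_{H_i}$ on $H_i^\bullet$ and sequences $R_{H_i}(x)$ ($x\in H_i^\bullet$; $H_i^\bullet$ is defined below), as follows. $B:=B^*\cap V$ is a base; a source line is a line with exactly one vertex in $B$, its two vertices are source vertices, and the other lines are normal. Each blossom contains at most one source line; it is a source blossom if it contains one, and normal otherwise. Each normal $H_i$ has two extra vertices, a bud $b_i$ and a tip $t_i$, with $\bar b_i=t_i$, $\bar t_i=b_i$ (a dummy line); $T$ is the set of all buds and tips and $V^*=V\cup T$. Exactly one of $b_i,t_i$ is in $B^*$. The blossoms are subsets of $V^*$, pairwise disjoint or properly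 nested; the sets $H_i\cap V$ are nonempty, distinct unions of lines; for $H_j$ normal, $t_j\in H_i$ iff $H_j\subseteq H_i$, and $b_j\in H_i$ iff $H_j\subsetneq H_i$. Write $C^*[S]=C^*[S\cap B^*,S\setminus B^*]$. Pivoting around $S$, defined if $\alpha=C^*[S]$ is nonsingular, replaces $C^*=\begin{pmatrix}\alpha&\beta\\\gamma&\delta\end{pmatrix}$ by $\begin{pmatrix}\alpha^{-1}&\alpha^{-1}\beta\\-\gamma\alpha^{-1}&\delta-\gamma\alpha^{-1}\beta\end{pmatrix}$ and $B^*$ by $B^*\triangle S$. Let $F^*=\{(u,v):u\in B^*,v\in V^*\setminus B^*,C^*_{uv}\ne0\}$, let $Q_{uv}$ be the sum of $q(H_i)$ over all $H_i$ containing exactly one of $u,v$, and $F^\circ=\{(u,v)\in F^*:p(v)-p(u)=Q_{uv}\}$ (tight edges), $G^\circ=(V^*,F^\circ)$ as an undirected graph. $H_i^-$ is the set of $v\in H_i$, $v\neq t_i$, joined by an edge of $F^*$ to $V^*\setminus H_i$, and $H_i^\bullet=H_i^-\cup(H_i\cap V)$. A tight perfect matching of $G^\circ[X]$ is a perfect matching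 of tight edges at most one of which leaves any given $H_i$ with $q(H_i)>0$. The data are *admissible* if moreover: - (BT1) after pivoting $C^*$ around $T$, the submatrix on $V$ is $A[U,B]^{-1}A[U,V\setminus B]$. - (BT2) for each normal $H_i$: if $b_i\in B^*$, then $C^*_{b_it_i}\ne0$, $C^*_{b_iv}=0$ for $v\in H_i\setminus B^*$, $v\ne t_i$, and $C^*_{ut_i}=0$ for $u\in B^*\setminus H_i$, $u\ne b_i$; if $t_i\in B^*$, then $C^*_{t_ib_i}\ne0$, $C^*_{ub_i}=0$ for $u\in B^*\cap H_i$, $u\neq t_i$, and $C^*_{t_iv}=0$ for $v\in (V^*\setminus B^*)\setminus H_i$, $v\ne b_i$. - (DF) $p(v)+p(\bar v)=w_\ell$ for each line $\ell=\{v,\bar v\}$; $p(v)-p(u)\ge Q_{uv}$ for $(u,v)\in F^*$; and $p(v)-p(u)=q(H_i)$ if $(u,v)\in F^*$, $\{u,v\}=\{b_i,t_i\}$. - (BR) For $H_i\in\Lambda$ and $x\in H_i^\bullet$, the sequence $R=R_{H_i}(x)$ has distinct vertices, $x\in R\subseteq H_i$; it consists of lines, dummy lines, and its first vertex, which is $t_i$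 if $H_i$ is normal and a source vertex (whose mate is not in $R$) if $H_i$ is a source blossom; its last two vertices are $\bar x,x$ unless $R=(x)$; if $R$ meets a normal $H_j\subsetneq H_i$, then $b_j,t_j\in R$; $G^\circ[R\setminus\{x\}]$ has exactly one tight perfect matching; and if $x\in H_i^-$, $Z\subseteq R\cap H_i^-$, $z\ge_{H_i}x$ for all $z\in Z$, $Z\neq\{x\}$, and $|H_j\cap Z|\le1$ whenever $q(H_j)>0$, then $G^\circ[R\setminus Z]$ has no tight perfect matching. **Procedure Search.** For $x\in V^*$, let $K(x)=H_i\cup\{b_i\}$ if $x\in H_i\cup\{b_i\}$ for a maximal blossom $H_i$ that is normal, $K(x)=H_i$ if $x\in H_i$ for a maximal blossom $H_i$ that is a source blossom, and otherwise call $x$ single and put $K(x)=\{x,\bar x\}$. The procedure labels vertices $x$ with sequences $P(x)$ and puts them into a queue ($\prec$ is the order of labeling), labels blossoms with $\oplus$ or $\ominus$, and assigns vertices $\rho(x)$ to some vertices. For a sequence $P$, $\overline P$ is its reverse and $P|r$ its part after $r$ ($P(v|r):=P(v)|r$). "Adjacent" means adjacent in $G^\circ$. "Label" for vertices includes putting them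 into the queue, except for tips $t$ in Blossom and Graft. 0. Nothing is labeled or assigned; the queue is empty. 1. Label every single source vertex $x$ with $P(x)=x$. While there is a source line $\{x,\bar x\}$ of adjacent single vertices, add it to $\Lambda$ as a blossom $H$ with $q(H)=0$, label $\oplus$, $R_H(x)=x$, $R_H(\bar x)=\bar x$. For every unlabeled maximal source blossom $H_i$, label it $\oplus$ and label every $x\in H_i^\bullet$, in the order $<_{H_i}$, with $P(x)=R_{H_i}(x)$. 2. If the queue is empty, return $\emptyset$. Otherwise remove its first element $v$. 3. While some labeled $u$ adjacent to $v$ has $K(u)\ne K(v)$, take the $\prec$-minimal one; if the first vertices of $P(v),P(u)$ lie in different source lines, return $P(v)\overline{P(u)}$; otherwise apply Blossom$(v,u)$. 4. While some unlabeled $u$ adjacent to $v$ with $K(u)\ne K(v)$ has no $\rho(u)$: if $u$ is single, label $\bar u$ with $P(\bar u)=P(v)u\bar u$, put $\rho(u)=v$, and, if $v,\bar u$ are adjacent, apply Blossom$(\bar u,v)$. If $K(u)=H_i\cup\{b_i\}$ with $H_i$ normal and $v,b_i$ are adjacent, apply Graft$(v,H_i)$. If $K(u)=H_i\cup\{b_i\}$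 with $H_i$ normal and $v,b_i$ are not adjacent, take the $<_{H_i}$-minimal $y\in H_i^\bullet$ adjacent to $v$, label $H_i$ with $\ominus$ and $b_i$ with $P(b_i)=P(v)\overline{R_{H_i}(y)}b_i$, and put $\rho(x)=v$ for the unlabeled $x\in H_i^\bullet$. 5. Go to 2. *Attaching* a new bud $b$ and tip $t$ to a vertex set $H$ with respect to $r\notin H$, $g\in H$: if $r\in B^*$, $g\notin B^*$, add $b$ to $B^*$ and put $C^*_{bt}=C^*_{rg}$, $C^*_{by}=C^*_{ry}$ ($y\in H\setminus B^*$), $C^*_{by}=0$ (other $y\notin B^*$), $C^*_{xt}=C^*_{xg}$ ($x\in B^*\setminus H$), $C^*_{xt}=0$ ($x\in B^*\cap H$), $p(b)=p(t)=p(r)+Q_{rb}$; if $r\notin B^*$, $g\in B^*$, add $t$ to $B^*$ and put $C^*_{tb}=C^*_{gr}$, $C^*_{xb}=C^*_{xr}$ ($x\in B^*\cap H$), $C^*_{xb}=0$ ($x\in B^*\setminus H$), $C^*_{ty}=C^*_{gy}$ ($y\notin B^*$, $y\notin H$), $C^*_{ty}=0$ ($y\in H\setminus B^*$), $p(b)=p(t)=p(r)-Q_{rb}$.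 Then pivot around $\{b,t\}$, add $t$ to $H$, label $t$ with $P(t)=P(r)bt$ and insert it into $\prec$ just after $r$, and put $\rho(b)=r$. *Completing* $H$ means: label $H$ with $\oplus$, put $R_H(x)=P(x|b)$ if $H$ has a bud $b$ and $R_H(x)=P(x)$ otherwise, let $<_H$ be $\prec$ on $H^\bullet$, and add $H$ to $\Lambda$ with $q(H)=0$. *Blossom$(v,u)$.* Let $c$ be the last vertex of $P(v)$ such that $K(c)$ meets $P(u)$, and $d$ the last vertex of $P(u)$ in $K(c)$. Let $H$ be the union of $K(x)$ over $x\in P(v|c)\cup P(u|d)$, and also over $x=c$ if $c\ne d$. If $H$ contains no source line, let $r=c$ if $c=d$ and let $r$ be the last vertex of $P(v)$ outside $H$ otherwise, let $g$ be the vertex after $r$ in $P(v)$, and attach $b,t$ to $H$; for each previously labeled $x$ whose path $P(x)$ meets $H$, replace $P(x)$ by $P(r)\,b\,t\,P(x|r)$; and for $x\in H$ with $\rho(x)=r$ put $\rho(x)=t$. Then label every unlabeled $x\in H^\bullet$ ($K$, maximal blossoms and labels of blossoms as before adding $H$; $P_u:=P(t)$ if $H$ has no source line and $u=r$, and $P_u:=P(u)$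 otherwise): if $x$ is single or the bud of a maximal blossom labeled $\oplus$, then $P(x)=P(v)\overline{P(u|x)}x$ if $x\in P(u|d)$, and $P(x)=P_u\overline{P(v|x)}x$ if $x\in P(v|c)$; if $x\in H_i^\bullet$ for a maximal normal blossom $H_i$ labeled $\ominus$, then $P(x)=P(v)\overline{P(u|t_i)}R_{H_i}(x)$ if $t_i\in P(u|d)$, and $P(x)=P_u\overline{P(v|t_i)}R_{H_i}(x)$ if $t_i\in P(v|c)$. These $x$ are labeled in any order such that $x$ comes before $y$ if $\rho(x)\succ\rho(y)$, or if $\rho(x)=\rho(y)$, $K(x)=K(y)=H_i\cup\{b_i\}$ with $H_i$ normal and $x<_{H_i}y$; and such that, if $H$ has no source line and $r=c=d\ne u$, nothing comes between $g$ and the vertex after $t$ in $P(u)$ (if both are among these $x$). Complete $H$. *Graft$(v,H_i)$.* Put $H=H_i\cup\{b_i\}$ and attach $b,t$ with $r=v$, $g=b_i$. Label each $x\in H_i^\bullet$, in the order $<_{H_i}$, with $P(x)=P(v)\,b\,t\,b_iR_{H_i}(x)$. Complete $H$. Put $\epsilon'=q(H_i)$, then $q(H_i)=0$, $q(H)=\epsilon'$;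 change $p(b_i)$ by $+\epsilon'$ if $b_i\in B^*$ and by $-\epsilon'$ otherwise, and $p(t)$ by $-\epsilon'$ if $t\in B^*$ and by $+\epsilon'$ otherwise. Pivot around $\{b_i,t_i\}$, and delete $b_i,t_i$ from $V^*$, $B^*$, $H$ and all $P(x),R_H(x)$, and $H_i$ from $\Lambda$. **Step size of the dual update.** Suppose that Search has returned $\emptyset$. In the final state, let $R$ be the set of vertices of $V^*$ that are in no blossom and are labeled or have $\rho$ assigned, $R^+$ the set of labeled vertices in $R$, $Z$ the set of vertices in labeled blossoms, $Z^+$ the union of the maximal blossoms labeled $\oplus$, and $Y=V^*\setminus(R\cup Z)$. Let $\epsilon=\min\{\epsilon_1,\epsilon_2,\epsilon_3,\epsilon_4\}$, where minima over empty sets are $+\infty$ and $$\begin{aligned}\epsilon_1&=\tfrac12\min\{p(v)-p(u)-Q_{uv}:(u,v)\in F^*,\ u,v\in R^+\cup Z^+,\ K(u)\ne K(v)\},\\ \epsilon_2&=\min\{p(v)-p(u)-Q_{uv}:(u,v)\in F^*,\ u\in R^+\cup Z^+,\ v\in Y\},\\ \epsilon_3&=\min\{p(v)-p(u)-Q_{uv}:(u,v)\in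 F^*,\ u\in Y,\ v\in R^+\cup Z^+\},\\ \epsilon_4&=\min\{q(H):H\text{ a maximal blossom labeled }\ominus\}.\end{aligned}$$ **Lemma.** Suppose that Search, called on admissible data, returns $\emptyset$, that there is a source line, and that $\epsilon=+\infty$. Then the instance has no parity base. -/

import Mathlib

noncomputable section

open scoped Classical

namespace MatroidParity

/-! ### The parity base problem -/

/-- An instance of the minimum-weight parity base problem: a matrix `A` of full row rank with row
set `U` and column set `V`, a partition of `V` into lines `{v, mate v}`, and line weights.
The weight of the line containing `v` is `w v`. -/
structure ParityInstance (K U V : Type*) [Field K] [Fintype U] [Fintype V] where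
  A : Matrix U V K
  rank_eq : A.rank = Fintype.card U
  mate : V → V
  mate_mate : ∀ v, mate (mate v) = v
  mate_ne : ∀ v, mate v ≠ v
  w : V → ℝ
  w_mate : ∀ v, w (mate v) = w v

/-- Bases of the column matroid of `A`: the maximal independent column sets. -/
def ParityInstance.IsBase {K U V : Type*} [Field K] [Fintype U] [Fintype V]
    (I : ParityInstance K U V) (B : Finset V) : Prop :=
  Maximal (fun S : Finset V => LinearIndepOn K I.A.col (S : Set V)) B

/-- A parity base is a base that is a union of lines. -/
def ParityInstance.IsParityBase {K U V : Type*} [Field K] [Fintype U] [Fintype V]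
    (I : ParityInstance K U V) (B : Finset V) : Prop :=
  I.IsBase B ∧ ∀ v ∈ B, I.mate v ∈ B

/-- `C` (on rows `B` and columns `V \ B`) is the fundamental cocircuit matrix of the base `B`,
that is, `A[U, B] * C = A[U, V \ B]`. -/
def ParityInstance.IsFundCocircuit {K U V : Type*} [Field K] [Fintype U] [Fintype V]
    (I : ParityInstance K U V) (B : Finset V) (C : V → V → K) : Prop :=
  ∀ v, v ∉ B → ∀ i : U, ∑ u ∈ B, I.A i u * C u v = I.A i v

/-- Vertices: the columns of `A`, and a potential bud `b_i` and tip `t_i` for every blossom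
identifier `i`. -/
inductive Vtx (V : Type*) where
  | orig (v : V) : Vtx V
  | bud (i : ℕ) : Vtx V
  | tip (i : ℕ) : Vtx V

/-- The other vertex of the line or dummy line of a vertex. -/
def ParityInstance.bar {K U V : Type*} [Field K] [Fintype U] [Fintype V]
    (I : ParityInstance K U V) : Vtx V → Vtx V
  | .orig v => .orig (I.mate v)
  | .bud i => .tip i
  | .tip i => .bud i

/-! ### Pivoting -/

/-- `C'` is obtained from the matrix `C` (row set `B ⊆ W`, column set `W \ B`) by pivoting
around `S`. With `α = C[S ∩ B, S \ B]`, `β = C[S ∩ B, W \ (B ∪ S)]`, `γ = C[B \ S, S \ B]` and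
`δ = C[B \ S, W \ (B ∪ S)]`, the matrix `C'` has the four blocks `α⁻¹`, `α⁻¹ * β`, `-γ * α⁻¹` and
`δ - γ * α⁻¹ * β`; in particular `α` is nonsingular. The new row set is `B ∆ S`. Entries outside
of these blocks have no meaning. -/
structure IsPivot {K X : Type*} [Field K] (W B S : Finset X) (C C' : X → X → K) : Prop where
  left_inv : ∀ i ∈ S \ B, ∀ j ∈ S \ B,
    ∑ k ∈ S ∩ B, C' i k * C k j = if i = j then 1 else 0
  right_inv : ∀ k ∈ S ∩ B, ∀ l ∈ S ∩ B,
    ∑ j ∈ S \ B, C k j * C' j l = if k = l then 1 else 0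
  upper_right : ∀ i ∈ S \ B, ∀ v ∈ W \ (B ∪ S), C' i v = ∑ k ∈ S ∩ B, C' i k * C k v
  lower_left : ∀ u ∈ B \ S, ∀ k ∈ S ∩ B, C' u k = - ∑ j ∈ S \ B, C u j * C' j k
  lower_right : ∀ u ∈ B \ S, ∀ v ∈ W \ (B ∪ S),
    C' u v = C u v - ∑ j ∈ S \ B, ∑ k ∈ S ∩ B, C u j * C' j k * C k v

/-! ### Blossoms, dual variables and routings -/

/-- The data on which the search procedure is called.
* `ids`: identifiers of the members of the blossom family `Λ`; `H i` is the blossom with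
  identifier `i`.
* `Bs`: the set `B*`; `C`: the matrix `C*`, meaningful on rows `B*` and columns `V* \ B*`.
* `p`, `q`: the dual variables.
* `R i x`: the routing of `x` in the blossom `H i`; `ord i`: the order `<` of the blossom. -/
structure Config (K V : Type*) where
  ids : Finset ℕ
  H : ℕ → Finset (Vtx V)
  Bs : Finset (Vtx V)
  C : Vtx V → Vtx V → K
  p : Vtx V → ℝ
  q : ℕ → ℝ
  R : ℕ → Vtx V → List (Vtx V)
  ord : ℕ → Vtx V → Vtx V → Prop

namespace Config

variable {K U V : Type*} [Field K] [Fintype U] [Fintype V]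

/-- `B = B* ∩ V`. -/
def base (c : Config K V) : Finset V :=
  Finset.univ.filter fun v => Vtx.orig v ∈ c.Bs

/-- Source vertices: the vertices of the lines with exactly one vertex in `B`. -/
def IsSource (I : ParityInstance K U V) (c : Config K V) (x : Vtx V) : Prop :=
  ∃ v, x = .orig v ∧ ¬ (v ∈ c.base ↔ I.mate v ∈ c.base)

/-- The vertex set contains (a vertex of) a source line. -/
def HasSource (I : ParityInstance K U V) (c : Config K V) (S : Finset (Vtx V)) : Prop :=
  ∃ x ∈ S, c.IsSource I x

/-- `i` is (the identifier of) a normal blossom. -/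
def IsNormal (I : ParityInstance K U V) (c : Config K V) (i : ℕ) : Prop :=
  i ∈ c.ids ∧ ¬ c.HasSource I (c.H i)

/-- `i` is (the identifier of) a source blossom. -/
def IsSourceBlossom (I : ParityInstance K U V) (c : Config K V) (i : ℕ) : Prop :=
  i ∈ c.ids ∧ c.HasSource I (c.H i)

/-- The set `T` of all buds and tips of normal blossoms. -/
def T (I : ParityInstance K U V) (c : Config K V) : Finset (Vtx V) :=
  (c.ids.filter (c.IsNormal I)).biUnion fun i => {Vtx.bud i, Vtx.tip i}

/-- The vertex set `V* = V ∪ T`. -/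
def Vstar (I : ParityInstance K U V) (c : Config K V) : Finset (Vtx V) :=
  Finset.univ.image Vtx.orig ∪ c.T I

/-- The edge set `F*`, as ordered pairs. -/
def Fstar (I : ParityInstance K U V) (c : Config K V) : Set (Vtx V × Vtx V) :=
  {e | e.1 ∈ c.Bs ∧ e.2 ∈ c.Vstar I \ c.Bs ∧ c.C e.1 e.2 ≠ 0}

/-- The pair `(u, v)` crosses the blossom `H i`. -/
def Crosses (c : Config K V) (i : ℕ) (u v : Vtx V) : Prop :=
  ¬ (u ∈ c.H i ↔ v ∈ c.H i)

/-- `Q_{uv}`, the sum of `q` over all blossoms crossed by `(u, v)`. -/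
def Q (c : Config K V) (u v : Vtx V) : ℝ :=
  ∑ i ∈ c.ids.filter (fun i => c.Crosses i u v), c.q i

/-- The set `F°` of tight edges, as ordered pairs. -/
def Ftight (I : ParityInstance K U V) (c : Config K V) : Set (Vtx V × Vtx V) :=
  {e | e ∈ c.Fstar I ∧ c.p e.2 - c.p e.1 = c.Q e.1 e.2}

/-- Adjacency in the undirected graph `(V*, F*)`. -/
def Adj (I : ParityInstance K U V) (c : Config K V) (u v : Vtx V) : Prop :=
  (u, v) ∈ c.Fstar I ∨ (v, u) ∈ c.Fstar I

/-- Adjacency in the undirected graph `G° = (V*, F°)`. -/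
def AdjT (I : ParityInstance K U V) (c : Config K V) (u v : Vtx V) : Prop :=
  (u, v) ∈ c.Ftight I ∨ (v, u) ∈ c.Ftight I

/-- `M` is a tight perfect matching of `G°[X]`: all its edges are tight, and at most one of its
edges crosses any given positive blossom. -/
def IsTightPM (I : ParityInstance K U V) (c : Config K V) (X : Finset (Vtx V))
    (M : Finset (Vtx V × Vtx V)) : Prop :=
  (∀ e ∈ M, e ∈ c.Ftight I ∧ e.1 ∈ X ∧ e.2 ∈ X) ∧
  (∀ x ∈ X, ∃! e, e ∈ M ∧ (e.1 = x ∨ e.2 = x)) ∧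
  ∀ i ∈ c.ids, 0 < c.q i → (M.filter fun e => c.Crosses i e.1 e.2).card ≤ 1

/-- `H⁻`: the vertices of the blossom other than the tip with an edge of `F*` leaving the
blossom. -/
def Hminus (I : ParityInstance K U V) (c : Config K V) (i : ℕ) : Finset (Vtx V) :=
  (c.H i).filter fun x => x ≠ Vtx.tip i ∧ ∃ y ∈ c.Vstar I, y ∉ c.H i ∧ c.Adj I x y

/-- `H• = H⁻ ∪ (H ∩ V)`. -/
def Hbul (I : ParityInstance K U V) (c : Config K V) (i : ℕ) : Finset (Vtx V) :=
  c.Hminus I i ∪ (c.H i).filter fun x => ∃ v, x = Vtx.orig v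

/-- `i` is an inclusionwise maximal blossom. -/
def IsMax (c : Config K V) (i : ℕ) : Prop :=
  i ∈ c.ids ∧ ∀ j ∈ c.ids, ¬ c.H i ⊂ c.H j

/-- `H ∪ {b}` for a normal blossom, `H` for a source blossom. -/
def cell (I : ParityInstance K U V) (c : Config K V) (i : ℕ) : Finset (Vtx V) :=
  if c.IsNormal I i then insert (Vtx.bud i) (c.H i) else c.H i

/-- A vertex is single if it lies in no maximal blossom and is not the bud of one. -/
def Single (I : ParityInstance K U V) (c : Config K V) (x : Vtx V) : Prop :=
  ∀ i, c.IsMax i → x ∉ c.cell I i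

/-- `K(x)`: the line of `x` if `x` is single, and otherwise the maximal blossom with `x` in it or
`x` as its bud, together with its bud if it is normal. -/
def Kset (I : ParityInstance K U V) (c : Config K V) (x : Vtx V) : Finset (Vtx V) :=
  if c.Single I x then {x, I.bar x}
  else (c.ids.filter fun i => c.IsMax i ∧ x ∈ c.cell I i).biUnion (c.cell I)

/-- Condition (BT1): pivoting `C*` around `T` gives a matrix whose part on `V` is the fundamental
cocircuit matrix of `B`. -/
def BT1 (I : ParityInstance K U V) (c : Config K V) : Prop :=
  ∃ C', IsPivot (c.Vstar I) c.Bs (c.T I) c.C C' ∧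
    I.IsFundCocircuit c.base fun u v => C' (.orig u) (.orig v)

/-- Condition (BT2). -/
def BT2 (I : ParityInstance K U V) (c : Config K V) : Prop :=
  ∀ i, c.IsNormal I i →
    (.bud i ∈ c.Bs → .tip i ∉ c.Bs →
      c.C (.bud i) (.tip i) ≠ 0 ∧
      (∀ v ∈ c.H i \ c.Bs, v ≠ .tip i → c.C (.bud i) v = 0) ∧
      (∀ u ∈ c.Bs \ c.H i, u ≠ .bud i → c.C u (.tip i) = 0)) ∧
    (.bud i ∉ c.Bs → .tip i ∈ c.Bs →
      c.C (.tip i) (.bud i) ≠ 0 ∧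
      (∀ u ∈ c.Bs ∩ c.H i, u ≠ .tip i → c.C u (.bud i) = 0) ∧
      (∀ v ∈ (c.Vstar I \ c.Bs) \ c.H i, v ≠ .bud i → c.C (.tip i) v = 0))

/-- The dual variables are feasible: `q` is nonnegative, and (DF1), (DF2), (DF3) hold. -/
structure DualFeasible (I : ParityInstance K U V) (c : Config K V) : Prop where
  q_nonneg : ∀ i ∈ c.ids, 0 ≤ c.q i
  df1 : ∀ v, c.p (.orig v) + c.p (.orig (I.mate v)) = I.w v
  df2 : ∀ e ∈ c.Fstar I, c.Q e.1 e.2 ≤ c.p e.2 - c.p e.1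
  df3 : ∀ i, c.IsNormal I i → ∀ e ∈ c.Fstar I,
    (e = (.bud i, .tip i) ∨ e = (.tip i, .bud i)) → c.p e.2 - c.p e.1 = c.q i

/-- The structural conditions on `B*` and on the blossom family `Λ`. -/
structure WellFormed (I : ParityInstance K U V) (c : Config K V) : Prop where
  isBase : I.IsBase c.base
  Bs_subset : c.Bs ⊆ c.Vstar I
  bud_tip : ∀ i, c.IsNormal I i → (.bud i ∈ c.Bs ↔ .tip i ∉ c.Bs)
  H_subset : ∀ i ∈ c.ids, c.H i ⊆ c.Vstar I
  lines : ∀ i ∈ c.ids, ∀ v, .orig v ∈ c.H i → .orig (I.mate v) ∈ c.H i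
  nonempty : ∀ i ∈ c.ids, ∃ v, .orig v ∈ c.H i
  distinct : ∀ i ∈ c.ids, ∀ j ∈ c.ids, i ≠ j → ∃ v, ¬ (.orig v ∈ c.H i ↔ .orig v ∈ c.H j)
  laminar : ∀ i ∈ c.ids, ∀ j ∈ c.ids, i ≠ j →
    Disjoint (c.H i) (c.H j) ∨ c.H i ⊂ c.H j ∨ c.H j ⊂ c.H i
  one_source : ∀ i ∈ c.ids, ∀ x ∈ c.H i, ∀ y ∈ c.H i,
    c.IsSource I x → c.IsSource I y → y = x ∨ y = I.bar x
  tip_mem : ∀ i ∈ c.ids, ∀ j, c.IsNormal I j → (.tip j ∈ c.H i ↔ c.H j ⊆ c.H i)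
  bud_mem : ∀ i ∈ c.ids, ∀ j, c.IsNormal I j → (.bud j ∈ c.H i ↔ c.H j ⊂ c.H i)

/-- The conditions (BR1)-(BR5) on the routing of `x ∈ H•` in the blossom `H i`, together with the
conventions on the routing as a sequence: its first vertex is the tip (normal blossom) or its
unique source vertex (source blossom), and its last two vertices are `x̄`, `x`, unless `x` is its
only vertex. -/
structure RoutingOK (I : ParityInstance K U V) (c : Config K V) (i : ℕ) (x : Vtx V) : Prop where
  nodup : (c.R i x).Nodup
  br1_mem : x ∈ c.R i x
  br1_subset : ∀ y ∈ c.R i x, y ∈ c.H i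
  br2_normal : c.IsNormal I i →
    (c.R i x).head? = some (.tip i) ∧ ∀ y ∈ c.R i x, y ≠ .tip i → I.bar y ∈ c.R i x
  br2_source : c.IsSourceBlossom I i →
    ∃ s, c.IsSource I s ∧ (c.R i x).head? = some s ∧ I.bar s ∉ c.R i x ∧
      ∀ y ∈ c.R i x, y ≠ s → I.bar y ∈ c.R i x
  ends : c.R i x = [x] ∨ ∃ l, c.R i x = l ++ [I.bar x, x]
  br3 : ∀ j, c.IsNormal I j → c.H j ⊂ c.H i → (∃ y ∈ c.R i x, y ∈ c.H j) →
    .bud j ∈ c.R i x ∧ .tip j ∈ c.R i x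
  br4 : ∃! M, c.IsTightPM I ((c.R i x).toFinset \ {x}) M
  br5 : x ∈ c.Hminus I i → ∀ Z : Finset (Vtx V), Z ⊆ (c.R i x).toFinset ∩ c.Hminus I i →
    (∀ z ∈ Z, z = x ∨ c.ord i x z) → Z ≠ {x} →
    (∀ j ∈ c.ids, 0 < c.q j → (c.H j ∩ Z).card ≤ 1) →
    ¬ ∃ M, c.IsTightPM I ((c.R i x).toFinset \ Z) M

/-- The order of the blossom `H i` is a strict total order on `H•`. -/
def OrderOK (I : ParityInstance K U V) (c : Config K V) (i : ℕ) : Prop :=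
  (∀ x ∈ c.Hbul I i, ¬ c.ord i x x) ∧
  (∀ x ∈ c.Hbul I i, ∀ y ∈ c.Hbul I i, ∀ z ∈ c.Hbul I i,
    c.ord i x y → c.ord i y z → c.ord i x z) ∧
  (∀ x ∈ c.Hbul I i, ∀ y ∈ c.Hbul I i, x ≠ y → c.ord i x y ∨ c.ord i y x)

/-- The standing conditions on the data on which the search procedure is called. -/
structure Admissible (I : ParityInstance K U V) (c : Config K V) : Prop where
  wellFormed : c.WellFormed I
  bt1 : c.BT1 I
  bt2 : c.BT2 I
  dualFeasible : c.DualFeasible I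
  routing : ∀ i ∈ c.ids, ∀ x ∈ c.Hbul I i, c.RoutingOK I i x
  order : ∀ i ∈ c.ids, c.OrderOK I i

end Config

/-! ### Auxiliary notions for sequences -/

/-- The part of the sequence `l` after the vertex `r` (not including `r`). -/
def after {X : Type*} (r : X) (l : List X) : List X :=
  (l.dropWhile fun x => decide (x ≠ r)).tail

/-- `a` is the last element of `l` that satisfies `Q`. -/
def IsLastWith {X : Type*} (l : List X) (Q : X → Prop) (a : X) : Prop :=
  ∃ l₁ l₂, l = l₁ ++ a :: l₂ ∧ Q a ∧ ∀ x ∈ l₂, ¬ Q x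

/-- `b` is the element subsequent to `a` in `l`. -/
def IsNextIn {X : Type*} (l : List X) (a b : X) : Prop :=
  ∃ l₁ l₂, l = l₁ ++ a :: b :: l₂

/-- `a` precedes `b` in `l`. -/
def Precedes {X : Type*} (l : List X) (a b : X) : Prop :=
  [a, b].Sublist l

/-- `l` lists the elements of `S` in the order `lt`. -/
def ListsInOrder {X : Type*} (l : List X) (S : Finset X) (lt : X → X → Prop) : Prop :=
  l.Nodup ∧ l.toFinset = S ∧ l.Pairwise lt

/-! ### The search procedure -/

/-- The labels of blossoms: `⊕` and `⊖`. -/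
inductive Sign where
  | plus : Sign
  | minus : Sign

/-- The state of the search procedure.
* `next`: all identifiers from `next` on are unused.
* `labeled`: the labeled vertices, listed in the order `≺`.
* `P x`: the path with which a labeled vertex `x` is labeled.
* `queue`: the queue; `rho`: the partially defined map `ρ`.
* `sign i`: the label of the blossom `H i`, if any. -/
structure SearchState (K V : Type*) extends Config K V where
  next : ℕ
  labeled : List (Vtx V)
  P : Vtx V → List (Vtx V)
  queue : List (Vtx V)
  rho : Vtx V → Option (Vtx V)
  sign : ℕ → Option Sign

/-- Where the control of the search procedure is. The three loops of Step 1 are `step1a`,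
`step1b`, `step1c`; `step3 v` and `step4 v` are Steps 3 and 4 for the vertex `v` removed from the
queue; `returnEmpty` and `returnPath` are the two ways to terminate. -/
inductive Phase (V : Type*) where
  | step1a : Phase V
  | step1b : Phase V
  | step1c : Phase V
  | step2 : Phase V
  | step3 (v : Vtx V) : Phase V
  | step4 (v : Vtx V) : Phase V
  | returnEmpty : Phase V
  | returnPath (P : List (Vtx V)) : Phase V

namespace SearchState

variable {K U V : Type*} [Field K] [Fintype U] [Fintype V]

/-- Step 0: nothing is labeled, and the queue is empty. -/
def IsStart (c : Config K V) (s : SearchState K V) : Prop :=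
  s.toConfig = c ∧ (∀ i ∈ c.ids, i < s.next) ∧ s.labeled = [] ∧ s.queue = [] ∧
    (∀ x, s.rho x = none) ∧ ∀ i, s.sign i = none

/-- Label the vertices of `xs`, in this order, with the paths given by `f`, and put them into the
queue. -/
def labelAll (s : SearchState K V) (xs : List (Vtx V)) (f : Vtx V → List (Vtx V)) :
    SearchState K V :=
  { s with
    labeled := s.labeled ++ xs
    queue := s.queue ++ xs
    P := fun x => if x ∈ xs then f x else s.P x }

/-- Add a blossom with the fresh identifier `next`, the vertex set `H` and dual variable `0`. -/
def addBlossom (s : SearchState K V) (H : Finset (Vtx V)) : SearchState K V :=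
  { s with
    ids := insert s.next s.ids
    H := Function.update s.H s.next H
    q := Function.update s.q s.next 0
    next := s.next + 1 }

/-- Label the blossom `n` with `⊕`, let `rt` be its routing, and order its set `H•` by `≺`. -/
def finishBlossom (I : ParityInstance K U V) (s : SearchState K V) (n : ℕ)
    (rt : Vtx V → List (Vtx V)) : SearchState K V :=
  { s with
    sign := Function.update s.sign n (some .plus)
    R := Function.update s.R n rt
    ord := Function.update s.ord n fun x y =>
      x ∈ s.Hbul I n ∧ y ∈ s.Hbul I n ∧ Precedes s.labeled x y }

/-- The matrix `C*` after the row and the column of the new bud `b` and tip `t` of the new blossom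
`H` have been attached, before the pivoting operation around `{b, t}`. -/
def attachC (s : SearchState K V) (H : Finset (Vtx V)) (r g : Vtx V) : Vtx V → Vtx V → K :=
  let b : Vtx V := .bud s.next
  let t : Vtx V := .tip s.next
  fun x y =>
    if r ∈ s.Bs then
      if x = b then (if y = t then s.C r g else if y ∈ H then s.C r y else 0)
      else if y = t then (if x ∈ H then 0 else s.C x g)
      else s.C x y
    else
      if x = t then (if y = b then s.C g r else if y ∈ H then 0 else s.C g y)
      else if y = b then (if x ∈ H then s.C x r else 0)
      else s.C x y

/-- The set `B*` after the new bud and tip have been attached, before the pivoting operation. -/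
def attachBs (s : SearchState K V) (r : Vtx V) : Finset (Vtx V) :=
  insert (if r ∈ s.Bs then .bud s.next else .tip s.next) s.Bs

/-- The potential after the new bud and tip have been attached. -/
def attachp (s : SearchState K V) (r : Vtx V) : Vtx V → ℝ :=
  let b : Vtx V := .bud s.next
  let t : Vtx V := .tip s.next
  fun x =>
    if x = b ∨ x = t then
      (if r ∈ s.Bs then s.p r + s.Q r b else s.p r - s.Q r b)
    else s.p x

/-- Introducing the bud `b` and the tip `t` of a new normal blossom `H ∪ {t}`, with the vertices
`r` outside and `g` inside of `H`: the matrix is extended and then pivoted around `{b, t}`, the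
new blossom is added, `t` is labeled with the path `P(r) b t` and inserted just after `r` into the
order `≺`, and `ρ(b) := r`. -/
def AttachBud (I : ParityInstance K U V) (s : SearchState K V) (H : Finset (Vtx V))
    (r g : Vtx V) (s' : SearchState K V) : Prop :=
  let b : Vtx V := .bud s.next
  let t : Vtx V := .tip s.next
  ((r ∈ s.Bs ∧ g ∉ s.Bs) ∨ (r ∉ s.Bs ∧ g ∈ s.Bs)) ∧
  ∃ C' l₁ l₂,
    IsPivot (s.Vstar I ∪ {b, t}) (s.attachBs r) {b, t} (s.attachC H r g) C' ∧
    s.labeled = l₁ ++ r :: l₂ ∧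
    s' = { s.addBlossom (insert t H) with
      Bs := symmDiff (s.attachBs r) {b, t}
      C := C'
      p := s.attachp r
      labeled := l₁ ++ r :: t :: l₂
      P := Function.update s.P t (s.P r ++ [b, t])
      rho := Function.update s.rho b (some r) }

/-- The updates of paths and of `ρ` in Step 3 of the procedure `Blossom`: the path of every vertex
labeled in `s` whose path meets `H` is rerouted through the new bud and tip, and vertices `x ∈ H`
with `ρ(x) = r` get `ρ(x) := t`. Here `s` is the state before and `s₁` the state after the new bud
and tip have been introduced. -/
def reroute (s s₁ : SearchState K V) (H : Finset (Vtx V)) (r : Vtx V) : SearchState K V :=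
  let b : Vtx V := .bud s.next
  let t : Vtx V := .tip s.next
  { s₁ with
    P := fun x =>
      if x ∈ s.labeled ∧ ∃ y ∈ s.P x, y ∈ H then s.P r ++ [b, t] ++ after r (s.P x) else s₁.P x
    rho := fun x => if x ∈ H ∧ s.rho x = some r then some t else s₁.rho x }

/-- The rules (i)-(vi) of Step 4 of `Blossom` for the path `path` of a newly labeled vertex `x`.
Blossoms and their labels refer to the state `s` before the new blossom is added; `P` are the
current paths, and `Pu` is the path that leads to `u` (through the new bud and tip, if any). -/
def PathRule (I : ParityInstance K U V) (s : SearchState K V) (P : Vtx V → List (Vtx V))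
    (Pu : List (Vtx V)) (v u c d x : Vtx V) (path : List (Vtx V)) : Prop :=
  ((s.Single I x ∨ ∃ i, s.IsMax i ∧ s.IsNormal I i ∧ s.sign i = some .plus ∧ x = .bud i) ∧
    ((x ∈ after d (P u) ∧ path = P v ++ (after x (P u)).reverse ++ [x]) ∨
     (x ∈ after c (P v) ∧ path = Pu ++ (after x (P v)).reverse ++ [x]))) ∨
  (∃ i, s.IsMax i ∧ s.IsNormal I i ∧ s.sign i = some .minus ∧ x ∈ s.Hbul I i ∧
    ((.tip i ∈ after d (P u) ∧ path = P v ++ (after (.tip i) (P u)).reverse ++ s.R i x) ∨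
     (.tip i ∈ after c (P v) ∧ path = Pu ++ (after (.tip i) (P v)).reverse ++ s.R i x)))

/-- Step 4 of `Blossom` (apart from its last ordering condition): `xs` lists the unlabeled
vertices of `H•` for the new blossom, in an admissible order, and `f` gives their paths. The
blossoms other than the new one are those of `s`, while `s₁` is the current state. -/
def LabelRule (I : ParityInstance K U V) (s s₁ : SearchState K V) (Pu : List (Vtx V))
    (v u c d : Vtx V) (xs : List (Vtx V)) (f : Vtx V → List (Vtx V)) : Prop :=
  xs.Nodup ∧ xs.toFinset = (s₁.Hbul I s.next).filter (fun x => x ∉ s₁.labeled) ∧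
  (∀ x ∈ xs, PathRule I s s₁.P Pu v u c d x (f x)) ∧
  (∀ x ∈ xs, ∀ y ∈ xs, ∀ x' y', s₁.rho x = some x' → s₁.rho y = some y' →
    Precedes s₁.labeled y' x' → Precedes xs x y) ∧
  (∀ x ∈ xs, ∀ y ∈ xs, ∀ i, s.IsMax i → s.IsNormal I i → x ∈ s.cell I i → y ∈ s.cell I i →
    s₁.rho x = s₁.rho y → s.ord i x y → Precedes xs x y)

/-- The union of the sets `K(x)` in Step 1 of `Blossom`. -/
def blossomSet (I : ParityInstance K U V) (s : SearchState K V) (v u c d : Vtx V) :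
    Finset (Vtx V) :=
  (after c (s.P v) ++ after d (s.P u) ++ if c = d then [] else [c]).toFinset.biUnion (s.Kset I)

/-- The procedure `Blossom(v, u)` leads from the state `s` to the state `s'`. -/
def Blossom (I : ParityInstance K U V) (s : SearchState K V) (v u : Vtx V)
    (s' : SearchState K V) : Prop :=
  ∃ c d, IsLastWith (s.P v) (fun x => ∃ y ∈ s.P u, y ∈ s.Kset I x) c ∧
    IsLastWith (s.P u) (fun x => x ∈ s.Kset I c) d ∧
    let H := s.blossomSet I v u c d
    let n := s.next
    -- the new blossom contains a source line
    ((s.HasSource I H ∧ ∃ xs f,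
      LabelRule I s (s.addBlossom H) (s.P u) v u c d xs f ∧
      let s₂ := (s.addBlossom H).labelAll xs f
      s' = s₂.finishBlossom I n s₂.P) ∨
    -- the new blossom contains no source line
    (¬ s.HasSource I H ∧ ∃ r g s₀ xs f,
      (if c = d then r = c else IsLastWith (s.P v) (fun x => x ∉ H) r) ∧
      IsNextIn (s.P v) r g ∧
      AttachBud I s H r g s₀ ∧
      let s₁ := reroute s s₀ H r
      -- the path to `u` runs through the new bud and tip; for `u = r` it is `P(r) b t = P(t)`
      LabelRule I s s₁ (if u = r then s₁.P (.tip n) else s₁.P u) v u c d xs f ∧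
      (c = d → c ≠ u → ∀ h, IsNextIn (s₁.P u) (.tip n) h →
        ∀ x, ¬ (Precedes xs g x ∧ Precedes xs x h) ∧ ¬ (Precedes xs h x ∧ Precedes xs x g)) ∧
      let s₂ := s₁.labelAll xs f
      s' = s₂.finishBlossom I n fun x => after (.bud n) (s₂.P x)))

/-- Step 4 of the procedure `Graft`: the new blossom `n` takes over the dual variable of the normal
blossom `i`, and then `i` is expanded, that is, `C*` is pivoted around its bud and tip (the result
is `C'`), these two vertices are removed, and `i` is removed from the family. -/
def expandAfterGraft (s : SearchState K V) (n i : ℕ) (C' : Vtx V → Vtx V → K) :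
    SearchState K V :=
  let D : Finset (Vtx V) := {.bud i, .tip i}
  { s with
    ids := s.ids.erase i
    H := Function.update s.H n (s.H n \ D)
    Bs := symmDiff s.Bs D \ D
    C := C'
    p := fun x =>
      if x = .bud i then (if .bud i ∈ s.Bs then s.p x + s.q i else s.p x - s.q i)
      else if x = .tip n then (if .tip n ∈ s.Bs then s.p x - s.q i else s.p x + s.q i)
      else s.p x
    q := Function.update (Function.update s.q i 0) n (s.q i)
    R := Function.update s.R n fun x => (s.R n x).filter fun y => y ∉ D
    P := fun x => (s.P x).filter fun y => y ∉ D }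

/-- The procedure `Graft(v, H i)` leads from the state `s` to the state `s'`. -/
def Graft (I : ParityInstance K U V) (s : SearchState K V) (v : Vtx V) (i : ℕ)
    (s' : SearchState K V) : Prop :=
  let n := s.next
  ∃ s₁ xs C',
    AttachBud I s (insert (.bud i) (s.H i)) v (.bud i) s₁ ∧
    ListsInOrder xs (s₁.Hbul I i) (s.ord i) ∧
    let s₂ := s₁.labelAll xs fun x => s.P v ++ [.bud n, .tip n, .bud i] ++ s.R i x
    let s₃ := s₂.finishBlossom I n fun x => after (.bud n) (s₂.P x)
    IsPivot (s₃.Vstar I) s₃.Bs {.bud i, .tip i} s₃.C C' ∧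
    s' = s₃.expandAfterGraft n i C'

/-- The first elements of the paths of `v` and `u` belong to different lines. -/
def DifferentRoots (I : ParityInstance K U V) (s : SearchState K V) (v u : Vtx V) : Prop :=
  ∃ x y, (s.P v).head? = some x ∧ (s.P u).head? = some y ∧ y ≠ x ∧ y ≠ I.bar x

/-- The vertices examined in Step 3 for `v`. -/
def Cand3 (I : ParityInstance K U V) (s : SearchState K V) (v u : Vtx V) : Prop :=
  u ∈ s.labeled ∧ s.AdjT I v u ∧ s.Kset I u ≠ s.Kset I v

/-- The vertices examined in Step 4 for `v`. -/
def Cand4 (I : ParityInstance K U V) (s : SearchState K V) (v u : Vtx V) : Prop :=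
  u ∉ s.labeled ∧ s.AdjT I v u ∧ s.Kset I u ≠ s.Kset I v ∧ s.rho u = none

/-- The state after the first part of (4-1). -/
def growSingle (I : ParityInstance K U V) (s : SearchState K V) (v u : Vtx V) :
    SearchState K V :=
  { s.labelAll [I.bar u] (fun _ => s.P v ++ [u, I.bar u]) with
    rho := Function.update s.rho u (some v) }

/-- The state after (4-3), where `y` is the chosen vertex. -/
def growBlossom (I : ParityInstance K U V) (s : SearchState K V) (v : Vtx V) (i : ℕ)
    (y : Vtx V) : SearchState K V :=
  let s₁ := s.labelAll [.bud i] fun _ => s.P v ++ (s.R i y).reverse ++ [.bud i]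
  { s₁ with
    sign := Function.update s.sign i (some .minus)
    rho := fun x => if x ∈ s.Hbul I i ∧ x ∉ s.labeled then some v else s.rho x }

/-- One step of the procedure `Search`. -/
inductive Step (I : ParityInstance K U V) :
    Phase V × SearchState K V → Phase V × SearchState K V → Prop
  -- Step 1, first loop
  | labelSingle (s : SearchState K V) (x : Vtx V) :
      s.IsSource I x → s.Single I x → x ∉ s.labeled →
      Step I (.step1a, s) (.step1a, s.labelAll [x] fun _ => [x])
  | endStep1a (s : SearchState K V) :
      (∀ x, s.IsSource I x → s.Single I x → x ∈ s.labeled) →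
      Step I (.step1a, s) (.step1b, s)
  -- Step 1, second loop
  | newSource (s : SearchState K V) (x : Vtx V) :
      s.IsSource I x → s.Single I x → s.Single I (I.bar x) → s.AdjT I x (I.bar x) →
      Step I (.step1b, s)
        (.step1b, (s.addBlossom {x, I.bar x}).finishBlossom I s.next fun y => [y])
  | endStep1b (s : SearchState K V) :
      (∀ x, s.IsSource I x → s.Single I x → s.Single I (I.bar x) → ¬ s.AdjT I x (I.bar x)) →
      Step I (.step1b, s) (.step1c, s)
  -- Step 1, third loop
  | labelSource (s : SearchState K V) (i : ℕ) (xs : List (Vtx V)) :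
      s.IsMax i → s.IsSourceBlossom I i → s.sign i = none →
      ListsInOrder xs (s.Hbul I i) (s.ord i) →
      Step I (.step1c, s)
        (.step1c, { s.labelAll xs (s.R i) with
          sign := Function.update s.sign i (some .plus) })
  | endStep1c (s : SearchState K V) :
      (∀ i, s.IsMax i → s.IsSourceBlossom I i → s.sign i ≠ none) →
      Step I (.step1c, s) (.step2, s)
  -- Step 2
  | queueEmpty (s : SearchState K V) :
      s.queue = [] → Step I (.step2, s) (.returnEmpty, s)
  | dequeue (s : SearchState K V) (v : Vtx V) (l : List (Vtx V)) :
      s.queue = v :: l → Step I (.step2, s) (.step3 v, { s with queue := l })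
  -- Step 3
  | augmenting (s : SearchState K V) (v u : Vtx V) :
      s.Cand3 I v u → (∀ z, s.Cand3 I v z → ¬ Precedes s.labeled z u) →
      s.DifferentRoots I v u →
      Step I (.step3 v, s) (.returnPath (s.P v ++ (s.P u).reverse), s)
  | blossom (s s' : SearchState K V) (v u : Vtx V) :
      s.Cand3 I v u → (∀ z, s.Cand3 I v z → ¬ Precedes s.labeled z u) →
      ¬ s.DifferentRoots I v u → s.Blossom I v u s' →
      Step I (.step3 v, s) (.step3 v, s')
  | endStep3 (s : SearchState K V) (v : Vtx V) :
      (∀ u, ¬ s.Cand3 I v u) → Step I (.step3 v, s) (.step4 v, s)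
  -- Step 4, (4-1)
  | single (s : SearchState K V) (v u : Vtx V) :
      s.Cand4 I v u → s.Single I u → ¬ s.AdjT I v (I.bar u) →
      Step I (.step4 v, s) (.step4 v, s.growSingle I v u)
  | singleBlossom (s s' : SearchState K V) (v u : Vtx V) :
      s.Cand4 I v u → s.Single I u → s.AdjT I v (I.bar u) →
      (s.growSingle I v u).Blossom I (I.bar u) v s' →
      Step I (.step4 v, s) (.step4 v, s')
  -- Step 4, (4-2)
  | graft (s s' : SearchState K V) (v u : Vtx V) (i : ℕ) :
      s.Cand4 I v u → s.IsMax i → s.IsNormal I i → u ∈ s.cell I i → s.AdjT I v (.bud i) →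
      s.Graft I v i s' →
      Step I (.step4 v, s) (.step4 v, s')
  -- Step 4, (4-3)
  | growMinus (s : SearchState K V) (v u : Vtx V) (i : ℕ) (y : Vtx V) :
      s.Cand4 I v u → s.IsMax i → s.IsNormal I i → u ∈ s.cell I i → ¬ s.AdjT I v (.bud i) →
      y ∈ s.Hbul I i → s.AdjT I v y →
      (∀ z ∈ s.Hbul I i, s.AdjT I v z → ¬ s.ord i z y) →
      Step I (.step4 v, s) (.step4 v, s.growBlossom I v i y)
  -- Step 5
  | endStep4 (s : SearchState K V) (v : Vtx V) :
      (∀ u, ¬ s.Cand4 I v u) → Step I (.step4 v, s) (.step2, s)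

/-- `Search`, called on the data `c`, returns `∅`, and `s` is its final state. -/
def ReturnsEmpty (I : ParityInstance K U V) (c : Config K V) (s : SearchState K V) : Prop :=
  ∃ s₀ : SearchState K V, s₀.IsStart c ∧
    Relation.ReflTransGen (Step I) (.step1a, s₀) (.returnEmpty, s)

/-! ### The step size of the dual update -/

/-- The set `R` of vertices that are reached (labeled) or examined (`ρ` is assigned) and that lie in
no blossom. -/
def Reached (I : ParityInstance K U V) (s : SearchState K V) : Set (Vtx V) :=
  {x | x ∈ s.Vstar I ∧ (x ∈ s.labeled ∨ s.rho x ≠ none) ∧ ∀ i ∈ s.ids, x ∉ s.H i}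

/-- `R⁺`, the labeled vertices in `R`. -/
def Rplus (I : ParityInstance K U V) (s : SearchState K V) : Set (Vtx V) :=
  {x | x ∈ s.Reached I ∧ x ∈ s.labeled}

/-- `Z`, the set of vertices in labeled blossoms. -/
def Z (s : SearchState K V) : Set (Vtx V) :=
  {x | ∃ i ∈ s.ids, s.sign i ≠ none ∧ x ∈ s.H i}

/-- `Z⁺`, the union of the maximal blossoms labeled with `⊕`. -/
def Zplus (s : SearchState K V) : Set (Vtx V) :=
  {x | ∃ i, s.IsMax i ∧ s.sign i = some .plus ∧ x ∈ s.H i}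

/-- `Y = V* \ (R ∪ Z)`. -/
def Y (I : ParityInstance K U V) (s : SearchState K V) : Set (Vtx V) :=
  {x | x ∈ s.Vstar I ∧ x ∉ s.Reached I ∧ x ∉ s.Z}

/-- The slack `p(v) - p(u) - Q_{uv}`. -/
def slack (s : SearchState K V) (e : Vtx V × Vtx V) : ℝ :=
  s.p e.2 - s.p e.1 - s.Q e.1 e.2

/-- `ε₁`. Minima over empty sets are `+∞`, as everywhere below. -/
def eps1 (I : ParityInstance K U V) (s : SearchState K V) : EReal :=
  sInf {r | ∃ e ∈ s.Fstar I, e.1 ∈ s.Rplus I ∪ s.Zplus ∧ e.2 ∈ s.Rplus I ∪ s.Zplus ∧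
    s.Kset I e.1 ≠ s.Kset I e.2 ∧ r = ((1 / 2 * s.slack e : ℝ) : EReal)}

/-- `ε₂`. -/
def eps2 (I : ParityInstance K U V) (s : SearchState K V) : EReal :=
  sInf {r | ∃ e ∈ s.Fstar I, e.1 ∈ s.Rplus I ∪ s.Zplus ∧ e.2 ∈ s.Y I ∧
    r = (s.slack e : EReal)}

/-- `ε₃`. -/
def eps3 (I : ParityInstance K U V) (s : SearchState K V) : EReal :=
  sInf {r | ∃ e ∈ s.Fstar I, e.1 ∈ s.Y I ∧ e.2 ∈ s.Rplus I ∪ s.Zplus ∧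
    r = (s.slack e : EReal)}

/-- `ε₄`. -/
def eps4 (s : SearchState K V) : EReal :=
  sInf {r | ∃ i, s.IsMax i ∧ s.sign i = some .minus ∧ r = (s.q i : EReal)}

/-- The step size `ε` of the dual update. -/
def eps (I : ParityInstance K U V) (s : SearchState K V) : EReal :=
  min (min (s.eps1 I) (s.eps2 I)) (min (s.eps3 I) s.eps4)

end SearchState

end MatroidParity

end

/-!
If the step size is infinite, then the final state of the search certifies that there is no parity
base. The dual variables matter only because every edge of `F*` joining two explored nodes, or an
explored node and an untouched one, would bound the step size. What remains is a counting argument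
of Tutte–Berge type in the graph of `F*`, which rests on invariants of the search.

*Matchings.* The matrix `C*` determines the kernel of `(1 C*)`, and this kernel is unchanged by
pivoting (`IsPivot.inKer_iff`). `Represents` states that the matroid of `A` can be read off from
that kernel; it holds for admissible data and survives attaching a bud and a tip
(`AttachBud.represents`). If `B'` is a base, then the set `W` of all buds, all tips and the
vertices in exactly one of `B` and `B'` therefore indexes a nonsingular submatrix, so the edges of
`F*` contain a perfect matching of `W` (`Invariant.exists_matching`). If `B'` is moreover a parity
base, then `W` contains both or none of the vertices of every line and dummy line, except for the
source lines, of which it contains one vertex (`ParitySet`).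

*Invariants.* The vertices form nodes: the maximal blossoms together with their buds, and the single
lines. The paths `P` form a search forest on the nodes, whose roots are the nodes with a source line
(`PathSys`). An edge between two labeled vertices of different nodes closes a cycle in the forest
(`Fork`), and both `Blossom` and `Graft` merge nodes of the forest into one (`Merge`); in either
case the new blossom has edges to the outside only at its labeled vertices and at its bud. The
resulting `Invariant` holds in every state of the search (`ReturnsEmpty.invariant`).

*Counting.* If the step size is infinite, then the edges of `F*` that leave an explored node end in
the `Barrier`, which consists of the buds of the blossoms labeled `⊕` and of the examined vertices
of single lines (`Invariant.barrier_of_adj`). Every such vertex in `W` comes with an odd component,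
represented by the tip of the blossom or by the mate, and every source line is in an odd component
that has no vertex in the barrier (`OddRep`). A perfect matching of `W` would send the odd
components injectively to the vertices of the barrier in `W`. There are fewer of the latter if there
is a source line (`Invariant.no_perfect_matching`).
-/

set_option linter.unusedSectionVars false

namespace MatroidParity

open scoped Classical

/-! ### Sequences -/

theorem after_append_cons {X : Type*} {r : X} {l₁ l₂ : List X} (h : r ∉ l₁) :
    after r (l₁ ++ r :: l₂) = l₂ := by
  unfold after
  rw [List.dropWhile_append_of_pos (fun a ha => by
    simp only [ne_eq, decide_eq_true_eq]; rintro rfl; exact h ha)]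
  simp

theorem after_of_notMem {X : Type*} {r : X} {l : List X} (h : r ∉ l) : after r l = [] := by
  unfold after
  rw [List.dropWhile_eq_nil_iff.2 (fun a ha => by
    simp only [ne_eq, decide_eq_true_eq]; rintro rfl; exact h ha)]
  rfl

theorem after_append {X : Type*} {r : X} {l₁ l₂ : List X} (hn : (l₁ ++ l₂).Nodup)
    (hl : l₁.getLast? = some r) : after r (l₁ ++ l₂) = l₂ := by
  obtain ⟨l, rfl⟩ := List.getLast?_eq_some_iff.1 hl
  rw [List.append_assoc, List.singleton_append] at hn ⊢
  refine after_append_cons fun h => ?_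
  rw [List.nodup_append] at hn
  exact hn.2.2 r h r (by simp) rfl

/-- Dropping a prefix without `r` does not change the part after `r`. -/
theorem after_append_right {X : Type*} {r : X} {l₁ l₂ : List X} (h : r ∉ l₁) :
    after r (l₁ ++ l₂) = after r l₂ := by
  unfold after
  rw [List.dropWhile_append_of_pos (fun a ha => by
    simp only [ne_eq, decide_eq_true_eq]; rintro rfl; exact h ha)]

theorem mem_split_after {X : Type*} {r : X} {l : List X} (h : r ∈ l) :
    ∃ l₁, r ∉ l₁ ∧ l = l₁ ++ r :: after r l := by
  obtain ⟨l₁, l₂, rfl, h1⟩ := List.eq_append_cons_of_mem h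
  exact ⟨l₁, h1, by rw [after_append_cons h1]⟩

theorem mem_of_mem_after {X : Type*} {r y : X} {l : List X} (h : y ∈ after r l) : y ∈ l := by
  by_cases hr : r ∈ l
  · obtain ⟨l₁, -, e⟩ := mem_split_after hr
    rw [e]; simp [h]
  · rw [after_of_notMem hr] at h; simp at h

theorem nodup_cons_after {X : Type*} {r : X} {l : List X} (h : l.Nodup) :
    (r :: after r l).Nodup := by
  by_cases hr : r ∈ l
  · obtain ⟨l₁, -, e⟩ := mem_split_after hr
    rw [e] at h
    exact (List.nodup_append.1 h).2.1
  · rw [after_of_notMem hr]; simp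

theorem IsLastWith.mem {X : Type*} {l : List X} {Q : X → Prop} {a : X} (h : IsLastWith l Q a) :
    a ∈ l := by
  obtain ⟨l₁, l₂, rfl, -⟩ := h; simp

theorem IsLastWith.holds {X : Type*} {l : List X} {Q : X → Prop} {a : X}
    (h : IsLastWith l Q a) : Q a := by
  obtain ⟨l₁, l₂, rfl, h, -⟩ := h; exact h

theorem IsLastWith.congr {X : Type*} {l : List X} {Q Q' : X → Prop} {a : X}
    (h : IsLastWith l Q a) (hQ : ∀ x ∈ l, Q x ↔ Q' x) : IsLastWith l Q' a := by
  obtain ⟨l₁, l₂, rfl, h, h'⟩ := h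
  exact ⟨l₁, l₂, rfl, (hQ _ (by simp)).1 h,
    fun x hx hx' => h' x hx ((hQ _ (by simp [hx])).2 hx')⟩

/-- The last element of `l` with property `Q` is the last element of a prefix after which `Q`
fails. -/
theorem IsLastWith.eq_of_append {X : Type*} {l A B : List X} {Q : X → Prop} {a w : X}
    (h : IsLastWith l Q a) (e : l = A ++ B) (hA : A.getLast? = some w) (hw : Q w)
    (hB : ∀ x ∈ B, ¬ Q x) : a = w := by
  obtain ⟨l₁, l₂, rfl, ha, h'⟩ := h
  obtain ⟨A', rfl⟩ := List.getLast?_eq_some_iff.1 hA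
  rw [List.append_assoc, List.singleton_append] at e
  rcases List.append_eq_append_iff.1 e with ⟨x, rfl, e'⟩ | ⟨x, rfl, e'⟩
  · cases x with
    | nil => simp at e'; exact e'.1
    | cons y x =>
      simp at e'
      exact absurd hw (h' w (by rw [e'.2]; simp))
  · cases x with
    | nil => simp at e'; exact e'.1.symm
    | cons y x =>
      simp at e'
      exact absurd ha (hB a (by rw [e'.2]; simp))

theorem getLast?_append_eq {X : Type*} {l₁ l₂ : List X} {x : X} (h : l₂.getLast? = some x) :
    (l₁ ++ l₂).getLast? = some x := by
  rw [List.getLast?_append, h]; rfl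

theorem mem_of_last {X : Type*} {l : List X} {x : X} (h : l.getLast? = some x) : x ∈ l :=
  List.mem_of_getLast? h

/-! ### Search forests -/

/-- The forest structure of the labeling. Vertices satisfying `W` are partitioned into nodes by
`κ`; the nodes satisfying `src` are the roots. The path `P x` of a labeled vertex `x` (those with
`L x`) ends in `x`. If the node of `x` is a root, then `P x` stays in it; otherwise it consists of
the path of the labeled vertex `par x`, which depends only on the node of `x`, and of vertices of
the node of `x`. The rank `rk` witnesses that the forest is well-founded. -/
structure PathSys {X N : Type*} (W : X → Prop) (κ : X → N) (src L : X → Prop)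
    (P : X → List X) (par : X → X) (rk : X → ℕ) : Prop where
  mem_W : ∀ x, L x → ∀ y ∈ P x, W y
  src_congr : ∀ x y, W x → W y → κ x = κ y → src x → src y
  rk_congr : ∀ x y, W x → W y → κ x = κ y → rk x = rk y
  par_congr : ∀ x y, W x → W y → κ x = κ y → par x = par y
  nodup : ∀ x, L x → (P x).Nodup
  last : ∀ x, L x → (P x).getLast? = some x
  root : ∀ x, L x → src x → ∀ y ∈ P x, κ y = κ x
  step : ∀ x, L x → ¬ src x → L (par x) ∧ rk (par x) < rk x ∧
    ∃ l, P x = P (par x) ++ l ∧ ∀ y ∈ l, κ y = κ x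

namespace PathSys

variable {X N : Type*} {W : X → Prop} {κ : X → N} {src L : X → Prop}
    {P : X → List X} {par : X → X} {rk : X → ℕ}

theorem self_mem (h : PathSys W κ src L P par rk) {x : X} (hx : L x) : x ∈ P x :=
  mem_of_last (h.last x hx)

theorem self_W (h : PathSys W κ src L P par rk) {x : X} (hx : L x) : W x :=
  h.mem_W x hx x (h.self_mem hx)

theorem eq_of_path_eq (h : PathSys W κ src L P par rk) {x y : X} (hx : L x) (hy : L y)
    (e : P x = P y) : x = y := by
  have h1 := h.last x hx
  rw [e, h.last y hy] at h1
  exact (Option.some.inj h1).symm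

theorem rk_le (h : PathSys W κ src L P par rk) {x y : X} (hx : L x) (hy : y ∈ P x) :
    rk y ≤ rk x := by
  induction hn : rk x using Nat.strong_induction_on generalizing x with
  | _ n ih =>
    subst hn
    by_cases hs : src x
    · exact (h.rk_congr y x (h.mem_W x hx y hy) (h.self_W hx) (h.root x hx hs y hy)).le
    · obtain ⟨h1, h2, l, h3, h4⟩ := h.step x hx hs
      rw [h3, List.mem_append] at hy
      rcases hy with hy' | hy'
      · exact (ih _ h2 h1 hy' rfl).trans h2.le
      · exact (h.rk_congr y x (h.mem_W x hx y (by rw [h3]; simp [hy'])) (h.self_W hx)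
          (h4 y hy')).le

/-- A path that meets a node contains the path of a labeled vertex of the node as a prefix, and
leaves the node for good after it. -/
theorem exists_prefix (h : PathSys W κ src L P par rk) {x y : X} (hx : L x) (hy : y ∈ P x) :
    ∃ x', L x' ∧ κ x' = κ y ∧ ∃ l, P x = P x' ++ l ∧ ∀ z ∈ l, rk y < rk z := by
  induction hn : rk x using Nat.strong_induction_on generalizing x with
  | _ n ih =>
    subst hn
    by_cases hs : src x
    · exact ⟨x, hx, (h.root x hx hs y hy).symm, [], by simp, by simp⟩
    · obtain ⟨h1, h2, l, h3, h4⟩ := h.step x hx hs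
      have hy0 := hy
      rw [h3, List.mem_append] at hy
      rcases hy with hy' | hy'
      · obtain ⟨x', hx', e, l', e', hl'⟩ := ih _ h2 h1 hy' rfl
        refine ⟨x', hx', e, l' ++ l, by rw [h3, e', List.append_assoc], fun z hz => ?_⟩
        rcases List.mem_append.1 hz with hz | hz
        · exact hl' z hz
        · rw [h.rk_congr z x (h.mem_W x hx z (by rw [h3]; simp [hz])) (h.self_W hx) (h4 z hz)]
          exact (h.rk_le h1 hy').trans_lt h2
      · exact ⟨x, hx, (h4 y hy').symm, [], by simp, by simp⟩

/-- The last vertices `c` and `d` of two paths in their last common node: the two paths extend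
those of `c` and `d`, and the extensions share no node with the other path. -/
theorem last_common (h : PathSys W κ src L P par rk) {v u c d : X} (hv : L v) (hu : L u)
    (hc : IsLastWith (P v) (fun x => ∃ y ∈ P u, κ y = κ x) c)
    (hd : IsLastWith (P u) (fun x => κ x = κ c) d) :
    L c ∧ L d ∧ ∃ l₁ l₂, P v = P c ++ l₁ ∧ P u = P d ++ l₂ ∧
      (∀ z ∈ l₁, rk c < rk z) ∧ (∀ z ∈ l₂, rk c < rk z) ∧
      (∀ z ∈ l₁, ∀ y ∈ P u, κ y ≠ κ z) ∧ (∀ z ∈ l₂, ∀ y ∈ P v, κ y ≠ κ z) := by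
  obtain ⟨y0, hy0, ey0⟩ := hc.holds
  obtain ⟨c', Lc', kc', l₁, e1, hl1⟩ := h.exists_prefix hv hc.mem
  have hWc : W c := h.mem_W v hv c hc.mem
  obtain ⟨d', Ld', kd', l₂, e2, hl2⟩ := h.exists_prefix hu hd.mem
  have hdk : κ d = κ c := hd.holds
  have hWd : W d := h.mem_W u hu d hd.mem
  have rdc : rk d = rk c := h.rk_congr _ _ hWd hWc hdk
  have hd' : d = d' := by
    refine hd.eq_of_append e2 (h.last _ Ld') (kd'.trans hdk) fun x hx hxe => ?_
    have := hl2 x hx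
    rw [rdc, h.rk_congr x c (h.mem_W u hu x (by rw [e2]; simp [hx])) hWc hxe] at this
    exact lt_irrefl _ this
  subst hd'
  obtain ⟨m₁, m₂, em, -, hm⟩ := hc
  -- `c'` follows every vertex of the node of `c`, so it is `c` itself
  have hcc : c = c' := by
    have hne : c ∉ l₁ := fun hc' => lt_irrefl _ (hl1 c hc')
    have hm2 : c' ∉ m₂ := fun hc' => hm c' hc' ⟨y0, hy0, ey0.trans kc'.symm⟩
    obtain ⟨p, hp⟩ := List.getLast?_eq_some_iff.1 (h.last _ Lc')
    have := e1
    rw [hp, em, List.append_assoc, List.singleton_append] at this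
    rcases List.append_eq_append_iff.1 this with ⟨x, rfl, e'⟩ | ⟨x, rfl, e'⟩
    · cases x with
      | nil => simp at e'; exact e'.1
      | cons y x => simp at e'; exact absurd (by rw [e'.2]; simp) hm2
    · cases x with
      | nil => simp at e'; exact e'.1.symm
      | cons y x => simp at e'; exact absurd (by rw [e'.2]; simp) hne
  subst hcc
  have hm2 : m₂ = l₁ := by
    have n := h.nodup v hv
    have a1 := after_append (e1 ▸ n) (h.last _ Lc')
    rw [← e1, em] at a1
    rw [em] at n
    rw [after_append_cons] at a1
    · exact a1
    · intro hc
      exact (List.nodup_append.1 n).2.2 c hc c (by simp) rfl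
  subst hm2
  refine ⟨Lc', Ld', m₂, l₂, e1, e2, hl1, fun z hz => rdc ▸ hl2 z hz,
    fun z hz y hy e => hm z hz ⟨y, hy, e⟩, fun z hz y hy e => ?_⟩
  rw [e1, List.mem_append] at hy
  have hWz : W z := h.mem_W u hu z (by rw [e2]; simp [hz])
  have hWy : W y := h.mem_W v hv y (by rw [e1]; simpa using hy)
  rcases hy with hy | hy
  · have := h.rk_le Lc' hy
    rw [h.rk_congr y z hWy hWz e] at this
    have := hl2 z hz
    omega
  · exact hm y hy ⟨z, by rw [e2]; simp [hz], e.symm⟩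

/-- If `P v` extends `P r` inside of a union `S` of nodes that lie strictly below the node of `r`,
then so do the paths of all labeled vertices in the nodes that the extension visits. -/
theorem exists_extension (h : PathSys W κ src L P par rk) {S : X → Prop} {r v x z : X}
    {m : List X} (hr : L r) (hv : L v) (hx : L x) (e : P v = P r ++ m) (hm : ∀ y ∈ m, S y)
    (hS : ∀ y y', W y → W y' → κ y = κ y' → S y → S y') (hrk : ∀ y, S y → rk r < rk y)
    (hsrc : ∀ y, S y → ¬ src y) (hz : z ∈ m) (hxz : κ x = κ z) :
    ∃ q, P x = P r ++ q ∧ ∀ y ∈ q, S y := by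
  have hzP : z ∈ P v := by rw [e]; simp [hz]
  have Wz := h.mem_W v hv z hzP
  have Wx := h.self_W hx
  have Sx : S x := hS z x Wz Wx hxz.symm (hm z hz)
  obtain ⟨v', Lv', kv', l, el, -⟩ := h.exists_prefix hv hzP
  have Wv' := h.self_W Lv'
  have Sv' : S v' := hS z v' Wz Wv' kv'.symm (hm z hz)
  have hp : par v' = par x := h.par_congr _ _ Wv' Wx (kv'.trans hxz.symm)
  obtain ⟨Lp, rp, s, es, hs⟩ := h.step v' Lv' (hsrc _ Sv')
  obtain ⟨-, -, sx, esx, hsx⟩ := h.step x hx (hsrc _ Sx)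
  have hsxS : ∀ y ∈ sx, S y := fun y hy =>
    hS x y Wx (h.mem_W x hx y (by rw [esx]; simp [hy])) (hsx y hy).symm Sx
  have hs0 : s ≠ [] := by
    rintro rfl
    rw [List.append_nil] at es
    have := h.eq_of_path_eq Lv' Lp es
    rw [← this] at rp
    exact lt_irrefl _ rp
  have key : P r ++ m = P (par v') ++ (s ++ l) := by rw [← e, el, es, List.append_assoc]
  rcases List.append_eq_append_iff.1 key with ⟨a, ea, em⟩ | ⟨a, ea, em⟩
  · refine ⟨a ++ sx, by rw [esx, ← hp, ea, List.append_assoc], fun y hy => ?_⟩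
    rcases List.mem_append.1 hy with hy | hy
    · exact hm y (by rw [em]; simp [hy])
    · exact hsxS y hy
  · cases a with
    | nil =>
      rw [List.append_nil] at ea
      exact ⟨sx, by rw [esx, ← hp, ea], hsxS⟩
    | cons a0 a =>
      exfalso
      obtain ⟨s0, s', rfl⟩ := List.exists_cons_of_ne_nil hs0
      simp only [List.cons_append, List.cons.injEq] at em
      obtain ⟨rfl, -⟩ := em
      have h1 : s0 ∈ P r := by rw [ea]; simp
      have h2 := h.rk_le hr h1
      have h3 := hrk s0 (hS v' s0 Wv' (h.mem_W r hr _ h1) (hs s0 (by simp)).symm Sv')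
      omega

end PathSys

/-! ### Changing a search forest -/

namespace PathSys

variable {X N N' : Type*} {W W' : X → Prop} {κ : X → N} {κ' : X → N'} {src src' L L' : X → Prop}
    {P P' : X → List X} {par : X → X} {rk : X → ℕ}

theorem congr_nodes (h : PathSys W κ src L P par rk)
    (hκ : ∀ x y, W x → W y → (κ' x = κ' y ↔ κ x = κ y)) (hsrc : ∀ x, W x → (src' x ↔ src x)) :
    PathSys W κ' src' L P par rk where
  mem_W := h.mem_W
  src_congr x y hx hy e hs := by
    rw [hsrc _ hx] at hs; rw [hsrc _ hy]
    exact h.src_congr x y hx hy ((hκ x y hx hy).1 e) hs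
  rk_congr x y hx hy e := h.rk_congr x y hx hy ((hκ x y hx hy).1 e)
  par_congr x y hx hy e := h.par_congr x y hx hy ((hκ x y hx hy).1 e)
  nodup := h.nodup
  last := h.last
  root x hx hs y hy := (hκ y x (h.mem_W x hx y hy) (h.self_W hx)).2
    (h.root x hx ((hsrc x (h.self_W hx)).1 hs) y hy)
  step x hx hs := by
    obtain ⟨h1, h2, l, h3, h4⟩ := h.step x hx (fun h' => hs ((hsrc x (h.self_W hx)).2 h'))
    exact ⟨h1, h2, l, h3, fun y hy => (hκ y x (h.mem_W x hx y (by rw [h3]; simp [hy]))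
      (h.self_W hx)).2 (h4 y hy)⟩

theorem add_roots (h : PathSys W κ src L P par rk) (hL : ∀ x, L x → L' x)
    (hP : ∀ x, L x → P' x = P x)
    (hnew : ∀ x, L' x → ¬ L x → src x ∧ (P' x).Nodup ∧ (P' x).getLast? = some x ∧
      ∀ y ∈ P' x, W y ∧ κ y = κ x) :
    PathSys W κ src L' P' par rk where
  mem_W x hx y hy := by
    by_cases hl : L x
    · rw [hP x hl] at hy; exact h.mem_W x hl y hy
    · exact ((hnew x hx hl).2.2.2 y hy).1
  src_congr := h.src_congr
  rk_congr := h.rk_congr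
  par_congr := h.par_congr
  nodup x hx := by
    by_cases hl : L x
    · rw [hP x hl]; exact h.nodup x hl
    · exact (hnew x hx hl).2.1
  last x hx := by
    by_cases hl : L x
    · rw [hP x hl]; exact h.last x hl
    · exact (hnew x hx hl).2.2.1
  root x hx hs y hy := by
    by_cases hl : L x
    · rw [hP x hl] at hy; exact h.root x hl hs y hy
    · exact ((hnew x hx hl).2.2.2 y hy).2
  step x hx hs := by
    by_cases hl : L x
    · obtain ⟨h1, h2, l, h3, h4⟩ := h.step x hl hs
      exact ⟨hL _ h1, h2, l, by rw [hP x hl, hP _ h1, h3], h4⟩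
    · exact absurd (hnew x hx hl).1 hs

/-- A node without labeled vertices becomes a child of the node of `v`. -/
theorem grow (h : PathSys W κ src L P par rk) {x₀ v : X} {l : List X} (hv : L v)
    (hsrc : ¬ src x₀) (hL : ∀ x, L' x ↔ L x ∨ x = x₀) (hP : ∀ x, L x → P' x = P x)
    (h0 : ∀ x, L x → κ x ≠ κ x₀) (hW : W x₀)
    (hx₀ : P' x₀ = P v ++ l) (hn : (P' x₀).Nodup) (hlast : (P' x₀).getLast? = some x₀)
    (hl : ∀ y ∈ l, W y ∧ κ y = κ x₀) :
    PathSys W κ src L' P' (fun x => if κ x = κ x₀ then v else par x)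
      (fun x => if κ x = κ x₀ then rk v + 1 else rk x) where
  mem_W x hx y hy := by
    rcases (hL x).1 hx with hx | rfl
    · rw [hP x hx] at hy; exact h.mem_W x hx y hy
    · rw [hx₀, List.mem_append] at hy
      rcases hy with hy | hy
      · exact h.mem_W v hv y hy
      · exact (hl y hy).1
  src_congr := h.src_congr
  rk_congr x y hx hy e := by
    simp only [e, h.rk_congr x y hx hy e]
  par_congr x y hx hy e := by
    simp only [e, h.par_congr x y hx hy e]
  nodup x hx := by
    rcases (hL x).1 hx with hx | rfl
    · rw [hP x hx]; exact h.nodup x hx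
    · exact hn
  last x hx := by
    rcases (hL x).1 hx with hx | rfl
    · rw [hP x hx]; exact h.last x hx
    · exact hlast
  root x hx hs y hy := by
    rcases (hL x).1 hx with hx | rfl
    · rw [hP x hx] at hy; exact h.root x hx hs y hy
    · exact absurd hs hsrc
  step x hx hs := by
    rcases (hL x).1 hx with hx | rfl
    · obtain ⟨h1, h2, l, h3, h4⟩ := h.step x hx hs
      simp only [h0 x hx, if_false, h0 _ h1]
      exact ⟨(hL _).2 (Or.inl h1), h2, l, by rw [hP x hx, hP _ h1, h3], h4⟩
    · simp only [if_true, h0 v hv, if_false]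
      exact ⟨(hL _).2 (Or.inl hv), Nat.lt_succ_self _, l, by rw [hx₀, hP v hv],
        fun y hy => (hl y hy).2⟩

/-- A union `D` of nodes that contains a root becomes a single root. -/
theorem merge_root (h : PathSys W κ src L P par rk) {D : X → Prop} {c : X}
    (hκ : ∀ x y, W x → W y → (κ' x = κ' y ↔ (D x ∧ D y) ∨ (¬ D x ∧ ¬ D y ∧ κ x = κ y)))
    (hD : ∀ x y, W x → W y → κ x = κ y → D x → D y)
    (hsrc : ∀ x, W x → (src' x ↔ D x ∨ src x))
    (hL : ∀ x, L x → L' x) (hL' : ∀ x, L' x → ¬ D x → L x)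
    (hmem : ∀ x, L' x → ∀ y ∈ P' x, W y)
    (hrk : ∀ x, L x → D x → rk c ≤ rk x)
    (hP : ∀ x, L x → P' x = P x)
    (hnew : ∀ x, L' x → D x → (P' x).Nodup ∧ (P' x).getLast? = some x ∧ ∀ y ∈ P' x, D y) :
    PathSys W κ' src' L' P' (fun x => if D x then c else par x)
      (fun x => if D x then rk c else rk x) := by
  have hWx : ∀ x, L' x → W x := fun x hx => by
    by_cases hd : D x
    · exact hmem x hx x (mem_of_last (hnew x hx hd).2.1)
    · exact h.self_W (hL' x hx hd)
  refine ⟨hmem, fun x y hx hy e hs => ?_, fun x y hx hy e => ?_, ?_, fun x hx => ?_,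
    fun x hx => ?_, fun x hx hs y hy => ?_, fun x hx hs => ?_⟩
  · rw [hsrc _ hx] at hs
    rw [hsrc _ hy]
    rcases (hκ x y hx hy).1 e with e | ⟨e1, e2, e3⟩
    · exact Or.inl e.2
    · exact Or.inr (h.src_congr x y hx hy e3 (hs.resolve_left e1))
  · rcases (hκ x y hx hy).1 e with e | ⟨e1, e2, e3⟩
    · simp [e.1, e.2]
    · simp [e1, e2, h.rk_congr x y hx hy e3]
  · intro x y hx hy e
    rcases (hκ x y hx hy).1 e with e | ⟨e1, e2, e3⟩
    · simp [e.1, e.2]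
    · simp [e1, e2, h.par_congr x y hx hy e3]
  · by_cases hd : D x
    · exact (hnew x hx hd).1
    · rw [hP x (hL' x hx hd)]; exact h.nodup x (hL' x hx hd)
  · by_cases hd : D x
    · exact (hnew x hx hd).2.1
    · rw [hP x (hL' x hx hd)]; exact h.last x (hL' x hx hd)
  · have Wy := hmem x hx y hy
    rw [hκ y x Wy (hWx x hx)]
    by_cases hd : D x
    · exact Or.inl ⟨(hnew x hx hd).2.2 y hy, hd⟩
    · have hx' := hL' x hx hd
      rw [hP x hx'] at hy
      have e := h.root x hx' (((hsrc x (hWx x hx)).1 hs).resolve_left hd) y hy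
      exact Or.inr ⟨fun hd' => hd (hD y x Wy (hWx x hx) e hd'), hd, e⟩
  · rw [hsrc x (hWx x hx), not_or] at hs
    have hx' := hL' x hx hs.1
    obtain ⟨h1, h2, l, h3, h4⟩ := h.step x hx' hs.2
    simp only [hs.1, if_false]
    refine ⟨hL _ h1, ?_, l, by rw [hP x hx', hP _ h1, h3], fun y hy => ?_⟩
    · split_ifs with hd
      · exact (hrk _ h1 hd).trans_lt h2
      · exact h2
    · have Wy := h.mem_W x hx' y (by rw [h3]; simp [hy])
      exact (hκ y x Wy (hWx x hx)).2 (Or.inr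
        ⟨fun hd' => hs.1 (hD y x Wy (hWx x hx) (h4 y hy) hd'), hs.1, h4 y hy⟩)

/-- The vertices of a set `D` become a single node that is a child of the node of `r`, and the paths
that meet `D` are rerouted from `r` through the sequence `pre` of new vertices of this node. -/
theorem merge_child (h : PathSys W κ src L P par rk) {D : X → Prop} {r : X} {pre : List X}
    (hr : L r) (hrD : ∀ y ∈ P r, ¬ D y)
    (hpre : pre.Nodup ∧ ∀ y ∈ pre, D y ∧ W' y ∧ ¬ W y)
    (hκ : ∀ x y, W' x → W' y → (κ' x = κ' y ↔ (D x ∧ D y) ∨ (¬ D x ∧ ¬ D y ∧ κ x = κ y)))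
    (hD : ∀ x y, W x → W y → W' x → W' y → κ x = κ y → D x → D y)
    (hW : ∀ x, W' x → ¬ D x → W x)
    (hsrc : ∀ x, W' x → (src' x ↔ ¬ D x ∧ src x))
    (hL : ∀ x, L x → L' x) (hL' : ∀ x, L' x → ¬ D x → L x)
    (hmem : ∀ x, L x → ∀ y ∈ P x, W' y)
    (hrk : ∀ x, L x → D x → rk r < rk x)
    (hP1 : ∀ x, L x → (∀ y ∈ P x, ¬ D y) → P' x = P x)
    (hP2 : ∀ x, L x → (∃ y ∈ P x, D y) → ∃ q, P x = P r ++ q ∧ P' x = P r ++ pre ++ q)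
    (hnew : ∀ x, L' x → D x → W' x ∧ (P' x).Nodup ∧ (P' x).getLast? = some x ∧
      ∃ q, P' x = P r ++ q ∧ ∀ y ∈ q, W' y ∧ D y) :
    PathSys W' κ' src' L' P' (fun x => if D x then r else par x)
      (fun x => if D x then rk r + 1 else rk x) := by
  have hWx : ∀ x, L' x → W' x := fun x hx => by
    by_cases hd : D x
    · exact (hnew x hx hd).1
    · exact hmem x (hL' x hx hd) x (h.self_mem (hL' x hx hd))
  have hPr : P' r = P r := hP1 r hr hrD
  have hmem' : ∀ x, L' x → ∀ y ∈ P' x, W' y := by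
    intro x hx y hy
    by_cases hd : D x
    · obtain ⟨-, -, -, q, e, hq⟩ := hnew x hx hd
      rw [e, List.mem_append] at hy
      exact hy.elim (hmem r hr y) fun hy => (hq y hy).1
    · have hx' := hL' x hx hd
      by_cases hm : ∃ y ∈ P x, D y
      · obtain ⟨q, e1, e2⟩ := hP2 x hx' hm
        rw [e2, List.mem_append, List.mem_append] at hy
        rcases hy with (hy | hy) | hy
        · exact hmem r hr y hy
        · exact (hpre.2 y hy).2.1
        · exact hmem x hx' y (by rw [e1]; simp [hy])
      · rw [hP1 x hx' (by push Not at hm; exact hm)] at hy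
        exact hmem x hx' y hy
  refine ⟨hmem', fun x y hx hy e hs => ?_, fun x y hx hy e => ?_, fun x y hx hy e => ?_,
    fun x hx => ?_, fun x hx => ?_, fun x hx hs y hy => ?_, fun x hx hs => ?_⟩
  · rw [hsrc _ hx] at hs
    rw [hsrc _ hy]
    rcases (hκ x y hx hy).1 e with e | ⟨e1, e2, e3⟩
    · exact absurd e.1 hs.1
    · exact ⟨e2, h.src_congr x y (hW x hx e1) (hW y hy e2) e3 hs.2⟩
  · rcases (hκ x y hx hy).1 e with e | ⟨e1, e2, e3⟩
    · simp [e.1, e.2]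
    · simp [e1, e2, h.rk_congr x y (hW x hx e1) (hW y hy e2) e3]
  · rcases (hκ x y hx hy).1 e with e | ⟨e1, e2, e3⟩
    · simp [e.1, e.2]
    · simp [e1, e2, h.par_congr x y (hW x hx e1) (hW y hy e2) e3]
  · by_cases hd : D x
    · exact (hnew x hx hd).2.1
    · have hx' := hL' x hx hd
      by_cases hm : ∃ y ∈ P x, D y
      · obtain ⟨q, e1, e2⟩ := hP2 x hx' hm
        have hn := h.nodup x hx'
        have hWP := h.mem_W x hx'
        rw [e1] at hn hWP
        rw [e2]
        simp only [List.nodup_append, List.mem_append] at hn ⊢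
        refine ⟨⟨hn.1, hpre.1, ?_⟩, hn.2.1, ?_⟩
        · rintro a ha b hb rfl
          exact (hpre.2 a hb).2.2 (hWP a (by simp [ha]))
        · rintro a (ha | ha) b hb rfl
          · exact hn.2.2 a ha a hb rfl
          · exact (hpre.2 a ha).2.2 (hWP a (by simp [hb]))
      · rw [hP1 x hx' (by push Not at hm; exact hm)]
        exact h.nodup x hx'
  · by_cases hd : D x
    · exact (hnew x hx hd).2.2.1
    · have hx' := hL' x hx hd
      by_cases hm : ∃ y ∈ P x, D y
      · obtain ⟨q, e1, e2⟩ := hP2 x hx' hm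
        have hl := h.last x hx'
        have hq : q ≠ [] := by
          rintro rfl
          obtain ⟨y, hy, hy'⟩ := hm
          rw [e1, List.append_nil] at hy
          exact hrD y hy hy'
        rw [e2, List.getLast?_append_of_ne_nil _ hq]
        rwa [e1, List.getLast?_append_of_ne_nil _ hq] at hl
      · rw [hP1 x hx' (by push Not at hm; exact hm)]
        exact h.last x hx'
  · rw [hsrc x (hWx x hx)] at hs
    have hx' := hL' x hx hs.1
    have hm : ∀ y ∈ P x, ¬ D y := fun y hy hd =>
      hs.1 (hD y x (h.mem_W x hx' y hy) (h.self_W hx') (hmem x hx' y hy) (hWx x hx)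
        (h.root x hx' hs.2 y hy) hd)
    rw [hP1 x hx' hm] at hy
    exact (hκ y x (hmem x hx' y hy) (hWx x hx)).2
      (Or.inr ⟨hm y hy, hs.1, h.root x hx' hs.2 y hy⟩)
  · rw [hsrc x (hWx x hx)] at hs
    by_cases hd : D x
    · simp only [hd, hrD r (h.self_mem hr), if_true, if_false]
      obtain ⟨hx', -, -, q, e, hq⟩ := hnew x hx hd
      exact ⟨hL r hr, Nat.lt_succ_self _, q, by rw [e, hPr], fun y hy =>
        (hκ y x (hq y hy).1 hx').2 (Or.inl ⟨(hq y hy).2, hd⟩)⟩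
    · have hx' := hL' x hx hd
      obtain ⟨h1, h2, l, h3, h4⟩ := h.step x hx' (fun h' => hs ⟨hd, h'⟩)
      simp only [hd, if_false]
      have hl : ∀ y ∈ l, W' y ∧ ¬ D y := fun y hy => by
        have : y ∈ P x := by rw [h3]; simp [hy]
        exact ⟨hmem x hx' y this, fun hdy => hd (hD y x (h.mem_W x hx' y this) (h.self_W hx')
          (hmem x hx' y this) (hWx x hx) (h4 y hy) hdy)⟩
      refine ⟨hL _ h1, ?_, l, ?_, fun y hy =>
        (hκ y x (hl y hy).1 (hWx x hx)).2 (Or.inr ⟨(hl y hy).2, hd, h4 y hy⟩)⟩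
      · split_ifs with hd'
        · exact (Nat.succ_le_of_lt (hrk _ h1 hd')).trans_lt h2
        · exact h2
      · by_cases hm : ∃ y ∈ P (par x), D y
        · obtain ⟨y, hy, hdy⟩ := hm
          obtain ⟨q, e1, e2⟩ := hP2 x hx' ⟨y, by rw [h3]; simp [hy], hdy⟩
          obtain ⟨q', e1', e2'⟩ := hP2 (par x) h1 ⟨y, hy, hdy⟩
          rw [h3, e1', List.append_assoc, List.append_cancel_left_eq] at e1
          rw [e2, e2', ← e1, List.append_assoc, List.append_assoc, List.append_assoc]
        · push Not at hm
          rw [hP1 _ h1 hm, ← h3]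
          refine hP1 x hx' fun y hy => ?_
          rw [h3, List.mem_append] at hy
          exact hy.elim (hm y) fun hy => (hl y hy).2

end PathSys

/-! ### The cycle closed by an edge between two labeled vertices -/

theorem nodup_reverse_after {X : Type*} {A l : List X} {x : X} (hA : A.Nodup) (hl : l.Nodup)
    (hx : x ∈ l) (hd : ∀ y ∈ A, y ∉ l) : (A ++ (after x l).reverse ++ [x]).Nodup := by
  have := nodup_cons_after (r := x) hl
  rw [List.nodup_cons] at this
  simp only [List.append_assoc, List.nodup_append, List.nodup_reverse, List.mem_append,
    List.mem_reverse, List.mem_singleton]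
  refine ⟨hA, ⟨this.2, by simp, ?_⟩, ?_⟩
  · rintro a ha b rfl rfl; exact this.1 ha
  · rintro a ha b (hb | rfl) rfl
    · exact hd a ha (mem_of_mem_after hb)
    · exact hd a ha hx

theorem nodup_reverse_after_append {X : Type*} {A l R : List X} {x : X} (hA : A.Nodup)
    (hl : l.Nodup) (hR : R.Nodup) (hd : ∀ y ∈ A, y ∉ l) (h1 : ∀ y ∈ R, y ∉ A)
    (h2 : ∀ y ∈ R, y ∉ after x l) : (A ++ (after x l).reverse ++ R).Nodup := by
  have := nodup_cons_after (r := x) hl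
  rw [List.nodup_cons] at this
  simp only [List.append_assoc, List.nodup_append, List.nodup_reverse, List.mem_append,
    List.mem_reverse]
  refine ⟨hA, ⟨this.2, hR, ?_⟩, ?_⟩
  · rintro a ha b hb rfl; exact h2 a hb ha
  · rintro a ha b (hb | hb) rfl
    · exact hd a ha (mem_of_mem_after hb)
    · exact h1 a hb ha

/-- The situation in which the procedure `Blossom` is applied to the labeled vertices `v` and `u`:
`c` and `d` are the last vertices of their paths in the last common node, `l₁` and `l₂` the parts
of the paths after these. -/
structure Fork {X N : Type*} (κ : X → N) (L : X → Prop) (P : X → List X) (rk : X → ℕ)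
    (v u c d : X) (l₁ l₂ : List X) : Prop where
  hv : L v
  hu : L u
  hc : L c
  hd : L d
  eq_node : κ d = κ c
  eq_left : P v = P c ++ l₁
  eq_right : P u = P d ++ l₂
  rk_left : ∀ z ∈ l₁, rk c < rk z
  rk_right : ∀ z ∈ l₂, rk c < rk z
  disj_left : ∀ z ∈ l₁, ∀ y ∈ P u, κ y ≠ κ z
  disj_right : ∀ z ∈ l₂, ∀ y ∈ P v, κ y ≠ κ z

namespace PathSys

variable {X N : Type*} {W : X → Prop} {κ : X → N} {src L : X → Prop}
    {P : X → List X} {par : X → X} {rk : X → ℕ}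

theorem fork (h : PathSys W κ src L P par rk) {v u c d : X} (hv : L v) (hu : L u)
    (hc : IsLastWith (P v) (fun x => ∃ y ∈ P u, κ y = κ x) c)
    (hd : IsLastWith (P u) (fun x => κ x = κ c) d) :
    ∃ l₁ l₂, Fork κ L P rk v u c d l₁ l₂ := by
  obtain ⟨h1, h2, l₁, l₂, h3, h4, h5, h6, h7, h8⟩ := h.last_common hv hu hc hd
  exact ⟨l₁, l₂, hv, hu, h1, h2, hd.holds, h3, h4, h5, h6, h7, h8⟩

variable {v u c d : X} {l₁ l₂ : List X}

theorem fork_after_left (h : PathSys W κ src L P par rk) (f : Fork κ L P rk v u c d l₁ l₂) :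
    after c (P v) = l₁ := by
  rw [f.eq_left]
  exact after_append (f.eq_left ▸ h.nodup v f.hv) (h.last c f.hc)

theorem fork_after_right (h : PathSys W κ src L P par rk) (f : Fork κ L P rk v u c d l₁ l₂) :
    after d (P u) = l₂ := by
  rw [f.eq_right]
  exact after_append (f.eq_right ▸ h.nodup u f.hu) (h.last d f.hd)

variable {S : X → Prop}

/-- If one of the nodes on the cycle is a root, then it is the last common node. -/
theorem fork_root (h : PathSys W κ src L P par rk) (f : Fork κ L P rk v u c d l₁ l₂)
    (hS : ∀ y, S y ↔ W y ∧ ∃ z ∈ l₁ ++ l₂ ++ (if c = d then [] else [c]), κ y = κ z)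
    (hsrc : ∃ y, S y ∧ src y) :
    c ≠ d ∧ src c ∧ S c ∧ (∀ y ∈ P v, S y) ∧ (∀ y ∈ P u, S y) ∧
      (∀ x, L x → S x → ∀ y ∈ P x, S y) ∧ (∀ x, S x → rk c ≤ rk x) ∧
      (∀ x, S x → src x → κ x = κ c) := by
  have Wc := h.self_W f.hc
  have Wv := h.mem_W v f.hv
  have Wu := h.mem_W u f.hu
  have Wd := h.self_W f.hd
  have rdc := h.rk_congr _ _ Wd Wc f.eq_node
  have W1 : ∀ z ∈ l₁, W z := fun z hz => Wv z (by rw [f.eq_left]; simp [hz])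
  have W2 : ∀ z ∈ l₂, W z := fun z hz => Wu z (by rw [f.eq_right]; simp [hz])
  -- a root node on the path of `w` contains the first vertex of the path, hence all of it
  have aux : ∀ w c' : X, ∀ l, L w → L c' → rk c' = rk c → P w = P c' ++ l →
      (∀ z ∈ l, rk c < rk z) → ∀ z ∈ l, ¬ src z := by
    intro w c' l hw hc' hr e hl z hz hs
    have hzw : z ∈ P w := by rw [e]; simp [hz]
    have Wz := h.mem_W w hw z hzw
    obtain ⟨w', Lw', kw', l', e', -⟩ := h.exists_prefix hw hzw
    have hs' : src w' := h.src_congr z w' Wz (h.self_W Lw') kw'.symm hs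
    have n1 : P c' ≠ [] := fun h0 => by simpa [h0] using h.last c' hc'
    have n2 : P w' ≠ [] := fun h0 => by simpa [h0] using h.last w' Lw'
    obtain ⟨a, A, ea⟩ := List.exists_cons_of_ne_nil n1
    obtain ⟨b, B, eb⟩ := List.exists_cons_of_ne_nil n2
    have hab : a = b := by
      rw [e', ea, eb] at e
      simp at e
      exact e.1.symm
    subst hab
    have h1 := h.root w' Lw' hs' a (by rw [eb]; simp)
    have h2 := h.rk_le hc' (y := a) (by rw [ea]; simp)
    have h3 := h.rk_congr a z (h.mem_W _ hc' a (by rw [ea]; simp)) Wz (h1.trans kw')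
    have h4 := hl z hz
    omega
  have hsrc_iff : ∀ y, S y → src y → c ≠ d ∧ src c ∧ κ y = κ c := by
    intro y hy hsy
    obtain ⟨Wy, z, hz, e⟩ := (hS y).1 hy
    rcases List.mem_append.1 hz with hz | hz
    · exfalso
      rcases List.mem_append.1 hz with hz | hz
      · exact aux v c l₁ f.hv f.hc rfl f.eq_left f.rk_left z hz
          (h.src_congr y z Wy (W1 z hz) e hsy)
      · exact aux u d l₂ f.hu f.hd rdc f.eq_right f.rk_right z hz
          (h.src_congr y z Wy (W2 z hz) e hsy)
    · split_ifs at hz with hcd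
      · simp at hz
      · simp only [List.mem_singleton] at hz
        subst hz
        exact ⟨hcd, h.src_congr y z Wy Wc e hsy, e⟩
  obtain ⟨y, hy, hsy⟩ := hsrc
  obtain ⟨hcd, hsc, -⟩ := hsrc_iff y hy hsy
  have hS' : ∀ y, S y ↔ W y ∧ ((∃ z ∈ l₁, κ y = κ z) ∨ (∃ z ∈ l₂, κ y = κ z) ∨ κ y = κ c) := by
    intro y
    rw [hS]
    simp only [hcd, if_false, List.mem_append, List.mem_singleton]
    constructor
    · rintro ⟨hw, z, (hz | hz) | rfl, e⟩
      · exact ⟨hw, Or.inl ⟨z, hz, e⟩⟩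
      · exact ⟨hw, Or.inr (Or.inl ⟨z, hz, e⟩)⟩
      · exact ⟨hw, Or.inr (Or.inr e)⟩
    · rintro ⟨hw, ⟨z, hz, e⟩ | ⟨z, hz, e⟩ | e⟩
      · exact ⟨hw, z, by simp [hz], e⟩
      · exact ⟨hw, z, by simp [hz], e⟩
      · exact ⟨hw, c, by simp, e⟩
  have hsd : src d := h.src_congr c d Wc Wd f.eq_node.symm hsc
  have Pv : ∀ y ∈ P v, S y := by
    intro y hy
    rw [hS']
    refine ⟨Wv y hy, ?_⟩
    rw [f.eq_left, List.mem_append] at hy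
    rcases hy with hy | hy
    · exact Or.inr (Or.inr (h.root c f.hc hsc y hy))
    · exact Or.inl ⟨y, hy, rfl⟩
  have Pu : ∀ y ∈ P u, S y := by
    intro y hy
    rw [hS']
    refine ⟨Wu y hy, ?_⟩
    rw [f.eq_right, List.mem_append] at hy
    rcases hy with hy | hy
    · exact Or.inr (Or.inr ((h.root d f.hd hsd y hy).trans f.eq_node))
    · exact Or.inr (Or.inl ⟨y, hy, rfl⟩)
  have hScongr : ∀ y y', W y' → κ y' = κ y → S y → S y' := by
    intro y y' hW e hy
    obtain ⟨-, z, hz, e'⟩ := (hS y).1 hy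
    exact (hS y').2 ⟨hW, z, hz, e.trans e'⟩
  have paths : ∀ w, L w → (∀ y ∈ P w, S y) → ∀ z ∈ P w, ∀ x, L x → κ x = κ z →
      ∀ y ∈ P x, S y := by
    intro w hw hPw z hz x hx e y hy
    have Sx := hScongr z x (h.self_W hx) e (hPw z hz)
    by_cases hs : src x
    · exact hScongr x y (h.mem_W x hx y hy) (h.root x hx hs y hy) Sx
    · obtain ⟨w', Lw', kw', l', e', -⟩ := h.exists_prefix hw hz
      have hs' : ¬ src w' := fun hs' =>
        hs (h.src_congr w' x (h.self_W Lw') (h.self_W hx) (kw'.trans e.symm) hs')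
      obtain ⟨-, -, s, es, -⟩ := h.step w' Lw' hs'
      obtain ⟨-, -, sx, esx, hsx⟩ := h.step x hx hs
      have hp : par w' = par x :=
        h.par_congr _ _ (h.self_W Lw') (h.self_W hx) (kw'.trans e.symm)
      rw [esx, List.mem_append] at hy
      rcases hy with hy' | hy'
      · exact hPw y (by rw [e', es, hp]; simp [hy'])
      · exact hScongr x y (h.mem_W x hx y (by rw [esx]; simp [hy'])) (hsx y hy') Sx
  refine ⟨hcd, hsc, (hS' c).2 ⟨Wc, by simp⟩, Pv, Pu, ?_, ?_, fun x hx hs => (hsrc_iff x hx hs).2.2⟩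
  · intro x hx Sx y hy
    obtain ⟨-, ⟨z, hz, e⟩ | ⟨z, hz, e⟩ | e⟩ := (hS' x).1 Sx
    · exact paths v f.hv Pv z (by rw [f.eq_left]; simp [hz]) x hx e y hy
    · exact paths u f.hu Pu z (by rw [f.eq_right]; simp [hz]) x hx e y hy
    · exact paths v f.hv Pv c (by rw [f.eq_left]; simp [h.self_mem f.hc]) x hx e y hy
  · intro x Sx
    obtain ⟨Wx, ⟨z, hz, e⟩ | ⟨z, hz, e⟩ | e⟩ := (hS' x).1 Sx
    · rw [h.rk_congr x z Wx (W1 z hz) e]; exact (f.rk_left z hz).le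
    · rw [h.rk_congr x z Wx (W2 z hz) e]; exact (f.rk_right z hz).le
    · exact (h.rk_congr x c Wx Wc e).ge

/-- If no node on the cycle is a root, then the vertex `r` is the exit of the cycle towards the
root. -/
theorem fork_child (h : PathSys W κ src L P par rk) (f : Fork κ L P rk v u c d l₁ l₂)
    (hS : ∀ y, S y ↔ W y ∧ ∃ z ∈ l₁ ++ l₂ ++ (if c = d then [] else [c]), κ y = κ z)
    (hsrc : ∀ y, S y → ¬ src y) {r : X}
    (hr : if c = d then r = c else IsLastWith (P v) (fun x => ¬ S x) r) :
    L r ∧ (∀ y ∈ P r, ¬ S y) ∧ (∀ y, S y → rk r < rk y) ∧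
      (∃ s₁ s₂, P v = P r ++ s₁ ++ l₁ ∧ P u = P r ++ s₂ ++ l₂ ∧
        (∀ y ∈ s₁ ++ l₁, S y) ∧ (∀ y ∈ s₂ ++ l₂, S y) ∧
        (c = d → r = c ∧ s₁ = [] ∧ s₂ = []) ∧
        (c ≠ d → s₁.getLast? = some c ∧ s₂.getLast? = some d)) ∧
      (∀ x, L x → S x → ∃ q, P x = P r ++ q ∧ ∀ y ∈ q, S y) ∧
      (∀ x, L x → (∃ y ∈ P x, S y) → ∃ q, P x = P r ++ q) := by
  have Wc := h.self_W f.hc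
  have Wv := h.mem_W v f.hv
  have Wu := h.mem_W u f.hu
  have Wd := h.self_W f.hd
  have rdc := h.rk_congr _ _ Wd Wc f.eq_node
  have W1 : ∀ z ∈ l₁, W z := fun z hz => Wv z (by rw [f.eq_left]; simp [hz])
  have W2 : ∀ z ∈ l₂, W z := fun z hz => Wu z (by rw [f.eq_right]; simp [hz])
  have S1 : ∀ y ∈ l₁, S y := fun y hy => (hS y).2 ⟨W1 y hy, y, by simp [hy], rfl⟩
  have S2 : ∀ y ∈ l₂, S y := fun y hy => (hS y).2 ⟨W2 y hy, y, by simp [hy], rfl⟩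
  have hScongr : ∀ y y', W y → W y' → κ y = κ y' → S y → S y' := by
    intro y y' _ hW e hy
    obtain ⟨-, z, hz, e'⟩ := (hS y).1 hy
    exact (hS y').2 ⟨hW, z, hz, e.symm.trans e'⟩
  have main : L r ∧ (∀ y, S y → rk r < rk y) ∧
      (∃ s₁ s₂, P v = P r ++ s₁ ++ l₁ ∧ P u = P r ++ s₂ ++ l₂ ∧
        (∀ y ∈ s₁ ++ l₁, S y) ∧ (∀ y ∈ s₂ ++ l₂, S y) ∧
        (c = d → r = c ∧ s₁ = [] ∧ s₂ = []) ∧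
        (c ≠ d → s₁.getLast? = some c ∧ s₂.getLast? = some d)) := by
    by_cases hcd : c = d
    · rw [if_pos hcd] at hr
      subst hr
      refine ⟨f.hc, fun y hy => ?_, [], [], by simp [f.eq_left], by rw [f.eq_right, hcd]; simp,
        by simpa using S1, by simpa using S2, fun _ => ⟨rfl, rfl, rfl⟩, fun h => absurd hcd h⟩
      obtain ⟨Wy, z, hz, e⟩ := (hS y).1 hy
      simp only [hcd, if_true, List.append_nil, List.mem_append] at hz
      rcases hz with hz | hz
      · rw [h.rk_congr y z Wy (W1 z hz) e]; exact f.rk_left z hz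
      · rw [h.rk_congr y z Wy (W2 z hz) e]; exact f.rk_right z hz
    · rw [if_neg hcd] at hr
      have Sc : S c := (hS c).2 ⟨Wc, c, by simp [hcd], rfl⟩
      have Sd : S d := hScongr c d Wc Wd f.eq_node.symm Sc
      obtain ⟨Lp, rp, s₁, e1, hs1⟩ := h.step c f.hc (hsrc c Sc)
      obtain ⟨-, -, s₂, e2, hs2⟩ := h.step d f.hd (hsrc d Sd)
      rw [h.par_congr d c Wd Wc f.eq_node] at e2
      have hrk : ∀ y, S y → rk (par c) < rk y := by
        intro y hy
        refine rp.trans_le ?_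
        obtain ⟨Wy, z, hz, e⟩ := (hS y).1 hy
        simp only [hcd, if_false, List.mem_append, List.mem_singleton] at hz
        rcases hz with (hz | hz) | rfl
        · rw [h.rk_congr y z Wy (W1 z hz) e]; exact (f.rk_left z hz).le
        · rw [h.rk_congr y z Wy (W2 z hz) e]; exact (f.rk_right z hz).le
        · exact (h.rk_congr y z Wy Wc e).ge
      have T1 : ∀ y ∈ s₁ ++ l₁, S y := by
        intro y hy
        rcases List.mem_append.1 hy with hy | hy
        · exact hScongr c y Wc (h.mem_W c f.hc y (by rw [e1]; simp [hy])) (hs1 y hy).symm Sc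
        · exact S1 y hy
      have T2 : ∀ y ∈ s₂ ++ l₂, S y := by
        intro y hy
        rcases List.mem_append.1 hy with hy | hy
        · exact hScongr d y Wd (h.mem_W d f.hd y (by rw [e2]; simp [hy])) (hs2 y hy).symm Sd
        · exact S2 y hy
      have e : P v = P (par c) ++ (s₁ ++ l₁) := by rw [f.eq_left, e1, List.append_assoc]
      have er : r = par c := hr.eq_of_append e (h.last _ Lp)
        (fun hS' => lt_irrefl _ (hrk _ hS')) (fun x hx hx' => hx' (T1 x hx))
      subst er
      have n1 : s₁ ≠ [] := by
        rintro rfl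
        rw [List.append_nil] at e1
        rw [← h.eq_of_path_eq f.hc Lp e1] at rp
        exact lt_irrefl _ rp
      have n2 : s₂ ≠ [] := by
        rintro rfl
        rw [List.append_nil] at e2
        rw [← h.eq_of_path_eq f.hd Lp e2, rdc] at rp
        exact lt_irrefl _ rp
      refine ⟨Lp, hrk, s₁, s₂, by rw [e, List.append_assoc],
        by rw [f.eq_right, e2], T1, T2, fun h => absurd h hcd, fun _ => ⟨?_, ?_⟩⟩
      · have := h.last c f.hc
        rwa [e1, List.getLast?_append_of_ne_nil _ n1] at this
      · have := h.last d f.hd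
        rwa [e2, List.getLast?_append_of_ne_nil _ n2] at this
  obtain ⟨Lr, hrk, s₁, s₂, e1, e2, T1, T2, A1, A2⟩ := main
  have hrS : ∀ y ∈ P r, ¬ S y := fun y hy hs => by
    have := h.rk_le Lr hy
    have := hrk y hs
    omega
  have ext : ∀ x, L x → S x → ∃ q, P x = P r ++ q ∧ ∀ y ∈ q, S y := by
    intro x hx Sx
    obtain ⟨-, z, hz, e⟩ := (hS x).1 Sx
    rw [List.append_assoc] at e1 e2
    rcases List.mem_append.1 hz with hz | hz
    · rcases List.mem_append.1 hz with hz | hz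
      · exact h.exists_extension Lr f.hv hx e1 T1 hScongr hrk hsrc (by simp [hz]) e
      · exact h.exists_extension Lr f.hu hx e2 T2 hScongr hrk hsrc (by simp [hz]) e
    · by_cases hcd : c = d
      · simp [hcd] at hz
      · simp only [hcd, if_false, List.mem_singleton] at hz
        subst hz
        exact h.exists_extension Lr f.hv hx e1 T1 hScongr hrk hsrc
          (List.mem_append_left _ (mem_of_last (A2 hcd).1)) e
  refine ⟨Lr, hrS, hrk, ⟨s₁, s₂, e1, e2, T1, T2, A1, A2⟩, ext, fun x hx ⟨y, hy, Sy⟩ => ?_⟩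
  obtain ⟨x', Lx', kx', l, e, -⟩ := h.exists_prefix hx hy
  obtain ⟨q, eq, -⟩ := ext x' Lx' (hScongr y x' (h.mem_W x hx y hy) (h.self_W Lx') kx'.symm Sy)
  exact ⟨q ++ l, by rw [e, eq, List.append_assoc]⟩

end PathSys

namespace Config

variable {K U V : Type*} [Field K] [Fintype U] [Fintype V]

/-! ### Blossom families -/

/-- The conditions on `B*` and on the blossom family that persist during the search. -/
structure Frame (I : ParityInstance K U V) (c : Config K V) : Prop where
  Bs_subset : c.Bs ⊆ c.Vstar I
  bud_tip : ∀ i, c.IsNormal I i → (.bud i ∈ c.Bs ↔ .tip i ∉ c.Bs)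
  H_subset : ∀ i ∈ c.ids, c.H i ⊆ c.Vstar I
  lines : ∀ i ∈ c.ids, ∀ v, .orig v ∈ c.H i → .orig (I.mate v) ∈ c.H i
  laminar : ∀ i ∈ c.ids, ∀ j ∈ c.ids, i ≠ j →
    Disjoint (c.H i) (c.H j) ∨ c.H i ⊂ c.H j ∨ c.H j ⊂ c.H i
  one_source : ∀ i ∈ c.ids, ∀ x ∈ c.H i, ∀ y ∈ c.H i,
    c.IsSource I x → c.IsSource I y → y = x ∨ y = I.bar x
  tip_mem : ∀ i ∈ c.ids, ∀ j, c.IsNormal I j → (.tip j ∈ c.H i ↔ c.H j ⊆ c.H i)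
  bud_mem : ∀ i ∈ c.ids, ∀ j, c.IsNormal I j → (.bud j ∈ c.H i ↔ c.H j ⊂ c.H i)

theorem WellFormed.frame {I : ParityInstance K U V} {c : Config K V} (h : c.WellFormed I) :
    c.Frame I :=
  ⟨h.Bs_subset, h.bud_tip, h.H_subset, h.lines, h.laminar, h.one_source, h.tip_mem, h.bud_mem⟩

/-- The node of `x` is a root of the search forest. -/
def Root (I : ParityInstance K U V) (c : Config K V) (x : Vtx V) : Prop :=
  c.HasSource I (c.Kset I x)

variable {I : ParityInstance K U V} {c c' : Config K V}

@[simp] theorem bar_bar (x : Vtx V) : I.bar (I.bar x) = x := by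
  cases x <;> simp [ParityInstance.bar, I.mate_mate]

theorem bar_ne (x : Vtx V) : I.bar x ≠ x := by
  cases x <;> simp [ParityInstance.bar, I.mate_ne]

theorem bar_injective : Function.Injective I.bar := fun x y h => by
  rw [← bar_bar (I := I) x, h, bar_bar]

@[simp] theorem orig_mem_Vstar (v : V) : Vtx.orig v ∈ c.Vstar I := by simp [Vstar]

@[simp] theorem bud_mem_Vstar {i : ℕ} : Vtx.bud i ∈ c.Vstar I ↔ c.IsNormal I i := by
  simp only [Vstar, T, Finset.mem_union, Finset.mem_image, Finset.mem_univ, true_and,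
    reduceCtorEq, exists_false, false_or, Finset.mem_biUnion, Finset.mem_filter,
    Finset.mem_insert, Vtx.bud.injEq, Finset.mem_singleton, or_false]
  exact ⟨fun ⟨a, ⟨_, h⟩, e⟩ => e ▸ h, fun h => ⟨i, ⟨h.1, h⟩, rfl⟩⟩

@[simp] theorem tip_mem_Vstar {i : ℕ} : Vtx.tip i ∈ c.Vstar I ↔ c.IsNormal I i := by
  simp only [Vstar, T, Finset.mem_union, Finset.mem_image, Finset.mem_univ, true_and,
    reduceCtorEq, exists_false, false_or, Finset.mem_biUnion, Finset.mem_filter,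
    Finset.mem_insert, Vtx.tip.injEq, Finset.mem_singleton]
  exact ⟨fun ⟨a, ⟨_, h⟩, e⟩ => e ▸ h, fun h => ⟨i, ⟨h.1, h⟩, rfl⟩⟩

theorem bar_mem_Vstar {x : Vtx V} : I.bar x ∈ c.Vstar I ↔ x ∈ c.Vstar I := by
  cases x <;> simp [ParityInstance.bar]

theorem mem_T {x : Vtx V} : x ∈ c.T I ↔ x ∈ c.Vstar I ∧ ∀ v, x ≠ .orig v := by
  cases x with
  | orig v => simp [T]
  | bud i => simp [Vstar]
  | tip i => simp [Vstar]

theorem isSource_congr (h : c'.base = c.base) {x : Vtx V} :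
    c'.IsSource I x ↔ c.IsSource I x := by
  simp [IsSource, h]

theorem hasSource_congr (h : c'.base = c.base) {S : Finset (Vtx V)} :
    c'.HasSource I S ↔ c.HasSource I S := by
  simp [HasSource, isSource_congr h]

theorem IsSource.bar {x : Vtx V} (h : c.IsSource I x) : c.IsSource I (I.bar x) := by
  obtain ⟨v, rfl, h⟩ := h
  exact ⟨I.mate v, rfl, by rw [I.mate_mate]; tauto⟩

theorem IsSource.mem_Vstar {x : Vtx V} (h : c.IsSource I x) : x ∈ c.Vstar I := by
  obtain ⟨v, rfl, h⟩ := h; simp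

theorem mem_cell {i : ℕ} {x : Vtx V} :
    x ∈ c.cell I i ↔ x ∈ c.H i ∨ (c.IsNormal I i ∧ x = .bud i) := by
  unfold cell
  split_ifs with h <;> simp [h]
  tauto

theorem H_subset_cell {i : ℕ} : c.H i ⊆ c.cell I i := fun _ hx => mem_cell.2 (Or.inl hx)

theorem normal_or_source {i : ℕ} (h : i ∈ c.ids) : c.IsNormal I i ∨ c.IsSourceBlossom I i := by
  by_cases hs : c.HasSource I (c.H i)
  · exact Or.inr ⟨h, hs⟩
  · exact Or.inl ⟨h, hs⟩

theorem IsNormal.not_source {i : ℕ} {x : Vtx V} (h : c.IsNormal I i) (hx : x ∈ c.cell I i) :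
    ¬ c.IsSource I x := by
  rintro hs
  rcases mem_cell.1 hx with hx | ⟨-, rfl⟩
  · exact h.2 ⟨x, hx, hs⟩
  · obtain ⟨v, hv, -⟩ := hs; cases hv

theorem exists_max {j : ℕ} (hj : j ∈ c.ids) : ∃ m, c.IsMax m ∧ c.H j ⊆ c.H m := by
  obtain ⟨m, hm, hmax⟩ := Finset.exists_max_image (c.ids.filter fun m => c.H j ⊆ c.H m)
    (fun m => (c.H m).card) ⟨j, by simp [hj]⟩
  rw [Finset.mem_filter] at hm
  refine ⟨m, ⟨hm.1, fun k hk hlt => ?_⟩, hm.2⟩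
  have := hmax k (by simp [hk, hm.2.trans hlt.1])
  exact absurd (Finset.card_lt_card hlt) (by omega)

namespace Frame

theorem tip_self (h : c.Frame I) {i : ℕ} (hi : c.IsNormal I i) : .tip i ∈ c.H i :=
  (h.tip_mem i hi.1 i hi).2 subset_rfl

theorem bud_notMem (h : c.Frame I) {i : ℕ} (hi : c.IsNormal I i) : .bud i ∉ c.H i :=
  fun hb => ((h.bud_mem i hi.1 i hi).1 hb).2 subset_rfl

theorem bud_mem_cell {i : ℕ} (hi : c.IsNormal I i) : .bud i ∈ c.cell I i :=
  mem_cell.2 (Or.inr ⟨hi, rfl⟩)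

theorem H_nonempty (h : c.Frame I) {i : ℕ} (hi : i ∈ c.ids) : (c.H i).Nonempty := by
  rcases normal_or_source (I := I) hi with h' | ⟨-, x, hx, -⟩
  · exact ⟨_, h.tip_self h'⟩
  · exact ⟨x, hx⟩

theorem cell_subset (h : c.Frame I) {i : ℕ} (hi : i ∈ c.ids) : c.cell I i ⊆ c.Vstar I := by
  intro x hx
  rcases mem_cell.1 hx with hx | ⟨hn, rfl⟩
  · exact h.H_subset i hi hx
  · simpa using hn

theorem H_disjoint_of_max (h : c.Frame I) {i j : ℕ} (hi : c.IsMax i) (hj : c.IsMax j)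
    (hij : i ≠ j) : Disjoint (c.H i) (c.H j) := by
  rcases h.laminar i hi.1 j hj.1 hij with h' | h' | h'
  · exact h'
  · exact absurd h' (hi.2 j hj.1)
  · exact absurd h' (hj.2 i hi.1)

theorem cell_disjoint (h : c.Frame I) {i j : ℕ} (hi : c.IsMax i) (hj : c.IsMax j)
    (hij : i ≠ j) : Disjoint (c.cell I i) (c.cell I j) := by
  rw [Finset.disjoint_left]
  intro x hxi hxj
  rcases mem_cell.1 hxi with hxi | ⟨ni, rfl⟩ <;> rcases mem_cell.1 hxj with hxj | ⟨nj, e⟩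
  · exact Finset.disjoint_left.1 (h.H_disjoint_of_max hi hj hij) hxi hxj
  · subst e
    exact hj.2 i hi.1 ((h.bud_mem i hi.1 j nj).1 hxi)
  · exact hi.2 j hj.1 ((h.bud_mem j hj.1 i ni).1 hxj)
  · exact hij (Vtx.bud.inj e)

theorem eq_of_mem_cell (h : c.Frame I) {i j : ℕ} {x : Vtx V} (hi : c.IsMax i) (hj : c.IsMax j)
    (hxi : x ∈ c.cell I i) (hxj : x ∈ c.cell I j) : i = j := by
  by_contra hij
  exact Finset.disjoint_left.1 (h.cell_disjoint hi hj hij) hxi hxj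

/-- A blossom is contained, together with its bud, in a maximal blossom and its bud. -/
theorem exists_max_cell (h : c.Frame I) {j : ℕ} (hj : j ∈ c.ids) :
    ∃ m, c.IsMax m ∧ c.H j ⊆ c.H m ∧ c.cell I j ⊆ c.cell I m := by
  obtain ⟨m, hm, hjm⟩ := exists_max hj
  refine ⟨m, hm, hjm, fun x hx => ?_⟩
  rcases mem_cell.1 hx with hx | ⟨nj, rfl⟩
  · exact H_subset_cell (hjm hx)
  · by_cases e : j = m
    · subst e; exact bud_mem_cell nj
    · refine H_subset_cell ((h.bud_mem m hm.1 j nj).2 ?_)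
      rcases h.laminar j hj m hm.1 e with h' | h' | h'
      · obtain ⟨y, hy⟩ := h.H_nonempty hj
        exact absurd (hjm hy) (Finset.disjoint_left.1 h' hy)
      · exact h'
      · exact absurd h' (hm.2 j hj)

theorem Kset_of_cell (h : c.Frame I) {i : ℕ} {x : Vtx V} (hi : c.IsMax i)
    (hx : x ∈ c.cell I i) : c.Kset I x = c.cell I i := by
  have hs : ¬ c.Single I x := fun hs => hs i hi hx
  rw [Kset, if_neg hs]
  ext y
  simp only [Finset.mem_biUnion, Finset.mem_filter]
  constructor
  · rintro ⟨j, ⟨-, hj, hxj⟩, hy⟩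
    rwa [h.eq_of_mem_cell hi hj hx hxj]
  · intro hy
    exact ⟨i, ⟨hi.1, hi, hx⟩, hy⟩

end Frame

theorem Kset_single {x : Vtx V} (hx : c.Single I x) : c.Kset I x = {x, I.bar x} := by
  rw [Kset, if_pos hx]

theorem single_or {x : Vtx V} : c.Single I x ∨ ∃ i, c.IsMax i ∧ x ∈ c.cell I i := by
  by_cases h : c.Single I x
  · exact Or.inl h
  · unfold Single at h; push Not at h; exact Or.inr h

namespace Frame

theorem single_orig (h : c.Frame I) {x : Vtx V} (hx : x ∈ c.Vstar I) (hs : c.Single I x) :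
    ∃ v, x = .orig v := by
  cases x with
  | orig v => exact ⟨v, rfl⟩
  | bud i =>
    rw [bud_mem_Vstar] at hx
    obtain ⟨m, hm, -, h2⟩ := h.exists_max_cell hx.1
    exact absurd (h2 (bud_mem_cell hx)) (hs m hm)
  | tip i =>
    rw [tip_mem_Vstar] at hx
    obtain ⟨m, hm, -, h2⟩ := h.exists_max_cell hx.1
    exact absurd (h2 (H_subset_cell (h.tip_self hx))) (hs m hm)

theorem single_bar (h : c.Frame I) {x : Vtx V} (hx : x ∈ c.Vstar I) (hs : c.Single I x) :
    c.Single I (I.bar x) := by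
  obtain ⟨v, rfl⟩ := h.single_orig hx hs
  intro i hi hv
  rcases mem_cell.1 hv with hv | ⟨-, e⟩
  · have := h.lines i hi.1 _ hv
    rw [I.mate_mate] at this
    exact hs i hi (H_subset_cell this)
  · cases e

theorem mem_Kset_self (h : c.Frame I) (x : Vtx V) : x ∈ c.Kset I x := by
  rcases single_or (I := I) (c := c) (x := x) with hs | ⟨i, hi, hx⟩
  · simp [Kset_single hs]
  · rwa [h.Kset_of_cell hi hx]

theorem Kset_eq_of_mem (h : c.Frame I) {x y : Vtx V} (hx : x ∈ c.Vstar I)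
    (hy : y ∈ c.Kset I x) : c.Kset I y = c.Kset I x := by
  rcases single_or (I := I) (c := c) (x := x) with hs | ⟨i, hi, hxi⟩
  · rw [Kset_single hs] at hy
    rcases Finset.mem_insert.1 hy with rfl | hy
    · rfl
    · rw [Finset.mem_singleton] at hy
      subst hy
      rw [Kset_single hs, Kset_single (h.single_bar hx hs), bar_bar, Finset.pair_comm]
  · rw [h.Kset_of_cell hi hxi] at hy ⊢
    exact h.Kset_of_cell hi hy

theorem mem_Kset_iff (h : c.Frame I) {x y : Vtx V} (hx : x ∈ c.Vstar I) :
    y ∈ c.Kset I x ↔ c.Kset I y = c.Kset I x :=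
  ⟨h.Kset_eq_of_mem hx, fun e => e ▸ h.mem_Kset_self y⟩

theorem Kset_subset (h : c.Frame I) {x : Vtx V} (hx : x ∈ c.Vstar I) :
    c.Kset I x ⊆ c.Vstar I := by
  rcases single_or (I := I) (c := c) (x := x) with hs | ⟨i, hi, hxi⟩
  · rw [Kset_single hs]
    intro y hy
    rcases Finset.mem_insert.1 hy with rfl | hy
    · exact hx
    · rw [Finset.mem_singleton] at hy
      subst hy
      exact bar_mem_Vstar.2 hx
  · rw [h.Kset_of_cell hi hxi]
    exact h.cell_subset hi.1

theorem one_source_Kset (h : c.Frame I) {x y z : Vtx V}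
    (hy : y ∈ c.Kset I x) (hz : z ∈ c.Kset I x) (sy : c.IsSource I y) (sz : c.IsSource I z) :
    z = y ∨ z = I.bar y := by
  rcases single_or (I := I) (c := c) (x := x) with hs | ⟨i, hi, hxi⟩
  · rw [Kset_single hs] at hy hz
    simp only [Finset.mem_insert, Finset.mem_singleton] at hy hz
    rcases hy with rfl | rfl <;> rcases hz with rfl | rfl <;> simp
  · rw [h.Kset_of_cell hi hxi] at hy hz
    rcases mem_cell.1 hy with hy | ⟨-, rfl⟩
    · rcases mem_cell.1 hz with hz | ⟨-, rfl⟩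
      · exact h.one_source i hi.1 y hy z hz sy sz
      · obtain ⟨v, hv, -⟩ := sz; cases hv
    · obtain ⟨v, hv, -⟩ := sy; cases hv

theorem single_of_Kset_eq (h : c.Frame I) {x y : Vtx V} (hs : c.Single I x)
    (e : c.Kset I y = c.Kset I x) : y = x ∨ y = I.bar x := by
  have := h.mem_Kset_self y
  rw [e, Kset_single hs] at this
  simpa using this

theorem root_normal (h : c.Frame I) {i : ℕ} {x : Vtx V} (hi : c.IsMax i) (hn : c.IsNormal I i)
    (hx : x ∈ c.cell I i) : ¬ c.Root I x := by
  rintro ⟨y, hy, hs⟩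
  rw [h.Kset_of_cell hi hx] at hy
  exact hn.not_source hy hs

theorem root_single {x : Vtx V} (hs : c.Single I x) : c.Root I x ↔ c.IsSource I x := by
  unfold Root HasSource
  rw [Kset_single hs]
  simp only [Finset.mem_insert, Finset.mem_singleton, exists_eq_or_imp, exists_eq_left]
  exact ⟨fun h' => h'.elim id fun h' => by simpa using h'.bar, Or.inl⟩

theorem root_source (h : c.Frame I) {x : Vtx V} (hs : c.IsSource I x) : c.Root I x :=
  ⟨x, h.mem_Kset_self x, hs⟩

end Frame

end Config

namespace Config

variable {K U V : Type*} [Field K] [Fintype U] [Fintype V]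
variable {I : ParityInstance K U V} {c c' : Config K V} {n : ℕ} {S : Finset (Vtx V)}

/-! ### Forming a new blossom -/

/-- The family of `c'` arises from that of `c` by adding the blossom `n` with vertex set `S`, a
union of nodes, together with a tip if it contains no source line. -/
structure AddNode (I : ParityInstance K U V) (c c' : Config K V) (n : ℕ) (S : Finset (Vtx V)) :
    Prop where
  fresh : n ∉ c.ids
  ids_eq : c'.ids = insert n c.ids
  H_eq : c'.H = Function.update c.H n (if c.HasSource I S then S else insert (.tip n) S)
  base_eq : c'.base = c.base
  Bs_old : ∀ x ∈ c.Vstar I, (x ∈ c'.Bs ↔ x ∈ c.Bs)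
  Bs_new : ∀ x ∈ c'.Bs, x ∈ c.Vstar I ∨ (¬ c.HasSource I S ∧ (x = .bud n ∨ x = .tip n))
  bud_tip : ¬ c.HasSource I S → (.bud n ∈ c'.Bs ↔ .tip n ∉ c'.Bs)
  closed : ∀ x ∈ S, x ∈ c.Vstar I ∧ c.Kset I x ⊆ S
  one_source : ∀ x ∈ S, ∀ y ∈ S, c.IsSource I x → c.IsSource I y → y = x ∨ y = I.bar x
  strict : c.HasSource I S → ∀ j ∈ c.ids, ¬ S ⊆ c.H j

namespace AddNode

theorem isSource_iff (a : AddNode I c c' n S) {x : Vtx V} :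
    c'.IsSource I x ↔ c.IsSource I x := isSource_congr a.base_eq

theorem H_old (a : AddNode I c c' n S) {j : ℕ} (hj : j ∈ c.ids) : c'.H j = c.H j := by
  rw [a.H_eq, Function.update_of_ne]
  rintro rfl; exact a.fresh hj

theorem H_new (a : AddNode I c c' n S) :
    c'.H n = if c.HasSource I S then S else insert (.tip n) S := by
  rw [a.H_eq, Function.update_self]

theorem subset_H_new (a : AddNode I c c' n S) : S ⊆ c'.H n := by
  rw [a.H_new]; split_ifs
  · exact subset_rfl
  · exact Finset.subset_insert _ _

theorem mem_ids (a : AddNode I c c' n S) {j : ℕ} : j ∈ c'.ids ↔ j = n ∨ j ∈ c.ids := by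
  rw [a.ids_eq, Finset.mem_insert]

theorem normal_old (a : AddNode I c c' n S) {j : ℕ} (hj : j ∈ c.ids) :
    c'.IsNormal I j ↔ c.IsNormal I j := by
  simp [IsNormal, a.mem_ids, hj, a.H_old hj, hasSource_congr a.base_eq]

theorem hasSource_new (a : AddNode I c c' n S) : c'.HasSource I (c'.H n) ↔ c.HasSource I S := by
  rw [hasSource_congr a.base_eq, a.H_new]
  split_ifs with h
  · rfl
  · simp only [HasSource, Finset.mem_insert, exists_eq_or_imp]
    exact ⟨fun h' => h'.elim (fun ⟨v, hv, _⟩ => by cases hv) id, Or.inr⟩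

theorem normal_new (a : AddNode I c c' n S) : c'.IsNormal I n ↔ ¬ c.HasSource I S := by
  simp [IsNormal, a.mem_ids, a.hasSource_new]

theorem mem_H_new (a : AddNode I c c' n S) {x : Vtx V} :
    x ∈ c'.H n ↔ x ∈ S ∨ (¬ c.HasSource I S ∧ x = .tip n) := by
  rw [a.H_new]
  split_ifs with h
  · simp [h]
  · simp [h]; tauto

theorem mem_cell_new (a : AddNode I c c' n S) {x : Vtx V} :
    x ∈ c'.cell I n ↔ x ∈ S ∨ (¬ c.HasSource I S ∧ (x = .bud n ∨ x = .tip n)) := by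
  rw [mem_cell, a.mem_H_new, a.normal_new]; tauto

theorem cell_old (a : AddNode I c c' n S) {j : ℕ} (hj : j ∈ c.ids) :
    c'.cell I j = c.cell I j := by
  ext x; rw [mem_cell, mem_cell, a.normal_old hj, a.H_old hj]

theorem not_normal_n (a : AddNode I c c' n S) : ¬ c.IsNormal I n := fun h => a.fresh h.1

theorem bud_notMem (a : AddNode I c c' n S) : .bud n ∉ c.Vstar I := by
  simpa using a.not_normal_n

theorem tip_notMem (a : AddNode I c c' n S) : .tip n ∉ c.Vstar I := by
  simpa using a.not_normal_n

theorem mem_Vstar (a : AddNode I c c' n S) {x : Vtx V} :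
    x ∈ c'.Vstar I ↔ x ∈ c.Vstar I ∨ (¬ c.HasSource I S ∧ (x = .bud n ∨ x = .tip n)) := by
  have key : ∀ i, c'.IsNormal I i ↔ c.IsNormal I i ∨ (¬ c.HasSource I S ∧ i = n) := by
    intro i
    by_cases e : i = n
    · subst e; simp [a.normal_new, a.not_normal_n]
    · by_cases hi : i ∈ c.ids
      · simp [a.normal_old hi, e]
      · have : i ∉ c'.ids := by simp [a.mem_ids, e, hi]
        simp [IsNormal, this, hi, e]
  cases x <;> simp [key]

theorem Vstar_subset (a : AddNode I c c' n S) : c.Vstar I ⊆ c'.Vstar I :=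
  fun _ hx => a.mem_Vstar.2 (Or.inl hx)

theorem cell_sub_or (a : AddNode I c c' n S) (h : c.Frame I) {j : ℕ} (hj : j ∈ c.ids) :
    c.cell I j ⊆ S ∨ Disjoint (c.cell I j) S := by
  obtain ⟨m, hm, -, hjm⟩ := h.exists_max_cell hj
  by_cases hd : Disjoint (c.cell I m) S
  · exact Or.inr (Finset.disjoint_of_subset_left hjm hd)
  · left
    rw [Finset.not_disjoint_iff] at hd
    obtain ⟨x, hx, hxS⟩ := hd
    have := (a.closed x hxS).2
    rw [h.Kset_of_cell hm hx] at this
    exact hjm.trans this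

theorem tip_notMem_H (a : AddNode I c c' n S) (h : c.Frame I) {j : ℕ} (hj : j ∈ c.ids) :
    .tip n ∉ c.H j := fun ht => a.tip_notMem (h.H_subset j hj ht)

theorem not_new_subset (a : AddNode I c c' n S) (h : c.Frame I) {j : ℕ} (hj : j ∈ c.ids) :
    ¬ c'.H n ⊆ c.H j := by
  intro hs
  by_cases hS : c.HasSource I S
  · exact a.strict hS j hj (a.subset_H_new.trans hs)
  · exact a.tip_notMem_H h hj (hs (a.mem_H_new.2 (Or.inr ⟨hS, rfl⟩)))

theorem H_sub_or (a : AddNode I c c' n S) (h : c.Frame I) {j : ℕ} (hj : j ∈ c.ids) :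
    (c.cell I j ⊆ S ∧ c.H j ⊂ c'.H n) ∨ (Disjoint (c.cell I j) S ∧ Disjoint (c.H j) (c'.H n)) := by
  rcases a.cell_sub_or h hj with hs | hs
  · exact Or.inl ⟨hs, (H_subset_cell.trans hs).trans a.subset_H_new, a.not_new_subset h hj⟩
  · refine Or.inr ⟨hs, Finset.disjoint_left.2 fun x hx hxn => ?_⟩
    rcases a.mem_H_new.1 hxn with hx' | ⟨-, rfl⟩
    · exact Finset.disjoint_left.1 hs (H_subset_cell hx) hx'
    · exact a.tip_notMem_H h hj hx

theorem H_subset_new_iff (a : AddNode I c c' n S) (h : c.Frame I) {j : ℕ} (hj : j ∈ c.ids) :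
    c.H j ⊆ c'.H n ↔ c.cell I j ⊆ S := by
  constructor
  · intro hs
    rcases a.H_sub_or h hj with h' | ⟨-, h'⟩
    · exact h'.1
    · obtain ⟨x, hx⟩ := h.H_nonempty hj
      exact absurd (hs hx) (Finset.disjoint_left.1 h' hx)
  · intro hs
    exact (H_subset_cell.trans hs).trans a.subset_H_new

theorem frame (a : AddNode I c c' n S) (h : c.Frame I) : c'.Frame I where
  Bs_subset x hx := a.mem_Vstar.2 (a.Bs_new x hx)
  bud_tip i hi := by
    by_cases e : i = n
    · subst e; exact a.bud_tip (a.normal_new.1 hi)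
    · have hi' : i ∈ c.ids := (a.mem_ids.1 hi.1).resolve_left e
      have hn := (a.normal_old hi').1 hi
      rw [a.Bs_old _ (bud_mem_Vstar.2 hn), a.Bs_old _ (tip_mem_Vstar.2 hn)]
      exact h.bud_tip i hn
  H_subset i hi := by
    rcases a.mem_ids.1 hi with rfl | hi
    · intro x hx
      rw [a.mem_Vstar]
      rcases a.mem_H_new.1 hx with hx | ⟨h1, rfl⟩
      · exact Or.inl (a.closed x hx).1
      · exact Or.inr ⟨h1, Or.inr rfl⟩
    · rw [a.H_old hi]; exact (h.H_subset i hi).trans a.Vstar_subset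
  lines i hi v hv := by
    rcases a.mem_ids.1 hi with rfl | hi
    · rw [a.mem_H_new] at hv ⊢
      rcases hv with hv | ⟨-, hv⟩
      · obtain ⟨h1, h2⟩ := a.closed _ hv
        left
        apply h2
        rcases single_or (I := I) (c := c) (x := .orig v) with hs | ⟨m, hm, hv'⟩
        · rw [Kset_single hs]; simp [ParityInstance.bar]
        · rw [h.Kset_of_cell hm hv']
          rcases mem_cell.1 hv' with hv' | ⟨-, hv'⟩
          · exact H_subset_cell (h.lines m hm.1 v hv')
          · cases hv'
      · cases hv
    · rw [a.H_old hi] at hv ⊢; exact h.lines i hi v hv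
  laminar i hi j hj hij := by
    rcases a.mem_ids.1 hi with rfl | hi <;> rcases a.mem_ids.1 hj with rfl | hj
    · exact absurd rfl hij
    · rw [a.H_old hj]
      rcases a.H_sub_or h hj with h' | h'
      · exact Or.inr (Or.inr h'.2)
      · exact Or.inl h'.2.symm
    · rw [a.H_old hi]
      rcases a.H_sub_or h hi with h' | h'
      · exact Or.inr (Or.inl h'.2)
      · exact Or.inl h'.2
    · rw [a.H_old hi, a.H_old hj]; exact h.laminar i hi j hj hij
  one_source i hi x hx y hy sx sy := by
    rw [a.isSource_iff] at sx sy
    rcases a.mem_ids.1 hi with rfl | hi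
    · rw [a.mem_H_new] at hx hy
      refine a.one_source x (hx.resolve_right ?_) y (hy.resolve_right ?_) sx sy
      · rintro ⟨-, rfl⟩; obtain ⟨v, hv, -⟩ := sx; cases hv
      · rintro ⟨-, rfl⟩; obtain ⟨v, hv, -⟩ := sy; cases hv
    · rw [a.H_old hi] at hx hy; exact h.one_source i hi x hx y hy sx sy
  tip_mem i hi j hj := by
    rcases a.mem_ids.1 hi with rfl | hi <;> rcases a.mem_ids.1 hj.1 with rfl | hj'
    · exact iff_of_true (a.mem_H_new.2 (Or.inr ⟨a.normal_new.1 hj, rfl⟩)) subset_rfl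
    · rw [a.H_old hj', a.H_subset_new_iff h hj', a.mem_H_new]
      have nj := (a.normal_old hj').1 hj
      constructor
      · rintro (ht | ⟨-, ht⟩)
        · rcases a.cell_sub_or h hj' with h' | h'
          · exact h'
          · exact absurd ht (Finset.disjoint_left.1 h' (H_subset_cell (h.tip_self nj)))
        · cases ht; exact absurd hj' a.fresh
      · intro hs
        exact Or.inl (hs (H_subset_cell (h.tip_self nj)))
    · rw [a.H_old hi]
      exact iff_of_false (a.tip_notMem_H h hi) (a.not_new_subset h hi)
    · rw [a.H_old hi, a.H_old hj']; exact h.tip_mem i hi j ((a.normal_old hj').1 hj)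
  bud_mem i hi j hj := by
    rcases a.mem_ids.1 hi with rfl | hi <;> rcases a.mem_ids.1 hj.1 with rfl | hj'
    · refine iff_of_false (fun hb => ?_) (fun hs => hs.2 subset_rfl)
      rcases a.mem_H_new.1 hb with hb | ⟨-, hb⟩
      · exact a.bud_notMem (a.closed _ hb).1
      · cases hb
    · rw [a.H_old hj', a.mem_H_new]
      have nj := (a.normal_old hj').1 hj
      constructor
      · rintro (ht | ⟨-, ht⟩)
        · rcases a.H_sub_or h hj' with h' | h'
          · exact h'.2
          · exact absurd ht (Finset.disjoint_left.1 h'.1 (Frame.bud_mem_cell nj))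
        · cases ht
      · intro hs
        exact Or.inl ((a.H_subset_new_iff h hj').1 hs.1 (Frame.bud_mem_cell nj))
    · rw [a.H_old hi]
      refine iff_of_false (fun hb => a.bud_notMem (h.H_subset i hi hb))
        (fun hs => a.not_new_subset h hi hs.1)
    · rw [a.H_old hi, a.H_old hj']; exact h.bud_mem i hi j ((a.normal_old hj').1 hj)

theorem max_new (a : AddNode I c c' n S) (h : c.Frame I) : c'.IsMax n := by
  refine ⟨a.mem_ids.2 (Or.inl rfl), fun j hj hs => ?_⟩
  rcases a.mem_ids.1 hj with rfl | hj
  · exact hs.2 subset_rfl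
  · rw [a.H_old hj] at hs; exact a.not_new_subset h hj hs.1

theorem max_iff (a : AddNode I c c' n S) (h : c.Frame I) {j : ℕ} :
    c'.IsMax j ↔ j = n ∨ (c.IsMax j ∧ Disjoint (c.cell I j) S) := by
  by_cases e : j = n
  · subst e; simp [a.max_new h]
  · simp only [e, false_or]
    constructor
    · intro hm
      have hj := (a.mem_ids.1 hm.1).resolve_left e
      refine ⟨⟨hj, fun k hk hs => ?_⟩, ?_⟩
      · refine hm.2 k (a.mem_ids.2 (Or.inr hk)) ?_
        rwa [a.H_old hj, a.H_old hk]
      · rcases a.H_sub_or h hj with h' | h'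
        · refine absurd ?_ (hm.2 n (a.mem_ids.2 (Or.inl rfl)))
          rw [a.H_old hj]; exact h'.2
        · exact h'.1
    · rintro ⟨hm, hd⟩
      refine ⟨a.mem_ids.2 (Or.inr hm.1), fun k hk hs => ?_⟩
      rw [a.H_old hm.1] at hs
      rcases a.mem_ids.1 hk with rfl | hk
      · have := (a.H_subset_new_iff h hm.1).1 hs.1
        obtain ⟨x, hx⟩ := h.H_nonempty hm.1
        exact Finset.disjoint_left.1 hd (H_subset_cell hx) (this (H_subset_cell hx))
      · rw [a.H_old hk] at hs; exact hm.2 k hk hs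

theorem single_iff (a : AddNode I c c' n S) (h : c.Frame I) {x : Vtx V} :
    c'.Single I x ↔ c.Single I x ∧ x ∉ c'.cell I n := by
  constructor
  · intro hs
    refine ⟨fun j hj hx => ?_, hs n (a.max_new h)⟩
    rcases a.cell_sub_or h hj.1 with h' | h'
    · exact hs n (a.max_new h) (a.mem_cell_new.2 (Or.inl (h' hx)))
    · have := hs j ((a.max_iff h).2 (Or.inr ⟨hj, h'⟩))
      rw [a.cell_old hj.1] at this
      exact this hx
  · rintro ⟨hs, hn⟩ j hj hx
    rcases (a.max_iff h).1 hj with rfl | ⟨hj, -⟩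
    · exact hn hx
    · rw [a.cell_old hj.1] at hx; exact hs j hj hx

theorem Kset_new (a : AddNode I c c' n S) (h : c.Frame I) {x : Vtx V} (hx : x ∈ c'.cell I n) :
    c'.Kset I x = c'.cell I n :=
  (a.frame h).Kset_of_cell (a.max_new h) hx

theorem Kset_old (a : AddNode I c c' n S) (h : c.Frame I) {x : Vtx V} (hx : x ∉ c'.cell I n) :
    c'.Kset I x = c.Kset I x := by
  rcases single_or (I := I) (c := c) (x := x) with hs | ⟨j, hj, hxj⟩
  · rw [Kset_single hs, Kset_single ((a.single_iff h).2 ⟨hs, hx⟩)]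
  · rcases a.cell_sub_or h hj.1 with h' | h'
    · exact absurd (a.mem_cell_new.2 (Or.inl (h' hxj))) hx
    · have hm := (a.max_iff h).2 (Or.inr ⟨hj, h'⟩)
      rw [h.Kset_of_cell hj hxj, (a.frame h).Kset_of_cell hm (by rwa [a.cell_old hj.1]),
        a.cell_old hj.1]

theorem Kset_eq_iff (a : AddNode I c c' n S) (h : c.Frame I) {x y : Vtx V} :
    c'.Kset I x = c'.Kset I y ↔ (x ∈ c'.cell I n ∧ y ∈ c'.cell I n) ∨
      (x ∉ c'.cell I n ∧ y ∉ c'.cell I n ∧ c.Kset I x = c.Kset I y) := by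
  have h' := a.frame h
  by_cases h1 : x ∈ c'.cell I n <;> by_cases h2 : y ∈ c'.cell I n
  · simp [h1, h2, a.Kset_new h]
  · simp only [h1, h2, and_false, not_true, false_and, or_false, iff_false]
    rw [a.Kset_new h h1]
    exact fun e => h2 (e ▸ h'.mem_Kset_self y)
  · simp only [h1, h2, and_false, not_true, false_and, or_false, iff_false]
    rw [a.Kset_new h h2]
    exact fun e => h1 (e ▸ h'.mem_Kset_self x)
  · simp [h1, h2, a.Kset_old h]

theorem root_iff (a : AddNode I c c' n S) (h : c.Frame I) {x : Vtx V} :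
    c'.Root I x ↔ (x ∈ c'.cell I n ∧ c.HasSource I S) ∨ (x ∉ c'.cell I n ∧ c.Root I x) := by
  unfold Root
  by_cases hx : x ∈ c'.cell I n
  · simp only [hx, true_and, not_true, false_and, or_false]
    rw [a.Kset_new h hx, hasSource_congr a.base_eq]
    constructor
    · rintro ⟨y, hy, hs⟩
      refine ⟨y, (a.mem_cell_new.1 hy).resolve_right ?_, hs⟩
      rintro ⟨-, rfl | rfl⟩ <;> (obtain ⟨v, hv, -⟩ := hs; cases hv)
    · rintro ⟨y, hy, hs⟩
      exact ⟨y, a.mem_cell_new.2 (Or.inl hy), hs⟩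
  · simp [hx, a.Kset_old h hx, hasSource_congr a.base_eq]

theorem closed_Kset (a : AddNode I c c' n S) (h : c.Frame I) {x y : Vtx V}
    (hx : x ∈ S) (e : c.Kset I y = c.Kset I x) : y ∈ S :=
  (a.closed x hx).2 (e ▸ h.mem_Kset_self y)

theorem mem_cell_congr (a : AddNode I c c' n S) (h : c.Frame I) {x y : Vtx V}
    (hx : x ∈ c.Vstar I) (e : c.Kset I x = c.Kset I y)
    (hxn : x ∈ c'.cell I n) : y ∈ c'.cell I n := by
  rcases a.mem_cell_new.1 hxn with hx' | ⟨-, rfl | rfl⟩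
  · exact a.mem_cell_new.2 (Or.inl (a.closed_Kset h hx' e.symm))
  · exact absurd hx a.bud_notMem
  · exact absurd hx a.tip_notMem

end AddNode

/-- The maximal normal blossom `i` of `c` is replaced in `c'` by the blossom `n`, which has a new
bud and tip. -/
structure Replace (I : ParityInstance K U V) (c c' : Config K V) (n i : ℕ) : Prop where
  fresh : n ∉ c.ids
  max : c.IsMax i
  normal : c.IsNormal I i
  ids_eq : c'.ids = insert n (c.ids.erase i)
  H_eq : ∀ j, j ≠ n → c'.H j = c.H j
  H_new : c'.H n = insert (.tip n) (c.H i \ {.tip i})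
  base_eq : c'.base = c.base
  Bs_old : ∀ x ∈ c.Vstar I, x ≠ .bud i → x ≠ .tip i → (x ∈ c'.Bs ↔ x ∈ c.Bs)
  Bs_new : ∀ x ∈ c'.Bs, (x ∈ c.Vstar I ∧ x ≠ .bud i ∧ x ≠ .tip i) ∨ x = .bud n ∨ x = .tip n
  bud_tip : .bud n ∈ c'.Bs ↔ .tip n ∉ c'.Bs

namespace Replace

variable {i : ℕ}

theorem mem_ids (a : Replace I c c' n i) {j : ℕ} : j ∈ c'.ids ↔ j = n ∨ (j ∈ c.ids ∧ j ≠ i) := by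
  rw [a.ids_eq, Finset.mem_insert, Finset.mem_erase]; tauto

theorem H_old (a : Replace I c c' n i) {j : ℕ} (hj : j ∈ c.ids) : c'.H j = c.H j := by
  refine a.H_eq j ?_
  rintro rfl; exact a.fresh hj

theorem mem_H_new (a : Replace I c c' n i) {x : Vtx V} :
    x ∈ c'.H n ↔ x = .tip n ∨ (x ∈ c.H i ∧ x ≠ .tip i) := by
  rw [a.H_new]; simp

theorem normal_old (a : Replace I c c' n i) {j : ℕ} (hj : j ∈ c.ids) (hji : j ≠ i) :
    c'.IsNormal I j ↔ c.IsNormal I j := by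
  simp [IsNormal, a.mem_ids, hj, hji, a.H_old hj, hasSource_congr a.base_eq]

theorem normal_new (a : Replace I c c' n i) : c'.IsNormal I n := by
  refine ⟨a.mem_ids.2 (Or.inl rfl), ?_⟩
  rintro ⟨x, hx, hs⟩
  rw [isSource_congr a.base_eq] at hs
  rcases a.mem_H_new.1 hx with rfl | hx
  · obtain ⟨v, hv, -⟩ := hs; cases hv
  · exact a.normal.2 ⟨x, hx.1, hs⟩

theorem mem_cell_new (a : Replace I c c' n i) {x : Vtx V} :
    x ∈ c'.cell I n ↔ x = .bud n ∨ x = .tip n ∨ (x ∈ c.H i ∧ x ≠ .tip i) := by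
  rw [mem_cell, a.mem_H_new]; simp [a.normal_new]; tauto

theorem cell_old (a : Replace I c c' n i) {j : ℕ} (hj : j ∈ c.ids) (hji : j ≠ i) :
    c'.cell I j = c.cell I j := by
  ext x; rw [mem_cell, mem_cell, a.normal_old hj hji, a.H_old hj]

theorem not_normal_n (a : Replace I c c' n i) : ¬ c.IsNormal I n := fun h => a.fresh h.1

theorem bud_notMem (a : Replace I c c' n i) : .bud n ∉ c.Vstar I := by
  simpa using a.not_normal_n

theorem tip_notMem (a : Replace I c c' n i) : .tip n ∉ c.Vstar I := by
  simpa using a.not_normal_n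

theorem mem_Vstar (a : Replace I c c' n i) {x : Vtx V} :
    x ∈ c'.Vstar I ↔ (x ∈ c.Vstar I ∧ x ≠ .bud i ∧ x ≠ .tip i) ∨ x = .bud n ∨ x = .tip n := by
  have key : ∀ j, c'.IsNormal I j ↔ (c.IsNormal I j ∧ j ≠ i) ∨ j = n := by
    intro j
    by_cases e : j = n
    · subst e; simp [a.normal_new]
    · by_cases hj : j ∈ c.ids ∧ j ≠ i
      · simp [a.normal_old hj.1 hj.2, e, hj.2]
      · have h1 : j ∉ c'.ids := by simp only [a.mem_ids, e, false_or]; exact hj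
        have h2 : ¬ (c.IsNormal I j ∧ j ≠ i) := fun h => hj ⟨h.1.1, h.2⟩
        simp only [h2, e, or_self, iff_false]
        exact fun h => h1 h.1
  cases x <;> simp [key]

theorem tip_notMem_H (a : Replace I c c' n i) (h : c.Frame I) {j : ℕ} (hj : j ∈ c.ids) :
    .tip n ∉ c.H j := fun ht => a.tip_notMem (h.H_subset j hj ht)

theorem not_new_subset (a : Replace I c c' n i) (h : c.Frame I) {j : ℕ} (hj : j ∈ c.ids) :
    ¬ c'.H n ⊆ c.H j :=
  fun hs => a.tip_notMem_H h hj (hs (a.mem_H_new.2 (Or.inl rfl)))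

theorem tip_i_notMem (a : Replace I c c' n i) (h : c.Frame I) {j : ℕ} (hj : j ∈ c.ids)
    (hji : j ≠ i) : .tip i ∉ c.H j := by
  rw [h.tip_mem j hj i a.normal]
  intro hs
  rcases h.laminar j hj i a.max.1 hji with h' | h' | h'
  · obtain ⟨x, hx⟩ := h.H_nonempty a.max.1
    exact Finset.disjoint_left.1 h' (hs hx) hx
  · exact h'.2 hs
  · exact a.max.2 j hj h'

theorem bud_i_notMem (a : Replace I c c' n i) (h : c.Frame I) {j : ℕ} (hj : j ∈ c.ids) :
    .bud i ∉ c.H j := by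
  rw [h.bud_mem j hj i a.normal]
  exact a.max.2 j hj

theorem H_subset_new_iff (a : Replace I c c' n i) (h : c.Frame I) {j : ℕ} (hj : j ∈ c.ids)
    (hji : j ≠ i) : c.H j ⊆ c'.H n ↔ c.H j ⊆ c.H i := by
  constructor
  · intro hs x hx
    rcases a.mem_H_new.1 (hs hx) with rfl | h'
    · exact absurd hx (a.tip_notMem_H h hj)
    · exact h'.1
  · intro hs x hx
    refine a.mem_H_new.2 (Or.inr ⟨hs hx, ?_⟩)
    rintro rfl
    exact a.tip_i_notMem h hj hji hx

theorem H_ssubset_new_iff (a : Replace I c c' n i) (h : c.Frame I) {j : ℕ} (hj : j ∈ c.ids)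
    (hji : j ≠ i) : c.H j ⊂ c'.H n ↔ c.H j ⊆ c.H i :=
  ⟨fun hs => (a.H_subset_new_iff h hj hji).1 hs.1,
    fun hs => ⟨(a.H_subset_new_iff h hj hji).2 hs, a.not_new_subset h hj⟩⟩

theorem sub_or (a : Replace I c c' n i) (h : c.Frame I) {j : ℕ} (hj : j ∈ c.ids)
    (hji : j ≠ i) : c.H j ⊂ c.H i ∨ Disjoint (c.H j) (c.H i) := by
  rcases h.laminar j hj i a.max.1 hji with h' | h' | h'
  · exact Or.inr h'
  · exact Or.inl h'
  · exact absurd h' (a.max.2 j hj)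

theorem laminar_new (a : Replace I c c' n i) (h : c.Frame I) {j : ℕ} (hj : j ∈ c.ids)
    (hji : j ≠ i) : c.H j ⊂ c'.H n ∨ Disjoint (c.H j) (c'.H n) := by
  rcases a.sub_or h hj hji with h' | h'
  · exact Or.inl ((a.H_ssubset_new_iff h hj hji).2 h'.1)
  · refine Or.inr (Finset.disjoint_left.2 fun x hx hxn => ?_)
    rcases a.mem_H_new.1 hxn with rfl | hx'
    · exact a.tip_notMem_H h hj hx
    · exact Finset.disjoint_left.1 h' hx hx'.1

theorem frame (a : Replace I c c' n i) (h : c.Frame I) : c'.Frame I where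
  Bs_subset x hx := a.mem_Vstar.2 (a.Bs_new x hx)
  bud_tip j hj := by
    rcases a.mem_ids.1 hj.1 with rfl | ⟨hj', hji⟩
    · exact a.bud_tip
    · have hn := (a.normal_old hj' hji).1 hj
      rw [a.Bs_old _ (bud_mem_Vstar.2 hn) (by simpa using hji) (by simp),
        a.Bs_old _ (tip_mem_Vstar.2 hn) (by simp) (by simpa using hji)]
      exact h.bud_tip j hn
  H_subset j hj := by
    rcases a.mem_ids.1 hj with rfl | ⟨hj, hji⟩
    · intro x hx
      rw [a.mem_Vstar]
      rcases a.mem_H_new.1 hx with rfl | hx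
      · simp
      · refine Or.inl ⟨h.H_subset i a.max.1 hx.1, ?_, hx.2⟩
        rintro rfl; exact h.bud_notMem a.normal hx.1
    · rw [a.H_old hj]
      intro x hx
      refine a.mem_Vstar.2 (Or.inl ⟨h.H_subset j hj hx, ?_, ?_⟩)
      · rintro rfl; exact a.bud_i_notMem h hj hx
      · rintro rfl; exact a.tip_i_notMem h hj hji hx
  lines j hj v hv := by
    rcases a.mem_ids.1 hj with rfl | ⟨hj, hji⟩
    · rw [a.mem_H_new] at hv ⊢
      simp only [reduceCtorEq, ne_eq, not_false_eq_true, and_true, false_or] at hv ⊢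
      exact h.lines i a.max.1 v hv
    · rw [a.H_old hj] at hv ⊢; exact h.lines j hj v hv
  laminar j hj k hk hjk := by
    rcases a.mem_ids.1 hj with rfl | ⟨hj, hji⟩ <;> rcases a.mem_ids.1 hk with rfl | ⟨hk, hki⟩
    · exact absurd rfl hjk
    · rw [a.H_old hk]
      rcases a.laminar_new h hk hki with h' | h'
      · exact Or.inr (Or.inr h')
      · exact Or.inl h'.symm
    · rw [a.H_old hj]
      rcases a.laminar_new h hj hji with h' | h'
      · exact Or.inr (Or.inl h')
      · exact Or.inl h'
    · rw [a.H_old hj, a.H_old hk]; exact h.laminar j hj k hk hjk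
  one_source j hj x hx y hy sx sy := by
    rw [isSource_congr a.base_eq] at sx sy
    rcases a.mem_ids.1 hj with rfl | ⟨hj, hji⟩
    · rw [a.mem_H_new] at hx
      rcases hx with rfl | hx
      · obtain ⟨v, hv, -⟩ := sx; cases hv
      · exact absurd ⟨x, hx.1, sx⟩ a.normal.2
    · rw [a.H_old hj] at hx hy; exact h.one_source j hj x hx y hy sx sy
  tip_mem j hj k hk := by
    rcases a.mem_ids.1 hj with rfl | ⟨hj, hji⟩ <;> rcases a.mem_ids.1 hk.1 with rfl | ⟨hk', hki⟩
    · exact iff_of_true (a.mem_H_new.2 (Or.inl rfl)) subset_rfl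
    · rw [a.H_old hk', a.H_subset_new_iff h hk' hki, a.mem_H_new,
        ← h.tip_mem i a.max.1 k ((a.normal_old hk' hki).1 hk)]
      have : k ≠ j := by rintro rfl; exact a.fresh hk'
      simp [hki, this]
    · rw [a.H_old hj]
      exact iff_of_false (a.tip_notMem_H h hj) (a.not_new_subset h hj)
    · rw [a.H_old hj, a.H_old hk']; exact h.tip_mem j hj k ((a.normal_old hk' hki).1 hk)
  bud_mem j hj k hk := by
    rcases a.mem_ids.1 hj with rfl | ⟨hj, hji⟩ <;> rcases a.mem_ids.1 hk.1 with rfl | ⟨hk', hki⟩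
    · refine iff_of_false (fun hb => ?_) (fun hs => hs.2 subset_rfl)
      rcases a.mem_H_new.1 hb with hb | hb
      · cases hb
      · exact a.bud_notMem (h.H_subset i a.max.1 hb.1)
    · rw [a.H_old hk', a.H_ssubset_new_iff h hk' hki, a.mem_H_new,
        h.bud_mem i a.max.1 k ((a.normal_old hk' hki).1 hk)]
      simp only [reduceCtorEq, ne_eq, not_false_eq_true, and_true, false_or]
      refine ⟨fun h' => h'.1, fun hs => ?_⟩
      rcases a.sub_or h hk' hki with h' | h'
      · exact h'
      · obtain ⟨x, hx⟩ := h.H_nonempty hk'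
        exact absurd (hs hx) (Finset.disjoint_left.1 h' hx)
    · rw [a.H_old hj]
      exact iff_of_false (fun hb => a.bud_notMem (h.H_subset j hj hb))
        (fun hs => a.not_new_subset h hj hs.1)
    · rw [a.H_old hj, a.H_old hk']; exact h.bud_mem j hj k ((a.normal_old hk' hki).1 hk)

theorem max_new (a : Replace I c c' n i) (h : c.Frame I) : c'.IsMax n := by
  refine ⟨a.mem_ids.2 (Or.inl rfl), fun j hj hs => ?_⟩
  rcases a.mem_ids.1 hj with rfl | ⟨hj, -⟩
  · exact hs.2 subset_rfl
  · rw [a.H_old hj] at hs; exact a.not_new_subset h hj hs.1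

theorem max_iff (a : Replace I c c' n i) (h : c.Frame I) {j : ℕ} :
    c'.IsMax j ↔ j = n ∨ (c.IsMax j ∧ j ≠ i) := by
  by_cases e : j = n
  · subst e; simp [a.max_new h]
  · simp only [e, false_or]
    constructor
    · intro hm
      obtain ⟨hj, hji⟩ := (a.mem_ids.1 hm.1).resolve_left e
      refine ⟨⟨hj, fun k hk hs => ?_⟩, hji⟩
      by_cases hki : k = i
      · subst hki
        have := hm.2 n (a.mem_ids.2 (Or.inl rfl))
        rw [a.H_old hj] at this
        exact this ((a.H_ssubset_new_iff h hj hji).2 hs.1)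
      · have := hm.2 k (a.mem_ids.2 (Or.inr ⟨hk, hki⟩))
        rw [a.H_old hj, a.H_old hk] at this
        exact this hs
    · rintro ⟨hm, hji⟩
      refine ⟨a.mem_ids.2 (Or.inr ⟨hm.1, hji⟩), fun k hk hs => ?_⟩
      rw [a.H_old hm.1] at hs
      rcases a.mem_ids.1 hk with rfl | ⟨hk, hki⟩
      · rcases a.sub_or h hm.1 hji with h' | h'
        · exact hm.2 i a.max.1 h'
        · obtain ⟨x, hx⟩ := h.H_nonempty hm.1
          exact Finset.disjoint_left.1 h' hx ((a.H_ssubset_new_iff h hm.1 hji).1 hs hx)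
      · rw [a.H_old hk] at hs; exact hm.2 k hk hs

/-- The vertices that persist belong to the cell of `n` if they belonged to the cell of `i`. -/
theorem mem_cell_iff (a : Replace I c c' n i) {x : Vtx V} (hx : x ∈ c.Vstar I)
    (h1 : x ≠ .bud i) (h2 : x ≠ .tip i) : x ∈ c'.cell I n ↔ x ∈ c.cell I i := by
  rw [a.mem_cell_new, mem_cell]
  have e1 : x ≠ .bud n := by rintro rfl; exact a.bud_notMem hx
  have e2 : x ≠ .tip n := by rintro rfl; exact a.tip_notMem hx
  simp [e1, e2, h1, h2]

theorem single_iff (a : Replace I c c' n i) (h : c.Frame I) {x : Vtx V} (hx : x ∈ c'.Vstar I) :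
    c'.Single I x ↔ c.Single I x ∧ x ∉ c'.cell I n := by
  constructor
  · intro hs
    have hn := hs n (a.max_new h)
    refine ⟨fun j hj hxj => ?_, hn⟩
    by_cases hji : j = i
    · subst hji
      rcases a.mem_Vstar.1 hx with ⟨h0, h1, h2⟩ | hx
      · exact hn ((a.mem_cell_iff h0 h1 h2).2 hxj)
      · exact hn (a.mem_cell_new.2 (by tauto))
    · refine hs j ((a.max_iff h).2 (Or.inr ⟨hj, hji⟩)) ?_
      rwa [a.cell_old hj.1 hji]
  · rintro ⟨hs, hn⟩ j hj hxj
    rcases (a.max_iff h).1 hj with rfl | ⟨hj, hji⟩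
    · exact hn hxj
    · rw [a.cell_old hj.1 hji] at hxj; exact hs j hj hxj

theorem Kset_new (a : Replace I c c' n i) (h : c.Frame I) {x : Vtx V} (hx : x ∈ c'.cell I n) :
    c'.Kset I x = c'.cell I n :=
  (a.frame h).Kset_of_cell (a.max_new h) hx

theorem Kset_old (a : Replace I c c' n i) (h : c.Frame I) {x : Vtx V} (hx : x ∈ c'.Vstar I)
    (hxn : x ∉ c'.cell I n) : c'.Kset I x = c.Kset I x := by
  rcases single_or (I := I) (c := c') (x := x) with hs | ⟨j, hj, hxj⟩
  · rw [Kset_single hs, Kset_single ((a.single_iff h hx).1 hs).1]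
  · rcases (a.max_iff h).1 hj with rfl | ⟨hj', hji⟩
    · exact absurd hxj hxn
    · rw [(a.frame h).Kset_of_cell hj hxj, h.Kset_of_cell hj' (by rwa [← a.cell_old hj'.1 hji]),
        a.cell_old hj'.1 hji]

theorem Kset_eq_iff (a : Replace I c c' n i) (h : c.Frame I) {x y : Vtx V}
    (hx : x ∈ c'.Vstar I) (hy : y ∈ c'.Vstar I) :
    c'.Kset I x = c'.Kset I y ↔ (x ∈ c'.cell I n ∧ y ∈ c'.cell I n) ∨
      (x ∉ c'.cell I n ∧ y ∉ c'.cell I n ∧ c.Kset I x = c.Kset I y) := by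
  have h' := a.frame h
  by_cases h1 : x ∈ c'.cell I n <;> by_cases h2 : y ∈ c'.cell I n
  · simp [h1, h2, a.Kset_new h]
  · simp only [h1, h2, and_false, not_true, false_and, or_false, iff_false]
    rw [a.Kset_new h h1]
    exact fun e => h2 (e ▸ h'.mem_Kset_self y)
  · simp only [h1, h2, and_false, not_true, false_and, or_false, iff_false]
    rw [a.Kset_new h h2]
    exact fun e => h1 (e ▸ h'.mem_Kset_self x)
  · simp [h1, h2, a.Kset_old h, hx, hy]

theorem root_iff (a : Replace I c c' n i) (h : c.Frame I) {x : Vtx V} (hx : x ∈ c'.Vstar I) :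
    c'.Root I x ↔ x ∉ c'.cell I n ∧ c.Root I x := by
  by_cases hxn : x ∈ c'.cell I n
  · simp only [hxn, not_true, false_and, iff_false]
    exact (a.frame h).root_normal (a.max_new h) a.normal_new hxn
  · simp [hxn, Root, a.Kset_old h hx hxn, hasSource_congr a.base_eq]

end Replace

end Config

/-! ### Pivoting -/

section Pivot

variable {K X : Type*} [Field K] {W B S : Finset X} {C C' : X → X → K}

/-- The vector `x` is in the kernel of the matrix `(1 C)`, whose columns are indexed by `B` and
`W \ B`. -/
def InKer (W B : Finset X) (C : X → X → K) (x : X → K) : Prop :=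
  ∀ u ∈ B, x u + ∑ v ∈ W \ B, C u v * x v = 0

/-- Pivoting does not change the kernel of `(1 C)`. -/
theorem IsPivot.inKer_iff (h : IsPivot W B S C C') (hS : S ⊆ W) (x : X → K) :
    InKer W B C x ↔ InKer W (symmDiff B S) C' x := by
  set R := W \ (B ∪ S) with hR
  have e1 : W \ B = (S \ B) ∪ R := by
    ext a
    have := @hS a
    simp only [hR, Finset.mem_sdiff, Finset.mem_union]; tauto
  have d1 : Disjoint (S \ B) R := by
    rw [Finset.disjoint_left]; intro a; simp only [hR, Finset.mem_sdiff, Finset.mem_union]; tauto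
  have e2 : W \ symmDiff B S = (S ∩ B) ∪ R := by
    ext a
    have := @hS a
    simp only [hR, Finset.mem_sdiff, Finset.mem_union, Finset.mem_symmDiff, Finset.mem_inter]
    tauto
  have d2 : Disjoint (S ∩ B) R := by
    rw [Finset.disjoint_left]; intro a
    simp only [hR, Finset.mem_sdiff, Finset.mem_union, Finset.mem_inter]; tauto
  set a : X → K := fun k => x k + ∑ v ∈ R, C k v * x v with ha
  have k1 : InKer W B C x ↔ (∀ k ∈ S ∩ B, a k + ∑ j ∈ S \ B, C k j * x j = 0) ∧
      (∀ u ∈ B \ S, a u + ∑ j ∈ S \ B, C u j * x j = 0) := by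
    have : ∀ u, x u + ∑ v ∈ W \ B, C u v * x v = a u + ∑ j ∈ S \ B, C u j * x j := by
      intro u; rw [e1, Finset.sum_union d1, ha]; ring
    simp only [InKer, this, Finset.mem_inter, Finset.mem_sdiff]
    constructor
    · intro h; exact ⟨fun k hk => h k hk.2, fun k hk => h k hk.1⟩
    · rintro ⟨h1, h2⟩ u hu
      by_cases hs : u ∈ S
      · exact h1 u ⟨hs, hu⟩
      · exact h2 u ⟨hu, hs⟩
  have k2 : InKer W (symmDiff B S) C' x ↔ (∀ j ∈ S \ B, x j + ∑ k ∈ S ∩ B, C' j k * a k = 0) ∧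
      (∀ u ∈ B \ S, a u - ∑ j ∈ S \ B, C u j * ∑ k ∈ S ∩ B, C' j k * a k = 0) := by
    have r1 : ∀ j ∈ S \ B, x j + ∑ v ∈ W \ symmDiff B S, C' j v * x v =
        x j + ∑ k ∈ S ∩ B, C' j k * a k := by
      intro j hj
      rw [e2, Finset.sum_union d2, ha]
      simp only [mul_add, Finset.sum_add_distrib, Finset.mul_sum]
      congr 2
      rw [Finset.sum_comm]
      refine Finset.sum_congr rfl fun v hv => ?_
      rw [h.upper_right j hj v hv, Finset.sum_mul]
      exact Finset.sum_congr rfl fun k _ => by ring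
    have r2 : ∀ u ∈ B \ S, x u + ∑ v ∈ W \ symmDiff B S, C' u v * x v =
        a u - ∑ j ∈ S \ B, C u j * ∑ k ∈ S ∩ B, C' j k * a k := by
      intro u hu
      rw [e2, Finset.sum_union d2]
      have t1 : ∑ k ∈ S ∩ B, C' u k * x k
          = - ∑ j ∈ S \ B, C u j * ∑ k ∈ S ∩ B, C' j k * x k := by
        rw [Finset.sum_congr rfl fun k hk => by rw [h.lower_left u hu k hk]]
        simp only [neg_mul, Finset.sum_neg_distrib, Finset.sum_mul, Finset.mul_sum]
        rw [Finset.sum_comm]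
        simp only [mul_assoc]
      have t2 : ∑ v ∈ R, C' u v * x v = ∑ v ∈ R, C u v * x v
          - ∑ j ∈ S \ B, C u j * ∑ k ∈ S ∩ B, C' j k * ∑ v ∈ R, C k v * x v := by
        rw [Finset.sum_congr rfl fun v hv => by rw [h.lower_right u hu v hv]]
        simp only [sub_mul, Finset.sum_sub_distrib, Finset.sum_mul, Finset.mul_sum]
        congr 1
        rw [Finset.sum_comm]
        refine Finset.sum_congr rfl fun j _ => ?_
        rw [Finset.sum_comm]
        simp only [mul_assoc]
      rw [t1, t2, ha]
      simp only [mul_add, Finset.sum_add_distrib]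
      ring
    simp only [InKer, Finset.mem_symmDiff]
    constructor
    · intro h0
      refine ⟨fun j hj => ?_, fun u hu => ?_⟩
      · rw [← r1 j hj]; exact h0 j (by rw [Finset.mem_sdiff] at hj; exact Or.inr hj)
      · rw [← r2 u hu]; exact h0 u (by rw [Finset.mem_sdiff] at hu; exact Or.inl hu)
    · rintro ⟨h1, h2⟩ u (hu | hu)
      · have hu : u ∈ B \ S := Finset.mem_sdiff.2 hu
        rw [r2 u hu]; exact h2 u hu
      · have hu : u ∈ S \ B := Finset.mem_sdiff.2 hu
        rw [r1 u hu]; exact h1 u hu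
  rw [k1, k2]
  have p : (∀ k ∈ S ∩ B, a k + ∑ j ∈ S \ B, C k j * x j = 0) ↔
      ∀ j ∈ S \ B, x j + ∑ k ∈ S ∩ B, C' j k * a k = 0 := by
    constructor
    · intro h0 j hj
      have : ∑ k ∈ S ∩ B, C' j k * a k = - ∑ i ∈ S \ B, (if j = i then 1 else 0) * x i := by
        rw [Finset.sum_congr rfl fun k hk => by rw [eq_neg_of_add_eq_zero_left (h0 k hk)]]
        simp only [mul_neg, Finset.sum_neg_distrib, Finset.mul_sum]
        rw [Finset.sum_comm]
        congr 1
        refine Finset.sum_congr rfl fun i hi => ?_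
        rw [← h.left_inv j hj i hi, Finset.sum_mul]
        simp only [mul_assoc]
      rw [this]
      simp [Finset.sum_ite_eq, hj, -Finset.mem_sdiff]
    · intro h0 k hk
      have : ∑ j ∈ S \ B, C k j * x j = - ∑ l ∈ S ∩ B, (if k = l then 1 else 0) * a l := by
        rw [Finset.sum_congr rfl fun j hj => by rw [eq_neg_of_add_eq_zero_left (h0 j hj)]]
        simp only [mul_neg, Finset.sum_neg_distrib, Finset.mul_sum]
        rw [Finset.sum_comm]
        congr 1
        refine Finset.sum_congr rfl fun l hl => ?_
        rw [← h.right_inv k hk l hl, Finset.sum_mul]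
        simp only [mul_assoc]
      rw [this]
      simp [Finset.sum_ite_eq, hk, -Finset.mem_inter]
  rw [p]
  refine and_congr_right fun h0 => forall₂_congr fun u _ => ?_
  have : ∑ j ∈ S \ B, C u j * ∑ k ∈ S ∩ B, C' j k * a k = - ∑ j ∈ S \ B, C u j * x j := by
    rw [← Finset.sum_neg_distrib]
    refine Finset.sum_congr rfl fun j hj => ?_
    rw [eq_neg_of_add_eq_zero_right (h0 j hj), mul_neg]
  rw [this, sub_neg_eq_add]

/-- Adjacency in the undirected graph of the nonzero entries of a matrix with row set `B` and
column set `W \ B`. -/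
def MatAdj (W B : Finset X) (C : X → X → K) (x y : X) : Prop :=
  (x ∈ B ∧ y ∈ W \ B ∧ C x y ≠ 0) ∨ (y ∈ B ∧ x ∈ W \ B ∧ C y x ≠ 0)

theorem inter_sdiff_pair {k j : X} (hk : k ∈ B) (hj : j ∉ B) :
    ({k, j} : Finset X) ∩ B = {k} ∧ ({k, j} : Finset X) \ B = {j} := by
  constructor <;> ext a <;>
    simp only [Finset.mem_inter, Finset.mem_sdiff, Finset.mem_insert, Finset.mem_singleton] <;>
    constructor
  · rintro ⟨rfl | rfl, h⟩
    · rfl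
    · exact absurd h hj
  · rintro rfl; exact ⟨Or.inl rfl, hk⟩
  · rintro ⟨rfl | rfl, h⟩
    · exact absurd hk h
    · rfl
  · rintro rfl; exact ⟨Or.inr rfl, hj⟩

/-- After a pivot around `{k, j}`, a new edge at a vertex `x` stems from an edge between `x` and
one of `k`, `j`. -/
theorem IsPivot.adj {k j : X} (h : IsPivot W B {k, j} C C') (hk : k ∈ B)
    (hj : j ∈ W \ B) {x y : X} (hx : x ≠ k ∧ x ≠ j)
    (ha : MatAdj W (symmDiff B {k, j}) C' x y) :
    MatAdj W B C x y ∨ (MatAdj W B C x j ∧ (y = k ∨ MatAdj W B C k y)) ∨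
      (MatAdj W B C x k ∧ (y = j ∨ MatAdj W B C j y)) := by
  have hjB := (Finset.mem_sdiff.1 hj).2
  obtain ⟨e1, e2⟩ := inter_sdiff_pair hk hjB
  have ur := h.upper_right
  have ll := h.lower_left
  have lr := h.lower_right
  rw [e1, e2] at lr ur ll
  simp only [Finset.mem_singleton, Finset.sum_singleton, forall_eq] at lr ur ll
  rcases ha with ⟨h1, h2, h3⟩ | ⟨h1, h2, h3⟩
  · have hxB : x ∈ B := by
      simp only [Finset.mem_symmDiff, Finset.mem_insert, Finset.mem_singleton] at h1; tauto
    have hxS : x ∈ B \ {k, j} := by simp [hxB, hx]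
    by_cases hyk : y = k
    · subst hyk
      rw [ll x hxS] at h3
      exact Or.inr (Or.inl ⟨Or.inl ⟨hxB, hj, fun h0 => h3 (by simp [h0])⟩, Or.inl rfl⟩)
    · have hyB : y ∉ B := fun hyB => by
        simp only [Finset.mem_sdiff, Finset.mem_symmDiff, Finset.mem_insert,
          Finset.mem_singleton] at h2
        have : y ≠ j := by rintro rfl; exact hjB hyB
        tauto
      have hyS : y ∈ W \ (B ∪ {k, j}) := by
        simp only [Finset.mem_sdiff, Finset.mem_symmDiff, Finset.mem_insert,
          Finset.mem_singleton, Finset.mem_union] at h2 ⊢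
        tauto
      have hyW : y ∈ W \ B := Finset.mem_sdiff.2 ⟨(Finset.mem_sdiff.1 h2).1, hyB⟩
      rw [lr x hxS y hyS] at h3
      by_cases h0 : C x y = 0
      · right; left
        rw [h0, zero_sub, neg_ne_zero] at h3
        exact ⟨Or.inl ⟨hxB, hj, fun h => h3 (by simp [h])⟩,
          Or.inr (Or.inl ⟨hk, hyW, fun h => h3 (by simp [h])⟩)⟩
      · exact Or.inl (Or.inl ⟨hxB, hyW, h0⟩)
  · have hxB : x ∉ B := fun hxB => by
      simp only [Finset.mem_sdiff, Finset.mem_symmDiff, Finset.mem_insert,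
        Finset.mem_singleton] at h2
      tauto
    have hxW : x ∈ W \ B := Finset.mem_sdiff.2 ⟨(Finset.mem_sdiff.1 h2).1, hxB⟩
    have hxS : x ∈ W \ (B ∪ {k, j}) := by
      simp only [Finset.mem_sdiff, Finset.mem_insert, Finset.mem_singleton, Finset.mem_union]
        at hxW ⊢
      tauto
    by_cases hyj : y = j
    · subst hyj
      rw [ur x hxS] at h3
      exact Or.inr (Or.inr ⟨Or.inr ⟨hk, hxW, fun h0 => h3 (by simp [h0])⟩, Or.inl rfl⟩)
    · have hyB : y ∈ B := by
        simp only [Finset.mem_symmDiff, Finset.mem_insert, Finset.mem_singleton] at h1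
        rcases h1 with h1 | ⟨rfl | rfl, -⟩
        · exact h1.1
        · exact hk
        · exact absurd rfl hyj
      have hyk : y ≠ k := by
        rintro rfl
        simp [Finset.mem_symmDiff, hk] at h1
      have hyS : y ∈ B \ {k, j} := by simp [hyB, hyj, hyk]
      rw [lr y hyS x hxS] at h3
      by_cases h0 : C y x = 0
      · right; right
        rw [h0, zero_sub, neg_ne_zero] at h3
        exact ⟨Or.inr ⟨hk, hxW, fun h => h3 (by simp [h])⟩,
          Or.inr (Or.inr ⟨hyB, hj, fun h => h3 (by simp [h])⟩)⟩
      · exact Or.inl (Or.inr ⟨hyB, hxW, h0⟩)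

end Pivot

/-! ### The matrix `C*` represents the matroid -/

section Represents

variable {K U V : Type*} [Field K] [Fintype U] [Fintype V]

/-- The matrix `C` with row set `B` and column set `W \ B` encodes the column matroid of the given
matrix: a vector in the kernel of `(1 C)` that vanishes on the buds and tips in `B` gives a vector
in the kernel of the given matrix, and is determined by it. -/
def Represents (I : ParityInstance K U V) (W B : Finset (Vtx V)) (C : Vtx V → Vtx V → K) : Prop :=
  ∀ x, InKer W B C x → (∀ y ∈ B, (∀ v, y ≠ .orig v) → x y = 0) →
    (∀ i, ∑ v, I.A i v * x (.orig v) = 0) ∧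
      ((∀ v, x (.orig v) = 0) → ∀ y ∈ W, x y = 0)

theorem Config.BT1.represents {I : ParityInstance K U V} {c : Config K V} (h : c.BT1 I) :
    Represents I (c.Vstar I) c.Bs c.C := by
  obtain ⟨C', hp, hf⟩ := h
  intro x hx h0
  have hT : c.T I ⊆ c.Vstar I := fun y hy => (Config.mem_T.1 hy).1
  rw [hp.inKer_iff hT] at hx
  have hz : ∀ v ∈ c.Vstar I \ symmDiff c.Bs (c.T I), (∀ w, v ≠ .orig w) → x v = 0 := by
    intro v hv hv'
    refine h0 v ?_ hv'
    have := Config.mem_T.2 ⟨(Finset.mem_sdiff.1 hv).1, hv'⟩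
    have := (Finset.mem_sdiff.1 hv).2
    rw [Finset.mem_symmDiff] at this
    tauto
  refine ⟨fun i => ?_, fun hv y hy => ?_⟩
  · have hrow : ∀ u ∈ c.base,
        x (.orig u) = - ∑ v ∈ c.baseᶜ, C' (.orig u) (.orig v) * x (.orig v) := by
      intro u hu
      have hu' : Vtx.orig u ∈ c.Bs := by simpa [Config.base] using hu
      have := hx (.orig u) (Finset.mem_symmDiff.2 (Or.inl ⟨hu', by simp [Config.mem_T]⟩))
      rw [eq_neg_of_add_eq_zero_left this]
      congr 1
      rw [← Finset.sum_image (s := c.baseᶜ) (g := Vtx.orig)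
        (f := fun v => C' (.orig u) v * x v) (by simp [Set.InjOn])]
      symm
      refine Finset.sum_subset ?_ ?_
      · intro v hv
        obtain ⟨w, hw, rfl⟩ := Finset.mem_image.1 hv
        simp only [Config.base, Finset.mem_compl, Finset.mem_filter, Finset.mem_univ, true_and]
          at hw
        simp [Finset.mem_symmDiff, hw, Config.mem_T]
      · intro v hv hv'
        rw [hz v hv, mul_zero]
        rintro w rfl
        apply hv'
        simp only [Finset.mem_sdiff, Finset.mem_symmDiff, Config.mem_T, not_or, not_and] at hv
        simp only [Config.base, Finset.mem_image, Finset.mem_compl, Finset.mem_filter,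
          Finset.mem_univ, true_and]
        exact ⟨w, fun h => by simpa using hv.2.1 h, rfl⟩
    rw [← Finset.sum_add_sum_compl c.base, Finset.sum_congr rfl fun u hu => by rw [hrow u hu],
      Finset.sum_congr (s₁ := c.baseᶜ) rfl fun v hv => by
        rw [← hf v (Finset.mem_compl.1 hv) i, Finset.sum_mul]]
    simp only [mul_neg, Finset.sum_neg_distrib, Finset.mul_sum]
    rw [Finset.sum_comm, neg_add_eq_zero]
    exact Finset.sum_congr rfl fun _ _ => Finset.sum_congr rfl fun _ _ => by ring
  · have hcol : ∀ v ∈ c.Vstar I \ symmDiff c.Bs (c.T I), x v = 0 := by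
      intro v hv'
      by_cases h' : ∃ w, v = .orig w
      · obtain ⟨w, rfl⟩ := h'; exact hv w
      · push Not at h'; exact hz v hv' h'
    by_cases hy' : y ∈ symmDiff c.Bs (c.T I)
    · have := hx y hy'
      rwa [Finset.sum_eq_zero (fun v hv => by rw [hcol v hv, mul_zero]), add_zero] at this
    · exact hcol y (by simp [hy, hy'])

/-- Attaching a bud and a tip, of which `e` gets a new row and `f` a new column, and pivoting
around them. -/
theorem Represents.attach {I : ParityInstance K U V} {W B : Finset (Vtx V)}
    {C C₁ C' : Vtx V → Vtx V → K} (h : Represents I W B C) (hB : B ⊆ W) {e f : Vtx V}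
    (he : e ∉ W) (hf : f ∉ W) (hef : e ≠ f) (hfo : ∀ v, f ≠ .orig v)
    (hC : ∀ u ∈ W, ∀ v ∈ W, C₁ u v = C u v)
    (hp : IsPivot (W ∪ {e, f}) (insert e B) {e, f} C₁ C') :
    Represents I (W ∪ {e, f}) (symmDiff (insert e B) {e, f}) C' := by
  intro x hx h0
  have hfB : f ∉ B := fun h' => hf (hB h')
  have heB : e ∉ B := fun h' => he (hB h')
  rw [← hp.inKer_iff Finset.subset_union_right] at hx
  have hxf : x f = 0 := h0 f (by simp [Finset.mem_symmDiff, hfB, hef.symm]) hfo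
  have hset : (W ∪ {e, f}) \ insert e B = insert f (W \ B) := by
    ext a
    simp only [Finset.mem_sdiff, Finset.mem_insert, Finset.mem_union, Finset.mem_singleton]
    constructor
    · tauto
    · rintro (rfl | ⟨h1, h2⟩)
      · exact ⟨by tauto, by push Not; exact ⟨hef.symm, hfB⟩⟩
      · exact ⟨by tauto, by push Not; exact ⟨by rintro rfl; exact he h1, h2⟩⟩
  have hfW : f ∉ W \ B := by simp [hf]
  have hx' : InKer W B C x := by
    intro u hu
    have := hx u (by simp [hu])
    rw [hset, Finset.sum_insert hfW, hxf, mul_zero, zero_add] at this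
    rw [← this]
    congr 1
    exact Finset.sum_congr rfl fun v hv => by rw [hC u (hB hu) v (Finset.mem_sdiff.1 hv).1]
  obtain ⟨h1, h2⟩ := h x hx' (fun y hy hyo => h0 y (by
    rw [Finset.mem_symmDiff]
    left
    simp only [Finset.mem_insert, hy, or_true, Finset.mem_singleton, not_or, true_and]
    exact ⟨by rintro rfl; exact heB hy, by rintro rfl; exact hfB hy⟩) hyo)
  refine ⟨h1, fun hv y hy => ?_⟩
  have hW := h2 hv
  rcases Finset.mem_union.1 hy with hy | hy
  · exact hW y hy
  · rcases Finset.mem_insert.1 hy with rfl | hy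
    · have := hx y (by simp)
      rwa [hset, Finset.sum_eq_zero (fun v hv' => ?_), add_zero] at this
      rcases Finset.mem_insert.1 hv' with rfl | hv'
      · rw [hxf, mul_zero]
      · rw [hW v (Finset.mem_sdiff.1 hv').1, mul_zero]
    · rw [Finset.mem_singleton.1 hy, hxf]

/-- Pivoting around a bud and a tip and deleting them. -/
theorem Represents.expand {I : ParityInstance K U V} {W B : Finset (Vtx V)}
    {C C' : Vtx V → Vtx V → K} (h : Represents I W B C) (hB : B ⊆ W) {k j : Vtx V}
    (hk : k ∈ B) (hj : j ∈ W \ B) (hko : ∀ v, k ≠ .orig v) (hjo : ∀ v, j ≠ .orig v)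
    (hp : IsPivot W B {k, j} C C') :
    Represents I (W \ {k, j}) (symmDiff B {k, j} \ {k, j}) C' := by
  intro x hx h0
  obtain ⟨hjW, hjB⟩ := Finset.mem_sdiff.1 hj
  have hkj : k ≠ j := by rintro rfl; exact hjB hk
  set D : Finset (Vtx V) := {k, j} with hD
  have kD : k ∈ D := by simp [hD]
  have jD : j ∈ D := by simp [hD]
  have hB' : symmDiff B D \ D = B \ D := by
    ext a; simp only [Finset.mem_sdiff, Finset.mem_symmDiff]; tauto
  have hset : W \ symmDiff B D = insert k ((W \ D) \ (symmDiff B D \ D)) := by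
    ext a
    simp only [hB', Finset.mem_sdiff, Finset.mem_symmDiff, Finset.mem_insert]
    by_cases e1 : a = k
    · subst e1; simp [hB hk, hk, kD]
    · by_cases e2 : a = j
      · subst e2; simp [hjB, jD, e1]
      · have : a ∉ D := by simp [hD, e1, e2]
        simp [this, e1]
  have hkn : k ∉ (W \ D) \ (symmDiff B D \ D) := by simp [kD]
  -- extend `x` by `0` at `k`, and by the value that the row of `j` forces at `j`
  set x' : Vtx V → K := fun y => if y = k then 0 else if y = j then
    - ∑ v ∈ (W \ D) \ (symmDiff B D \ D), C' j v * x v else x y with hx'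
  have hx'e : ∀ y, y ∉ D → x' y = x y := by
    intro y hy
    have : y ≠ k ∧ y ≠ j := by
      simp only [hD, Finset.mem_insert, Finset.mem_singleton, not_or] at hy; exact hy
    simp [hx', this]
  have hsum : ∀ u, ∑ v ∈ W \ symmDiff B D, C' u v * x' v
      = ∑ v ∈ (W \ D) \ (symmDiff B D \ D), C' u v * x v := by
    intro u
    rw [hset, Finset.sum_insert hkn]
    have : x' k = 0 := by simp [hx']
    rw [this, mul_zero, zero_add]
    refine Finset.sum_congr rfl fun v hv => ?_
    rw [hx'e v (Finset.mem_sdiff.1 (Finset.mem_sdiff.1 hv).1).2]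
  have hker : InKer W B C x' := by
    rw [hp.inKer_iff (by
      intro a ha
      rcases Finset.mem_insert.1 ha with rfl | ha
      · exact hB hk
      · rwa [Finset.mem_singleton.1 ha])]
    intro u hu
    rw [hsum]
    by_cases e : u = j
    · subst e
      simp [hx', hkj.symm]
    · have hu' : u ∈ symmDiff B D \ D := by
        refine Finset.mem_sdiff.2 ⟨hu, fun huD => ?_⟩
        simp only [hD, Finset.mem_insert, Finset.mem_singleton] at huD
        rcases huD with rfl | rfl
        · simp [Finset.mem_symmDiff, hk, kD] at hu
        · exact e rfl
      rw [hx'e u (Finset.mem_sdiff.1 hu').2]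
      exact hx u hu'
  obtain ⟨h1, h2⟩ := h x' hker (fun y hy hyo => by
    by_cases e : y = k
    · simp [hx', e]
    · have hyD : y ∉ D := by
        simp only [hD, Finset.mem_insert, Finset.mem_singleton, not_or]
        exact ⟨e, by rintro rfl; exact hjB hy⟩
      rw [hx'e y hyD]
      exact h0 y (by rw [hB']; simp [hy, hyD]) hyo)
  have ho : ∀ v, x' (.orig v) = x (.orig v) := fun v => by
    simp [hx', (hko v).symm, (hjo v).symm]
  simp only [ho] at h1 h2
  refine ⟨h1, fun hv y hy => ?_⟩
  rw [Finset.mem_sdiff] at hy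
  rw [← hx'e y hy.2]
  exact h2 hv y hy.1

end Represents

variable {K U V : Type*} [Field K] [Fintype U] [Fintype V]

namespace Config

/-! ### Edges that leave a vertex set -/

/-- The vertex `x` has an edge of `F*` to a vertex outside of `F`. -/
def Exits (I : ParityInstance K U V) (c : Config K V) (F : Finset (Vtx V)) (x : Vtx V) : Prop :=
  ∃ y ∈ c.Vstar I, y ∉ F ∧ c.Adj I x y

variable {I : ParityInstance K U V} {c c' : Config K V}

theorem adj_iff {x y : Vtx V} : c.Adj I x y ↔ MatAdj (c.Vstar I) c.Bs c.C x y := Iff.rfl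

theorem AdjT.adj {x y : Vtx V} (h : c.AdjT I x y) : c.Adj I x y :=
  h.imp (fun h => h.1) (fun h => h.1)

theorem Adj.symm {x y : Vtx V} (h : c.Adj I x y) : c.Adj I y x := Or.symm h

theorem Adj.mem_right (hf : c.Frame I) {x y : Vtx V} (h : c.Adj I x y) : y ∈ c.Vstar I := by
  rcases h with h | h
  · exact (Finset.mem_sdiff.1 h.2.1).1
  · exact hf.Bs_subset h.1

theorem Adj.ne {x y : Vtx V} (h : c.Adj I x y) : x ≠ y := by
  rintro rfl
  rcases h with h | h <;> exact (Finset.mem_sdiff.1 h.2.1).2 h.1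

theorem mem_Hminus {i : ℕ} {x : Vtx V} :
    x ∈ c.Hminus I i ↔ x ∈ c.H i ∧ x ≠ .tip i ∧ c.Exits I (c.H i) x := by
  simp [Hminus, Exits]

theorem mem_Hbul {i : ℕ} {x : Vtx V} :
    x ∈ c.Hbul I i ↔ x ∈ c.H i ∧ ((∃ v, x = .orig v) ∨ (x ≠ .tip i ∧ c.Exits I (c.H i) x)) := by
  rw [Hbul, Finset.mem_union, mem_Hminus, Finset.mem_filter]; tauto

theorem Hbul_subset {i : ℕ} : c.Hbul I i ⊆ c.H i := fun _ hx => (mem_Hbul.1 hx).1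

/-- Condition (BT2) for a normal blossom: the only neighbor of its tip outside of it is its bud. -/
theorem BT2.tip_closed (h : c.BT2 I) (hf : c.Frame I) {i : ℕ} (hi : c.IsNormal I i) :
    ¬ c.Exits I (c.cell I i) (.tip i) := by
  rintro ⟨y, hy, hyc, ha⟩
  rw [mem_cell] at hyc
  push Not at hyc
  have hyb := hyc.2 hi
  have hbt := hf.bud_tip i hi
  rcases ha with ⟨h1, h2, h3⟩ | ⟨h1, h2, h3⟩
  · exact h3 (((h i hi).2 (by tauto) h1).2.2 y (Finset.mem_sdiff.2 ⟨h2, hyc.1⟩) hyb)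
  · have h2' := (Finset.mem_sdiff.1 h2).2
    exact h3 (((h i hi).1 (by tauto) h2').2.2 y (Finset.mem_sdiff.2 ⟨h1, hyc.1⟩) hyb)

end Config

namespace SearchState

open Config

variable {I : ParityInstance K U V} {s s' : SearchState K V}

/-! ### Attaching a bud and a tip -/

theorem attachC_old {H : Finset (Vtx V)} {r g x y : Vtx V}
    (hx : x ≠ .bud s.next ∧ x ≠ .tip s.next) (hy : y ≠ .bud s.next ∧ y ≠ .tip s.next) :
    s.attachC H r g x y = s.C x y := by
  simp [attachC, hx, hy]

/-- The hypotheses under which a bud and a tip are attached to the union `S` of nodes. -/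
structure AttachHyp (I : ParityInstance K U V) (s : SearchState K V) (S : Finset (Vtx V))
    (r g : Vtx V) : Prop where
  frame : s.Frame I
  fresh : s.next ∉ s.ids
  closed : ∀ x ∈ S, x ∈ s.Vstar I ∧ s.Kset I x ⊆ S
  normal : ¬ s.HasSource I S
  r_mem : r ∈ s.Vstar I
  g_mem : g ∈ S

variable {S : Finset (Vtx V)} {r g : Vtx V}

theorem AttachHyp.ne_new (h : AttachHyp I s S r g) {x : Vtx V} (hx : x ∈ s.Vstar I) :
    x ≠ .bud s.next ∧ x ≠ .tip s.next := by
  constructor <;> rintro rfl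
  · exact h.fresh (bud_mem_Vstar.1 hx).1
  · exact h.fresh (tip_mem_Vstar.1 hx).1

theorem AttachBud.mem_Bs (h : AttachHyp I s S r g) (ha : AttachBud I s S r g s') {x : Vtx V} :
    x ∈ s'.Bs ↔ x ∈ s.Bs ∨ x = (if r ∈ s.Bs then .tip s.next else .bud s.next) := by
  obtain ⟨-, C', l₁, l₂, -, -, rfl⟩ := ha
  have hb : Vtx.bud s.next ∉ s.Bs := fun hb => (h.ne_new (h.frame.Bs_subset hb)).1 rfl
  have ht : Vtx.tip s.next ∉ s.Bs := fun hb => (h.ne_new (h.frame.Bs_subset hb)).2 rfl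
  show x ∈ symmDiff (s.attachBs r) _ ↔ _
  rw [attachBs, Finset.mem_symmDiff]
  by_cases e1 : x = .bud s.next
  · subst e1; split_ifs <;> simp [hb]
  · by_cases e2 : x = .tip s.next
    · subst e2; split_ifs <;> simp [ht]
    · split_ifs <;> simp [e1, e2]

theorem AttachBud.addNode (h : AttachHyp I s S r g) (ha : AttachBud I s S r g s') :
    AddNode I s.toConfig s'.toConfig s.next S := by
  have hBs := fun x => ha.mem_Bs h (x := x)
  have hb : Vtx.bud s.next ∉ s.Bs := fun hb => (h.ne_new (h.frame.Bs_subset hb)).1 rfl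
  have ht : Vtx.tip s.next ∉ s.Bs := fun hb => (h.ne_new (h.frame.Bs_subset hb)).2 rfl
  refine ⟨h.fresh, ?_, ?_, ?_, fun x hx => ?_, fun x hx => ?_, fun _ => ?_, h.closed,
    fun x hx y _ sx _ => absurd ⟨x, hx, sx⟩ h.normal, fun hs => absurd hs h.normal⟩
  · obtain ⟨-, C', l₁, l₂, -, -, rfl⟩ := ha; rfl
  · obtain ⟨-, C', l₁, l₂, -, -, rfl⟩ := ha
    rw [if_neg h.normal]; rfl
  · ext v
    simp only [base, Finset.mem_filter, Finset.mem_univ, true_and, hBs]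
    split_ifs <;> simp
  · rw [hBs]
    have := h.ne_new hx
    split_ifs <;> simp [this]
  · rcases (hBs x).1 hx with hx | hx
    · exact Or.inl (h.frame.Bs_subset hx)
    · refine Or.inr ⟨h.normal, ?_⟩
      split_ifs at hx <;> simp [hx]
  · rw [hBs, hBs]
    split_ifs <;> simp [hb, ht]

theorem AttachBud.Vstar_eq (h : AttachHyp I s S r g) (ha : AttachBud I s S r g s') :
    s'.Vstar I = s.Vstar I ∪ {.bud s.next, .tip s.next} := by
  ext x
  rw [(ha.addNode h).mem_Vstar]
  simp [h.normal]
  tauto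

theorem AttachBud.represents (h : AttachHyp I s S r g) (ha : AttachBud I s S r g s')
    (hr : Represents I (s.Vstar I) s.Bs s.C) : Represents I (s'.Vstar I) s'.Bs s'.C := by
  rw [ha.Vstar_eq h]
  obtain ⟨-, C', l₁, l₂, hp, -, rfl⟩ := ha
  have hb : Vtx.bud s.next ∉ s.Vstar I := fun hb => (h.ne_new hb).1 rfl
  have ht : Vtx.tip s.next ∉ s.Vstar I := fun hb => (h.ne_new hb).2 rfl
  have hC : ∀ u ∈ s.Vstar I, ∀ v ∈ s.Vstar I, s.attachC S r g u v = s.C u v :=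
    fun u hu v hv => attachC_old (h.ne_new hu) (h.ne_new hv)
  show Represents I _ (symmDiff (s.attachBs r) _) C'
  unfold attachBs at hp ⊢
  split_ifs at hp ⊢ with hrB
  · exact hr.attach h.frame.Bs_subset hb ht (by simp) (by simp) hC hp
  · rw [Finset.pair_comm] at hp ⊢
    exact hr.attach h.frame.Bs_subset ht hb (by simp) (by simp) hC hp

/-- An edge at an old vertex after the attachment stems from an edge of the old matrix, or from one
of the extended matrix at the new bud or tip. -/
theorem AttachBud.adj_cases (h : AttachHyp I s S r g) (ha : AttachBud I s S r g s') {x y : Vtx V}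
    (hx : x ∈ s.Vstar I) (hxy : s'.Adj I x y) :
    (y ∈ s.Vstar I ∧ s.Adj I x y) ∨
      MatAdj (s.Vstar I ∪ {.bud s.next, .tip s.next}) (s.attachBs r) (s.attachC S r g) x
        (.bud s.next) ∨
      MatAdj (s.Vstar I ∪ {.bud s.next, .tip s.next}) (s.attachBs r) (s.attachC S r g) x
        (.tip s.next) := by
  have hW := ha.Vstar_eq h
  rw [adj_iff, hW] at hxy
  obtain ⟨hrg, C', l₁, l₂, hp, -, rfl⟩ := ha
  change MatAdj _ (symmDiff (s.attachBs r) _) C' x y at hxy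
  have nx := h.ne_new hx
  have hb : Vtx.bud s.next ∉ s.Vstar I := fun hb => (h.ne_new hb).1 rfl
  have ht : Vtx.tip s.next ∉ s.Vstar I := fun hb => (h.ne_new hb).2 rfl
  have hb' : Vtx.bud s.next ∉ s.Bs := fun h' => hb (h.frame.Bs_subset h')
  have ht' : Vtx.tip s.next ∉ s.Bs := fun h' => ht (h.frame.Bs_subset h')
  have old : ∀ z, z ∈ s.Vstar I →
      MatAdj (s.Vstar I ∪ {.bud s.next, .tip s.next}) (s.attachBs r) (s.attachC S r g) x z →
      s.Adj I x z := by
    intro z hz hxz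
    have nz := h.ne_new hz
    rw [adj_iff]
    have hB : ∀ w, w ∈ s.Vstar I → (w ∈ s.attachBs r ↔ w ∈ s.Bs) := by
      intro w hw
      have := h.ne_new hw
      unfold attachBs; split_ifs <;> simp [this]
    unfold MatAdj at hxz ⊢
    rw [attachC_old nx nz, attachC_old nz nx, hB x hx, hB z hz] at hxz
    simp only [Finset.mem_sdiff, hB x hx, hB z hz, hx, hz, true_and] at hxz ⊢
    tauto
  have fin : ∀ z, MatAdj (s.Vstar I ∪ {.bud s.next, .tip s.next}) (s.attachBs r)
      (s.attachC S r g) x z → (z ∈ s.Vstar I ∧ s.Adj I x z) ∨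
        z = .bud s.next ∨ z = .tip s.next := by
    intro z hz
    by_cases e : z = .bud s.next ∨ z = .tip s.next
    · exact Or.inr e
    · rw [not_or] at e
      have : z ∈ s.Vstar I := by
        have hzW : z ∈ s.Vstar I ∪ {.bud s.next, .tip s.next} := by
          rcases hz with hz | hz
          · exact (Finset.mem_sdiff.1 hz.2.1).1
          · have := hz.1
            unfold attachBs at this
            have hB := @h.frame.Bs_subset z
            simp only [Finset.mem_insert] at this
            rcases this with this | this
            · split_ifs at this <;> simp [this]
            · exact Finset.mem_union_left _ (hB this)
        simpa [e.1, e.2] using hzW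
      exact Or.inl ⟨this, old z this hz⟩
  have fin' : ∀ k j, k ∈ s.attachBs r →
      j ∈ (s.Vstar I ∪ {.bud s.next, .tip s.next}) \ s.attachBs r →
      ({k, j} : Finset (Vtx V)) = {.bud s.next, .tip s.next} → x ≠ k ∧ x ≠ j →
      MatAdj (s.Vstar I ∪ {.bud s.next, .tip s.next}) (s.attachBs r) (s.attachC S r g) x y ∨
      MatAdj (s.Vstar I ∪ {.bud s.next, .tip s.next}) (s.attachBs r) (s.attachC S r g) x j ∨
      MatAdj (s.Vstar I ∪ {.bud s.next, .tip s.next}) (s.attachBs r) (s.attachC S r g) x k := by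
    intro k j hk hj e hxkj
    rw [← e] at hp hxy hj ⊢
    exact (hp.adj hk hj hxkj hxy).imp_right (Or.imp And.left And.left)
  have key : MatAdj (s.Vstar I ∪ {.bud s.next, .tip s.next}) (s.attachBs r)
      (s.attachC S r g) x y ∨
      MatAdj (s.Vstar I ∪ {.bud s.next, .tip s.next}) (s.attachBs r) (s.attachC S r g) x
        (.bud s.next) ∨
      MatAdj (s.Vstar I ∪ {.bud s.next, .tip s.next}) (s.attachBs r) (s.attachC S r g) x
        (.tip s.next) := by
    by_cases hrB : r ∈ s.Bs
    · rw [or_comm (a := MatAdj _ _ _ x (.bud s.next))]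
      exact fin' _ _ (by simp [attachBs, hrB]) (by simp [attachBs, hrB, ht']) rfl nx
    · exact fin' _ _ (by simp [attachBs, hrB]) (by simp [attachBs, hrB, hb'])
        (Finset.pair_comm _ _) nx.symm
  rcases key with h' | h'
  · rcases fin y h' with h'' | rfl | rfl
    · exact Or.inl h''
    · exact Or.inr (Or.inl h')
    · exact Or.inr (Or.inr h')
  · exact Or.inr h'

/-- Attaching a bud and a tip to `S` gives new edges outside of `S` only to vertices that are
adjacent to `g`. -/
theorem AttachBud.adj (h : AttachHyp I s S r g) (ha : AttachBud I s S r g s') {x y : Vtx V}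
    (hx : x ∈ s.Vstar I) (hxS : x ∉ S) (hxy : s'.Adj I x y) :
    (y ∈ s.Vstar I ∧ s.Adj I x y) ∨ s.Adj I x g := by
  have nx := h.ne_new hx
  have hg : g ∈ s.Vstar I := (h.closed g h.g_mem).1
  have hb' : Vtx.bud s.next ∉ s.Bs := fun h' => (h.ne_new (h.frame.Bs_subset h')).1 rfl
  have ht' : Vtx.tip s.next ∉ s.Bs := fun h' => (h.ne_new (h.frame.Bs_subset h')).2 rfl
  have hne : Vtx.bud (V := V) s.next ≠ .tip s.next := by simp
  have hrg := ha.1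
  rcases ha.adj_cases h hx hxy with h' | h' | h'
  · exact Or.inl h'
  · exfalso
    revert h'
    unfold MatAdj attachC attachBs
    by_cases hrB : r ∈ s.Bs
    · simp [hrB, nx, hxS, hne]
    · simp [hrB, nx, hxS, hne, hb']
  · right
    rw [adj_iff]
    revert h'
    unfold MatAdj attachC attachBs
    by_cases hrB : r ∈ s.Bs
    · have hgB : g ∉ s.Bs := by tauto
      simp [hrB, nx, hxS, hne.symm, hgB, hg, ht', hx]
    · have hgB : g ∈ s.Bs := by tauto
      simp [hrB, nx, hxS, hne.symm, hgB, hg, ht', hx]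

/-- Attaching a bud and a tip to `S` gives new edges at vertices of `S` only to those that are
adjacent to `r`. -/
theorem AttachBud.adj_mem (h : AttachHyp I s S r g) (ha : AttachBud I s S r g s') {x y : Vtx V}
    (hx : x ∈ S) (hxy : s'.Adj I x y) : (y ∈ s.Vstar I ∧ s.Adj I x y) ∨ s.Adj I x r := by
  have hxV := (h.closed x hx).1
  have nx := h.ne_new hxV
  have hb' : Vtx.bud s.next ∉ s.Bs := fun h' => (h.ne_new (h.frame.Bs_subset h')).1 rfl
  have ht' : Vtx.tip s.next ∉ s.Bs := fun h' => (h.ne_new (h.frame.Bs_subset h')).2 rfl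
  have hne : Vtx.bud (V := V) s.next ≠ .tip s.next := by simp
  have hr := h.r_mem
  rcases ha.adj_cases h hxV hxy with h' | h' | h'
  · exact Or.inl h'
  · right
    rw [adj_iff]
    revert h'
    unfold MatAdj attachC attachBs
    by_cases hrB : r ∈ s.Bs
    · simp [hrB, nx, hx, hne, hxV]
    · simp [hrB, nx, hx, hne, hr, hb']
  · exfalso
    revert h'
    unfold MatAdj attachC attachBs
    by_cases hrB : r ∈ s.Bs
    · simp [hrB, nx, hx, hne.symm, ht']
    · simp [hrB, nx, hx, hne.symm]

theorem AttachBud.exits (h : AttachHyp I s S r g) (ha : AttachBud I s S r g s')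
    {F : Finset (Vtx V)} (hF : F ⊆ s.Vstar I) (hd : Disjoint F S) {x : Vtx V} (hx : x ∈ F)
    (he : s'.Exits I F x) : s.Exits I F x := by
  obtain ⟨y, -, hyF, hxy⟩ := he
  rcases ha.adj h (hF hx) (Finset.disjoint_left.1 hd hx) hxy with h' | h'
  · exact ⟨y, h'.1, hyF, h'.2⟩
  · exact ⟨g, (h.closed g h.g_mem).1, fun hg => Finset.disjoint_left.1 hd hg h.g_mem, h'⟩

/-- After a bud and a tip have been attached to `S`, the vertex `g` has no neighbor outside. -/
theorem AttachBud.adj_g (h : AttachHyp I s S r g) (ha : AttachBud I s S r g s') {y : Vtx V}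
    (hy : s'.Adj I g y) : y ∈ S ∨ y = .tip s.next := by
  have hW := ha.Vstar_eq h
  rw [adj_iff, hW] at hy
  obtain ⟨hrg, C', l₁, l₂, hp, -, rfl⟩ := ha
  change MatAdj _ (symmDiff (s.attachBs r) _) C' g y at hy
  by_contra hcon
  push Not at hcon
  obtain ⟨hyS, hyt⟩ := hcon
  have hg : g ∈ s.Vstar I := (h.closed g h.g_mem).1
  have ng := h.ne_new hg
  have nr := h.ne_new h.r_mem
  have hb : Vtx.bud s.next ∉ s.Vstar I := fun hb => (h.ne_new hb).1 rfl
  have ht : Vtx.tip s.next ∉ s.Vstar I := fun hb => (h.ne_new hb).2 rfl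
  have hb' : Vtx.bud s.next ∉ s.Bs := fun h' => hb (h.frame.Bs_subset h')
  have ht' : Vtx.tip s.next ∉ s.Bs := fun h' => ht (h.frame.Bs_subset h')
  have hne : Vtx.bud (V := V) s.next ≠ .tip s.next := by simp
  have hS : Vtx.bud s.next ∉ S := fun h' => hb (h.closed _ h').1
  by_cases hrB : r ∈ s.Bs
  · have hgB : g ∉ s.Bs := by tauto
    have hk : Vtx.bud s.next ∈ s.attachBs r := by simp [attachBs, hrB]
    have hj : Vtx.tip s.next ∉ s.attachBs r := by simp [attachBs, hrB, ht']
    obtain ⟨e1, e2⟩ := inter_sdiff_pair hk hj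
    have li := hp.left_inv
    have lr := hp.lower_right
    rw [e1, e2] at lr li
    simp only [Finset.mem_singleton, Finset.sum_singleton, forall_eq, if_true] at lr li
    have hgB1 : g ∉ symmDiff (s.attachBs r) {.bud s.next, .tip s.next} := by
      simp [Finset.mem_symmDiff, attachBs, hrB, ng, hgB]
    rcases hy with hy | ⟨h1, -, h3⟩
    · exact hgB1 hy.1
    · have hyb : y ≠ .bud s.next := by
        rintro rfl
        simp [Finset.mem_symmDiff, attachBs, hrB] at h1
      have hyB : y ∈ s.Bs := by
        simpa [Finset.mem_symmDiff, attachBs, hrB, hyb, hyt] using h1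
      rw [lr y (by simp [attachBs, hyB, hyb, hyt])
        g (by simp [attachBs, hrB, hg, ng, hgB])] at h3
      apply h3
      simp only [attachC, hrB, if_true, hyb, if_false, ng, hyS, h.g_mem] at li ⊢
      linear_combination (- s.C y g) * li
  · have hgB : g ∈ s.Bs := by tauto
    have hk : Vtx.tip s.next ∈ s.attachBs r := by simp [attachBs, hrB]
    have hj : Vtx.bud s.next ∉ s.attachBs r := by simp [attachBs, hrB, hb']
    obtain ⟨e1, e2⟩ := inter_sdiff_pair hk hj
    rw [Finset.pair_comm] at e1 e2
    have li := hp.left_inv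
    have lr := hp.lower_right
    rw [e1, e2] at lr li
    simp only [Finset.mem_singleton, Finset.sum_singleton, forall_eq, if_true] at lr li
    have hgB1 : g ∈ symmDiff (s.attachBs r) {.bud s.next, .tip s.next} := by
      simp [Finset.mem_symmDiff, attachBs, hrB, ng, hgB]
    rcases hy with ⟨-, h2, h3⟩ | hy
    · have hyb : y ≠ .bud s.next := by
        rintro rfl
        simp [Finset.mem_symmDiff, attachBs, hrB, hb'] at h2
      have hyB : y ∉ s.Bs ∧ y ∈ s.Vstar I := by
        simpa [Finset.mem_symmDiff, attachBs, hrB, hyb, hyt, and_comm] using h2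
      rw [lr g (by simp [attachBs, hgB, ng])
        y (by simp [attachBs, hrB, hyB, hyb, hyt])] at h3
      apply h3
      simp only [attachC, hrB, if_true, hyb, if_false, ng, hyS, h.g_mem] at li ⊢
      linear_combination (- s.C g y) * li
    · exact (Finset.mem_sdiff.1 hy.2.1).2 hgB1

end SearchState

namespace SearchState

open Config

variable {I : ParityInstance K U V} {s s' : SearchState K V} {B₀ : Finset V}

/-! ### The invariants of the search -/

/-- The labeled vertices form a search forest, whose roots are the nodes with a source line. -/
def PathInv (I : ParityInstance K U V) (s : SearchState K V) : Prop :=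
  ∃ par rk, PathSys (· ∈ s.Vstar I) (s.Kset I) (s.Root I) (· ∈ s.labeled) s.P par rk

/-- The invariants of the search. They express that a maximal blossom is either untouched, or
labeled `⊖` and entered through its bud only, or labeled `⊕` and completely explored, and that a
single line is either untouched or explored in one direction.

Here `B₀` is the base, which the search does not change. -/
structure Invariant (I : ParityInstance K U V) (B₀ : Finset V) (s : SearchState K V) : Prop where
  frame : s.Frame I
  lt_next : ∀ i ∈ s.ids, i < s.next
  base_eq : s.base = B₀
  represents : Represents I (s.Vstar I) s.Bs s.C
  queue : ∀ x ∈ s.queue, x ∈ s.labeled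
  sign_mono : ∀ i ∈ s.ids, ∀ j ∈ s.ids, s.H i ⊂ s.H j → s.sign i ≠ none → s.sign j ≠ none
  plus : ∀ i, s.IsMax i → s.IsNormal I i → s.sign i = some .plus →
    s.rho (.bud i) ≠ none ∧ .tip i ∈ s.labeled ∧ ∀ x ∈ s.Hbul I i, x ∈ s.labeled
  minus : ∀ i, s.IsMax i → s.sign i = some .minus →
    s.IsNormal I i ∧ .bud i ∈ s.labeled ∧ (∀ x ∈ s.Hbul I i, x ∈ s.labeled ∨ s.rho x ≠ none) ∧
      (∀ x ∈ s.labeled, x ∈ s.cell I i → x = .bud i) ∧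
      ∃ l, s.P (.bud i) = l ++ [.tip i, .bud i]
  route : ∀ i, s.IsMax i → s.sign i ≠ some .plus → ∀ x ∈ s.Hbul I i,
    (s.R i x).Nodup ∧ (∀ y ∈ s.R i x, y ∈ s.H i) ∧ (s.R i x).getLast? = some x ∧
      (s.IsNormal I i → (s.R i x).head? = some (.tip i))
  tip_closed : ∀ i, s.IsMax i → s.IsNormal I i → s.sign i ≠ some .plus →
    ¬ s.Exits I (s.cell I i) (.tip i)
  touched : ∀ x ∈ s.labeled, ∀ y ∈ s.P x, (∀ i, s.IsMax i → y ∈ s.cell I i → s.sign i ≠ none) ∧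
    (s.Single I y → y ∈ s.labeled ∨ I.bar y ∈ s.labeled)
  single_rho : ∀ x ∈ s.Vstar I, s.Single I x → s.rho x ≠ none → I.bar x ∈ s.labeled
  single_labeled : ∀ x ∈ s.labeled, s.Single I x → ¬ s.IsSource I x → s.rho (I.bar x) ≠ none
  bud_rho : ∀ i, s.IsMax i → s.IsNormal I i → s.rho (.bud i) ≠ none → s.sign i ≠ none
  paths : PathInv I s

/-- All source vertices in no blossom are labeled. -/
def SourcesLabeled (I : ParityInstance K U V) (s : SearchState K V) : Prop :=
  ∀ x, s.IsSource I x → s.Single I x → x ∈ s.labeled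

/-- All maximal source blossoms are labeled. -/
def SourceBlossomsLabeled (I : ParityInstance K U V) (s : SearchState K V) : Prop :=
  ∀ i, s.IsMax i → ¬ s.IsNormal I i → s.sign i ≠ none

theorem PathInv.labeled_mem (h : PathInv I s) {x : Vtx V} (hx : x ∈ s.labeled) :
    x ∈ s.Vstar I := by
  obtain ⟨par, rk, h⟩ := h; exact h.self_W hx

theorem PathInv.path_mem (h : PathInv I s) {x y : Vtx V} (hx : x ∈ s.labeled) (hy : y ∈ s.P x) :
    y ∈ s.Vstar I := by
  obtain ⟨par, rk, h⟩ := h; exact h.mem_W x hx y hy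

theorem PathInv.self_mem (h : PathInv I s) {x : Vtx V} (hx : x ∈ s.labeled) : x ∈ s.P x := by
  obtain ⟨par, rk, h⟩ := h; exact h.self_mem hx

/-- Nodes of `s` are merged into a new maximal blossom `n` labeled `⊕`, while nothing changes at
the other nodes. -/
structure Merge (I : ParityInstance K U V) (s s' : SearchState K V) (n : ℕ) : Prop where
  frame : s'.Frame I
  lt_next : ∀ i ∈ s'.ids, i < s'.next
  base_eq : s'.base = s.base
  represents : Represents I (s'.Vstar I) s'.Bs s'.C
  queue : ∀ x ∈ s'.queue, x ∈ s'.labeled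
  max_new : s'.IsMax n
  sign_new : s'.sign n = some .plus
  normal_new : s'.IsNormal I n →
    s'.rho (.bud n) ≠ none ∧ .tip n ∈ s'.labeled ∧ ∀ x ∈ s'.Hbul I n, x ∈ s'.labeled
  ids_old : ∀ i ∈ s'.ids, i ≠ n → i ∈ s.ids ∧ s'.H i = s.H i ∧ s'.sign i = s.sign i
  max_old : ∀ i, s'.IsMax i → i ≠ n → s.IsMax i ∧ s'.cell I i = s.cell I i ∧
    (s'.IsNormal I i ↔ s.IsNormal I i) ∧ s'.R i = s.R i
  exits_old : ∀ i, s'.IsMax i → i ≠ n → ∀ F : Finset (Vtx V), F ⊆ s.cell I i → ∀ x ∈ F,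
    s'.Exits I F x → s.Exits I F x
  vtx_old : ∀ x ∈ s'.Vstar I, x ∉ s'.cell I n → x ∈ s.Vstar I ∧ (s'.Single I x → s.Single I x) ∧
    (x ∈ s'.labeled → x ∈ s.labeled) ∧ s'.rho x = s.rho x
  labeled_mono : ∀ x ∈ s.labeled, x ∈ s'.labeled
  touched : ∀ x ∈ s'.labeled, ∀ y ∈ s'.P x, y ∈ s'.cell I n ∨ ∃ x₀ ∈ s.labeled, y ∈ s.P x₀
  path_minus : ∀ i, s'.IsMax i → i ≠ n → s.sign i = some .minus →
    ∃ l, s'.P (.bud i) = l ++ [.tip i, .bud i]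
  paths : PathInv I s'

/-- The invariants persist when nodes are merged, since the new blossom is completely explored and
nothing changes elsewhere. -/
theorem Merge.invariant {n : ℕ} (m : Merge I s s' n) (h : Invariant I B₀ s) :
    Invariant I B₀ s' := by
  have hdisj : ∀ i, s'.IsMax i → i ≠ n → ∀ x ∈ s.cell I i, x ∉ s'.cell I n := by
    intro i hi hin x hx hxn
    obtain ⟨-, hc, -⟩ := m.max_old i hi hin
    exact hin (m.frame.eq_of_mem_cell hi m.max_new (hc ▸ hx) hxn)
  have hmem : ∀ i, s'.IsMax i → i ≠ n → ∀ x ∈ s.cell I i, x ∈ s'.Vstar I := by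
    intro i hi hin x hx
    obtain ⟨-, hc, -⟩ := m.max_old i hi hin
    exact m.frame.cell_subset hi.1 (hc ▸ hx)
  have hbul : ∀ i, s'.IsMax i → i ≠ n → ∀ x ∈ s'.Hbul I i, x ∈ s.Hbul I i := by
    intro i hi hin x hx
    obtain ⟨-, hH, -⟩ := m.ids_old i hi.1 hin
    rw [mem_Hbul, hH] at hx
    rw [mem_Hbul]
    refine ⟨hx.1, hx.2.imp_right fun hx' => ⟨hx'.1, ?_⟩⟩
    exact m.exits_old i hi hin _ H_subset_cell x hx.1 hx'.2
  have hsg : ∀ x, s'.Single I x → x ∉ s'.cell I n := fun x hx => hx n m.max_new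
  refine ⟨m.frame, m.lt_next, m.base_eq.trans h.base_eq, m.represents, m.queue, ?_, ?_, ?_, ?_, ?_,
    ?_, ?_, ?_, ?_, m.paths⟩
  · intro i hi j hj hij hs
    by_cases hjn : j = n
    · subst hjn; simp [m.sign_new]
    · by_cases hin : i = n
      · subst hin; exact absurd hij (m.max_new.2 j hj)
      · obtain ⟨a1, a2, a3⟩ := m.ids_old i hi hin
        obtain ⟨b1, b2, b3⟩ := m.ids_old j hj hjn
        rw [a2, b2] at hij
        rw [a3] at hs
        rw [b3]
        exact h.sign_mono i a1 j b1 hij hs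
  · intro i hi hn hs
    by_cases hin : i = n
    · subst hin; exact m.normal_new hn
    · obtain ⟨a1, a2, a3⟩ := m.ids_old i hi.1 hin
      obtain ⟨b1, b2, b3, b4⟩ := m.max_old i hi hin
      obtain ⟨c1, c2, c3⟩ := h.plus i b1 (b3.1 hn) (a3 ▸ hs)
      have hb := Frame.bud_mem_cell (b3.1 hn)
      refine ⟨?_, m.labeled_mono _ c2, fun x hx => m.labeled_mono _ (c3 x (hbul i hi hin x hx))⟩
      rwa [(m.vtx_old _ (hmem i hi hin _ hb) (hdisj i hi hin _ hb)).2.2.2]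
  · intro i hi hs
    have hin : i ≠ n := by rintro rfl; rw [m.sign_new] at hs; cases hs
    obtain ⟨a1, a2, a3⟩ := m.ids_old i hi.1 hin
    obtain ⟨b1, b2, b3, b4⟩ := m.max_old i hi hin
    rw [a3] at hs
    obtain ⟨c1, c2, c3, c4, c5⟩ := h.minus i b1 hs
    refine ⟨b3.2 c1, m.labeled_mono _ c2, fun x hx => ?_, fun x hx hxc => ?_,
      m.path_minus i hi hin hs⟩
    · have hx' := hbul i hi hin x hx
      have hxc := H_subset_cell (I := I) (Hbul_subset hx')
      refine (c3 x hx').imp (m.labeled_mono x) ?_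
      rw [(m.vtx_old x (hmem i hi hin x hxc) (hdisj i hi hin x hxc)).2.2.2]
      exact id
    · rw [b2] at hxc
      exact c4 x ((m.vtx_old x (hmem i hi hin x hxc) (hdisj i hi hin x hxc)).2.2.1 hx) hxc
  · intro i hi hs x hx
    have hin : i ≠ n := by rintro rfl; exact hs m.sign_new
    obtain ⟨a1, a2, a3⟩ := m.ids_old i hi.1 hin
    obtain ⟨b1, b2, b3, b4⟩ := m.max_old i hi hin
    rw [b4, a2, b3]
    exact h.route i b1 (a3 ▸ hs) x (hbul i hi hin x hx)
  · intro i hi hn hs he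
    have hin : i ≠ n := by rintro rfl; exact hs m.sign_new
    obtain ⟨a1, a2, a3⟩ := m.ids_old i hi.1 hin
    obtain ⟨b1, b2, b3, b4⟩ := m.max_old i hi hin
    rw [b2] at he
    exact h.tip_closed i b1 (b3.1 hn) (a3 ▸ hs) (m.exits_old i hi hin _ subset_rfl _
      (H_subset_cell (h.frame.tip_self (b3.1 hn))) he)
  · intro x hx y hy
    by_cases hyn : y ∈ s'.cell I n
    · refine ⟨fun i hi hyi => ?_, fun hsy => absurd hyn (hsg y hsy)⟩
      rw [m.frame.eq_of_mem_cell hi m.max_new hyi hyn, m.sign_new]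
      simp
    · obtain ⟨x₀, hx₀, hy₀⟩ := (m.touched x hx y hy).resolve_left hyn
      obtain ⟨t1, t2⟩ := h.touched x₀ hx₀ y hy₀
      refine ⟨fun i hi hyi => ?_, fun hsy => ?_⟩
      · have hin : i ≠ n := by rintro rfl; exact hyn hyi
        obtain ⟨a1, a2, a3⟩ := m.ids_old i hi.1 hin
        obtain ⟨b1, b2, b3, b4⟩ := m.max_old i hi hin
        rw [a3]
        exact t1 i b1 (b2 ▸ hyi)
      · have hyV : y ∈ s'.Vstar I := m.paths.path_mem hx hy
        exact (t2 ((m.vtx_old y hyV hyn).2.1 hsy)).imp (m.labeled_mono _) (m.labeled_mono _)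
  · intro x hx hsx hr
    obtain ⟨v1, v2, v3, v4⟩ := m.vtx_old x hx (hsg x hsx)
    rw [v4] at hr
    exact m.labeled_mono _ (h.single_rho x v1 (v2 hsx) hr)
  · intro x hx hsx hns
    have hxV := m.paths.labeled_mem hx
    obtain ⟨v1, v2, v3, v4⟩ := m.vtx_old x hxV (hsg x hsx)
    rw [isSource_congr m.base_eq] at hns
    obtain ⟨w1, w2, w3, w4⟩ := m.vtx_old (I.bar x) (bar_mem_Vstar.2 hxV)
      (hsg _ (m.frame.single_bar hxV hsx))
    rw [w4]
    exact h.single_labeled x (v3 hx) (v2 hsx) hns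
  · intro i hi hn hr
    by_cases hin : i = n
    · subst hin; simp [m.sign_new]
    · obtain ⟨a1, a2, a3⟩ := m.ids_old i hi.1 hin
      obtain ⟨b1, b2, b3, b4⟩ := m.max_old i hi hin
      have hb := Frame.bud_mem_cell (b3.1 hn)
      rw [(m.vtx_old _ (hmem i hi hin _ hb) (hdisj i hi hin _ hb)).2.2.2] at hr
      rw [a3]
      exact h.bud_rho i b1 (b3.1 hn) hr

theorem Merge.sourcesLabeled {n : ℕ} (m : Merge I s s' n) (h : SourcesLabeled I s) :
    SourcesLabeled I s' := by
  intro x hx hsx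
  obtain ⟨v1, v2, v3, v4⟩ := m.vtx_old x hx.mem_Vstar (hsx n m.max_new)
  exact m.labeled_mono x (h x ((isSource_congr m.base_eq).1 hx) (v2 hsx))

theorem Merge.sourceBlossomsLabeled {n : ℕ} (m : Merge I s s' n)
    (h : SourceBlossomsLabeled I s) : SourceBlossomsLabeled I s' := by
  intro i hi hn
  by_cases hin : i = n
  · subst hin; simp [m.sign_new]
  · obtain ⟨a1, a2, a3⟩ := m.ids_old i hi.1 hin
    obtain ⟨b1, b2, b3, b4⟩ := m.max_old i hi hin
    rw [a3]
    exact h i b1 (fun hn' => hn (b3.2 hn'))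

end SearchState

namespace SearchState

open Config

variable {I : ParityInstance K U V} {s s' : SearchState K V} {B₀ : Finset V}

/-! ### Exploring a node -/

theorem _root_.MatroidParity.Config.RoutingOK.last {c : Config K V} {i : ℕ} {x : Vtx V}
    (h : c.RoutingOK I i x) : (c.R i x).getLast? = some x := by
  rcases h.ends with e | ⟨l, e⟩ <;> rw [e] <;> simp

theorem IsStart.invariant {c : Config K V} (hc : c.Admissible I) (h : IsStart c s) :
    Invariant I c.base s := by
  obtain ⟨rfl, h1, h2, h3, h4, h5⟩ := h
  have hf := hc.wellFormed.frame
  refine ⟨hf, h1, rfl, hc.bt1.represents, by simp [h3], by simp [h5], by simp [h5], by simp [h5],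
    ?_, ?_, by simp [h2], by simp [h4], by simp [h2], by simp [h4], ?_⟩
  · intro i hi _ x hx
    have hr := hc.routing i hi.1 x hx
    exact ⟨hr.nodup, hr.br1_subset, hr.last, fun hn => (hr.br2_normal hn).1⟩
  · intro i _ hn _
    exact hc.bt2.tip_closed hf hn
  · refine ⟨fun _ => .bud 0, fun _ => 0, ?_⟩
    constructor <;> simp [h2, Root]
    intro x y hx hy e
    rw [e]
    exact id

/-- If only labels of a single node `N` change, and the blossom family does not, then the invariants
have to be checked at `N` only. -/
theorem Invariant.explore (h : Invariant I B₀ s) (N : Finset (Vtx V)) (xs : List (Vtx V))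
    (hcfg : s'.toConfig = s.toConfig) (hnext : s'.next = s.next)
    (hlab : s'.labeled = s.labeled ++ xs) (hq : s'.queue = s.queue ++ xs)
    (hxs : ∀ x ∈ xs, x ∈ N)
    (hN : ∀ j, s.IsMax j → s.cell I j = N ∨ Disjoint (s.cell I j) N)
    (hNbar : ∀ x ∈ N, s.Single I x → I.bar x ∈ N)
    (hP : ∀ x, x ∉ xs → s'.P x = s.P x) (hrho : ∀ x, x ∉ N → s'.rho x = s.rho x)
    (hsign : ∀ j, s'.sign j = s.sign j ∨ (s.IsMax j ∧ s.cell I j = N))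
    (hsp : ∀ j, s.sign j = some .plus → s'.sign j = some .plus)
    (hplus : ∀ i, s.IsMax i → s.cell I i = N → s.IsNormal I i → s'.sign i ≠ some .plus)
    (hminus : ∀ i, s.IsMax i → s.cell I i = N → s'.sign i = some .minus →
      s.IsNormal I i ∧ .bud i ∈ s'.labeled ∧ (∀ x ∈ s.Hbul I i, x ∈ s'.labeled ∨ s'.rho x ≠ none) ∧
      (∀ x ∈ s'.labeled, x ∈ s.cell I i → x = .bud i) ∧
      ∃ l, s'.P (.bud i) = l ++ [.tip i, .bud i])
    (hnone : ∀ i, s.IsMax i → s.cell I i = N → s'.sign i ≠ none)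
    (htouched : ∀ x ∈ xs, ∀ y ∈ s'.P x, y ∈ N ∨ ∃ x₀ ∈ s.labeled, y ∈ s.P x₀)
    (hsingle : ∀ y ∈ N, s.Single I y → y ∈ s'.labeled ∨ I.bar y ∈ s'.labeled)
    (hsr : ∀ x ∈ N, s.Single I x → s'.rho x ≠ none → I.bar x ∈ s'.labeled)
    (hsl : ∀ x ∈ N, x ∈ s'.labeled → s.Single I x → ¬ s.IsSource I x → s'.rho (I.bar x) ≠ none)
    (hpaths : PathInv I s') : Invariant I B₀ s' := by
  have hmono : ∀ x ∈ s.labeled, x ∈ s'.labeled := fun x hx => by rw [hlab]; simp [hx]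
  have hlab' : ∀ x ∈ s'.labeled, x ∉ N → x ∈ s.labeled := fun x hx hn => by
    rw [hlab, List.mem_append] at hx
    exact hx.resolve_right fun hx => hn (hxs x hx)
  have hs' : ∀ j, s.IsMax j → s.cell I j ≠ N → s'.sign j = s.sign j := fun j _ hne =>
    (hsign j).resolve_right fun h' => hne h'.2
  have hd : ∀ j, s.IsMax j → s.cell I j ≠ N → ∀ x ∈ s.cell I j, x ∉ N := fun j hj hne x hx =>
    Finset.disjoint_left.1 ((hN j hj).resolve_left hne) hx
  have hpl : ∀ j, s'.sign j ≠ some .plus → s.sign j ≠ some .plus :=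
    fun j hj hj' => hj (hsp j hj')
  refine ⟨by rw [hcfg]; exact h.frame, by rw [hcfg, hnext]; exact h.lt_next,
    by rw [hcfg]; exact h.base_eq, by rw [hcfg]; exact h.represents, ?_, ?_, ?_, ?_, ?_, ?_, ?_, ?_,
    ?_, ?_, hpaths⟩
  all_goals try simp only [hcfg]
  · intro x hx
    rw [hq, List.mem_append] at hx
    rw [hlab, List.mem_append]
    exact hx.imp_left (h.queue x)
  · intro i hi j hj hij hs
    rcases hsign i with e | ⟨hm, -⟩
    · rw [e] at hs
      have := h.sign_mono i hi j hj hij hs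
      rcases hsign j with e | ⟨hm, hc⟩
      · rwa [e]
      · exact hnone j hm hc
    · exact absurd hij (hm.2 j hj)
  · intro i hi hn hs
    by_cases hc : s.cell I i = N
    · exact absurd hs (hplus i hi hc hn)
    · rw [hs' i hi hc] at hs
      obtain ⟨c1, c2, c3⟩ := h.plus i hi hn hs
      refine ⟨?_, hmono _ c2, fun x hx => hmono _ (c3 x hx)⟩
      rwa [hrho _ (hd i hi hc _ (Frame.bud_mem_cell hn))]
  · intro i hi hs
    by_cases hc : s.cell I i = N
    · exact hminus i hi hc hs
    · rw [hs' i hi hc] at hs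
      obtain ⟨c1, c2, c3, c4, c5⟩ := h.minus i hi hs
      have hb := hd i hi hc _ (Frame.bud_mem_cell c1)
      refine ⟨c1, hmono _ c2, fun x hx => ?_, fun x hx hxc => ?_, ?_⟩
      · refine (c3 x hx).imp (hmono x) ?_
        rw [hrho x (hd i hi hc x (H_subset_cell (Hbul_subset hx)))]
        exact id
      · exact c4 x (hlab' x hx (hd i hi hc x hxc)) hxc
      · rwa [hP _ fun hx => hb (hxs _ hx)]
  · intro i hi hs
    exact h.route i hi (hpl i hs)
  · intro i hi hn hs
    exact h.tip_closed i hi hn (hpl i hs)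
  · intro x hx y hy
    have key : y ∈ N ∨ ∃ x₀ ∈ s.labeled, y ∈ s.P x₀ := by
      by_cases hxx : x ∈ xs
      · exact htouched x hxx y hy
      · rw [hP x hxx] at hy
        rw [hlab, List.mem_append] at hx
        exact Or.inr ⟨x, hx.resolve_right hxx, hy⟩
    refine ⟨fun i hi hyi => ?_, fun hsy => ?_⟩
    · by_cases hc : s.cell I i = N
      · exact hnone i hi hc
      · obtain ⟨x₀, hx₀, hy₀⟩ := key.resolve_left (hd i hi hc y hyi)
        rw [hs' i hi hc]
        exact (h.touched x₀ hx₀ y hy₀).1 i hi hyi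
    · by_cases hyN : y ∈ N
      · exact hsingle y hyN hsy
      · obtain ⟨x₀, hx₀, hy₀⟩ := key.resolve_left hyN
        exact ((h.touched x₀ hx₀ y hy₀).2 hsy).imp (hmono _) (hmono _)
  · intro x hx hsx hr
    by_cases hxN : x ∈ N
    · exact hsr x hxN hsx hr
    · rw [hrho x hxN] at hr
      exact hmono _ (h.single_rho x hx hsx hr)
  · intro x hx hsx hns
    by_cases hxN : x ∈ N
    · exact hsl x hxN hx hsx hns
    · have hx' := hlab' x hx hxN
      have hb : I.bar x ∉ N := fun hb => hxN (by
        have := hNbar _ hb (h.frame.single_bar (h.paths.labeled_mem hx') hsx)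
        rwa [bar_bar] at this)
      rw [hrho _ hb]
      exact h.single_labeled x hx' hsx hns
  · intro i hi hn hr
    by_cases hc : s.cell I i = N
    · exact hnone i hi hc
    · rw [hrho _ (hd i hi hc _ (Frame.bud_mem_cell hn))] at hr
      rw [hs' i hi hc]
      exact h.bud_rho i hi hn hr

theorem cell_eq_or_disjoint_Kset (h : s.Frame I) {x : Vtx V} (hx : x ∈ s.Vstar I) (j : ℕ)
    (hj : s.IsMax j) : s.cell I j = s.Kset I x ∨ Disjoint (s.cell I j) (s.Kset I x) := by
  by_cases hd : Disjoint (s.cell I j) (s.Kset I x)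
  · exact Or.inr hd
  · rw [Finset.not_disjoint_iff] at hd
    obtain ⟨y, hy, hyx⟩ := hd
    rw [← h.Kset_of_cell hj hy, h.Kset_eq_of_mem hx hyx]
    exact Or.inl rfl

theorem cell_ne_of_single (h : s.Frame I) {x : Vtx V} (hs : s.Single I x) {j : ℕ}
    (hj : s.IsMax j) : s.cell I j ≠ s.Kset I x := by
  intro e
  exact hs j hj (e ▸ h.mem_Kset_self x)

theorem bar_mem_Kset (h : s.Frame I) {x y : Vtx V} (hx : x ∈ s.Vstar I) (hy : y ∈ s.Kset I x)
    (hs : s.Single I y) : I.bar y ∈ s.Kset I x := by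
  rw [← h.Kset_eq_of_mem hx hy, Kset_single hs]; simp

theorem Invariant.labelSingle (h : Invariant I B₀ s) {x : Vtx V} (hx : s.IsSource I x)
    (hsx : s.Single I x) (hxl : x ∉ s.labeled) :
    Invariant I B₀ (s.labelAll [x] fun _ => [x]) := by
  have hxV := hx.mem_Vstar
  have hf := h.frame
  have hne : ∀ {i}, s.IsMax i → s.cell I i ≠ s.Kset I x := fun hi => cell_ne_of_single hf hsx hi
  refine h.explore (s.Kset I x) [x] rfl rfl rfl rfl (by simpa using hf.mem_Kset_self x)
    (cell_eq_or_disjoint_Kset hf hxV) (fun y => bar_mem_Kset hf hxV)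
    (fun y hy => if_neg hy) (fun _ _ => rfl) (fun _ => Or.inl rfl) (fun _ => id)
    (fun i hi e => absurd e (hne hi)) (fun i hi e => absurd e (hne hi))
    (fun i hi e => absurd e (hne hi)) ?_ ?_ ?_ ?_ ?_
  · intro y hy z hz
    rw [List.mem_singleton] at hy
    subst hy
    left
    simp only [labelAll, List.mem_singleton, if_true] at hz
    subst hz; exact hf.mem_Kset_self _
  · intro y hy hsy
    rw [Kset_single hsx] at hy
    simp only [Finset.mem_insert, Finset.mem_singleton] at hy
    rcases hy with rfl | rfl <;> simp [labelAll]
  · intro y hy hsy hr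
    have := h.single_rho y (hf.Kset_subset hxV hy) hsy hr
    simp [labelAll, this]
  · intro y hy hyl hsy hns
    exfalso
    rw [Kset_single hsx] at hy
    simp only [Finset.mem_insert, Finset.mem_singleton] at hy
    rcases hy with rfl | rfl
    · exact hns hx
    · exact hns hx.bar
  · obtain ⟨par, rk, hp⟩ := h.paths
    refine ⟨par, rk, hp.add_roots (L' := (· ∈ (s.labelAll [x] fun _ => [x]).labeled))
      (fun y hy => by simp [labelAll, hy]) (fun y hy => ?_) (fun y hy hyl => ?_)⟩
    · exact if_neg (by rintro hyx; rw [List.mem_singleton] at hyx; subst hyx; exact hxl hy)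
    · have hyx : y = x := by simpa [labelAll, hyl] using hy
      subst hyx
      have e : (s.labelAll [y] fun _ => [y]).P y = [y] := if_pos (by simp)
      rw [e]
      exact ⟨hf.root_source hx, by simp, by simp, by simpa using hxV⟩

theorem Invariant.labelSource (h : Invariant I B₀ s) {i : ℕ} {xs : List (Vtx V)}
    (hi : s.IsMax i) (hsb : s.IsSourceBlossom I i) (hsi : s.sign i = none)
    (hl : ListsInOrder xs (s.Hbul I i) (s.ord i)) :
    Invariant I B₀ { s.labelAll xs (s.R i) with
      sign := Function.update s.sign i (some .plus) } := by
  have hf := h.frame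
  have hnn : ¬ s.IsNormal I i := fun hn => hn.2 hsb.2
  have hcell : s.cell I i = s.H i := by rw [cell, if_neg hnn]
  have hxs : ∀ x, x ∈ xs ↔ x ∈ s.Hbul I i := fun x => by rw [← hl.2.1]; simp
  have hxc : ∀ x ∈ xs, x ∈ s.cell I i := fun x hx =>
    H_subset_cell (Hbul_subset ((hxs x).1 hx))
  have hroute := fun x hx => h.route i hi (by rw [hsi]; simp) x ((hxs x).1 hx)
  have huniq : ∀ j, s.IsMax j → s.cell I j = s.cell I i → j = i := fun j hj e => by
    obtain ⟨y, hy⟩ := hf.H_nonempty hj.1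
    have hy := H_subset_cell (I := I) hy
    exact hf.eq_of_mem_cell hj hi hy (e ▸ hy)
  have hnl : ∀ x ∈ xs, x ∉ s.labeled := fun x hx hxl =>
    (h.touched x hxl x (h.paths.self_mem hxl)).1 i hi (hxc x hx) hsi
  refine h.explore (s.cell I i) xs rfl rfl rfl rfl hxc
    (fun j hj => ?_) (fun y hy hsy => absurd hy (hsy i hi))
    (fun y hy => if_neg hy) (fun _ _ => rfl) (fun j => ?_) (fun j hj => ?_)
    (fun j hj e hn => ?_) (fun j hj e hs => ?_) (fun j hj e => ?_) (fun x hx y hy => ?_)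
    (fun y hy hsy => absurd hy (hsy i hi)) (fun y hy hsy => absurd hy (hsy i hi))
    (fun y hy _ hsy => absurd hy (hsy i hi)) ?_
  · by_cases e : j = i
    · subst e; exact Or.inl rfl
    · exact Or.inr (hf.cell_disjoint hj hi e)
  · by_cases e : j = i
    · subst e; exact Or.inr ⟨hi, rfl⟩
    · exact Or.inl (Function.update_of_ne e _ _)
  · by_cases e : j = i
    · subst e; exact Function.update_self _ _ _
    · exact (Function.update_of_ne e _ _).trans hj
  · rw [huniq j hj e] at hn; exact absurd hn hnn
  · have := huniq j hj e
    subst this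
    simp only [Function.update_self] at hs
    cases hs
  · have := huniq j hj e
    subst this
    simp
  · left
    simp only [labelAll, hx, if_true] at hy
    exact H_subset_cell ((hroute x hx).2.1 y hy)
  · obtain ⟨par, rk, hp⟩ := h.paths
    refine ⟨par, rk, hp.add_roots (L' := (· ∈ s.labeled ++ xs))
      (fun y hy => by simp [hy]) (fun y hy => ?_) (fun y hy hyl => ?_)⟩
    · exact if_neg fun hyx => hnl y hyx hy
    · have hyx : y ∈ xs := by simpa [hyl] using hy
      have e : (s.labelAll xs (s.R i)).P y = s.R i y := if_pos hyx
      obtain ⟨r1, r2, r3, -⟩ := hroute y hyx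
      show s.Root I y ∧ ((s.labelAll xs (s.R i)).P y).Nodup ∧ _ ∧ _
      simp only [e]
      have hK : ∀ z ∈ s.cell I i, s.Kset I z = s.cell I i := fun z hz => hf.Kset_of_cell hi hz
      refine ⟨?_, r1, r3, fun z hz => ⟨hf.H_subset i hi.1 (r2 z hz), ?_⟩⟩
      · obtain ⟨z, hz, hzs⟩ := hsb.2
        refine ⟨z, ?_, hzs⟩
        rw [hK y (hxc y hyx), hcell]; exact hz
      · rw [hK z (H_subset_cell (r2 z hz)), hK y (hxc y hyx)]

/-- The invariants persist when a line without labeled vertices is entered from `v`: it becomes a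
leaf of the search forest. -/
theorem Invariant.growSingle (h : Invariant I B₀ s) (hsl : SourcesLabeled I s) {v u : Vtx V}
    (hv : v ∈ s.labeled) (hu : s.Cand4 I v u) (hsu : s.Single I u) :
    Invariant I B₀ (s.growSingle I v u) := by
  obtain ⟨hul, hadj, hK, hru⟩ := hu
  have hf := h.frame
  have huV : u ∈ s.Vstar I := hadj.adj.mem_right hf
  have hbV : I.bar u ∈ s.Vstar I := bar_mem_Vstar.2 huV
  have hsb := hf.single_bar huV hsu
  have hns : ¬ s.IsSource I u := fun hs => hul (hsl u hs hsu)
  have hnsb : ¬ s.IsSource I (I.bar u) := fun hs => hns (by simpa using hs.bar)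
  have hbl : I.bar u ∉ s.labeled := fun hb =>
    h.single_labeled _ hb hsb hnsb (by rwa [bar_bar])
  have hne : ∀ {i}, s.IsMax i → s.cell I i ≠ s.Kset I u := fun hi => cell_ne_of_single hf hsu hi
  have hKu : ∀ {y}, y ∈ s.Kset I u ↔ y = u ∨ y = I.bar u := by rw [Kset_single hsu]; simp
  have hunt : ∀ x ∈ s.labeled, ∀ y ∈ s.P x, y ∉ s.Kset I u := by
    intro x hx y hy hyu
    rcases hKu.1 hyu with rfl | rfl
    · exact ((h.touched x hx _ hy).2 hsu).elim hul hbl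
    · have := (h.touched x hx _ hy).2 hsb
      rw [bar_bar] at this
      exact this.elim hbl hul
  have hb : I.bar u ∈ s.Kset I u := hKu.2 (Or.inr rfl)
  have hPb : (s.growSingle I v u).P (I.bar u) = s.P v ++ [u, I.bar u] := if_pos (by simp)
  refine h.explore (s.Kset I u) [I.bar u] rfl rfl rfl rfl (by simpa using hb)
    (cell_eq_or_disjoint_Kset hf huV) (fun y => bar_mem_Kset hf huV)
    (fun y hy => if_neg hy) (fun y hy => ?_) (fun _ => Or.inl rfl) (fun _ => id)
    (fun i hi e => absurd e (hne hi)) (fun i hi e => absurd e (hne hi))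
    (fun i hi e => absurd e (hne hi)) ?_ ?_ ?_ ?_ ?_
  · have hyu : y ≠ u := by rintro rfl; exact hy (hf.mem_Kset_self _)
    exact Function.update_of_ne hyu _ _
  · intro y hy z hz
    rw [List.mem_singleton] at hy
    subst hy
    rw [hPb, List.mem_append] at hz
    rcases hz with hz | hz
    · exact Or.inr ⟨v, hv, hz⟩
    · left; rw [hKu]; simpa using hz
  · intro y hy hsy
    rcases hKu.1 hy with rfl | rfl <;> simp [SearchState.growSingle, labelAll]
  · intro y hy hsy hr
    rcases hKu.1 hy with rfl | rfl
    · simp [SearchState.growSingle, labelAll]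
    · exfalso
      have : s.rho (I.bar u) ≠ none := by
        have e : (s.growSingle I v u).rho (I.bar u) = s.rho (I.bar u) :=
          Function.update_of_ne (bar_ne u) _ _
        rwa [e] at hr
      have := h.single_rho _ hbV hsb this
      rw [bar_bar] at this
      exact hul this
  · intro y hy hyl hsy _
    have hyb : y = I.bar u := by
      rcases hKu.1 hy with rfl | rfl
      · have : y ∈ s.labeled ∨ y = I.bar y := by
          simpa [SearchState.growSingle, labelAll] using hyl
        exact absurd this (by simp [hul, (bar_ne y).symm])
      · rfl
    subst hyb
    simp [SearchState.growSingle]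
  · obtain ⟨par, rk, hp⟩ := h.paths
    refine ⟨_, _, hp.grow (x₀ := I.bar u) (l := [u, I.bar u]) hv ?_ (fun x => ?_) (fun x hx => ?_)
      (fun x hx e => ?_) hbV hPb ?_ ?_ ?_⟩
    · rwa [Frame.root_single hsb]
    · simp [SearchState.growSingle, labelAll]
    · exact if_neg fun hxb => hbl (by rw [List.mem_singleton] at hxb; rwa [← hxb])
    · refine hunt x hx x (hp.self_mem hx) ((hf.mem_Kset_iff huV).2 (e.trans ?_))
      exact hf.Kset_eq_of_mem huV hb
    · rw [hPb, List.nodup_append]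
      refine ⟨hp.nodup v hv, by simpa using (bar_ne u).symm, fun a ha b hb' e => ?_⟩
      subst e
      exact hunt v hv a ha (hKu.2 (by simpa using hb'))
    · rw [hPb]; simp
    · intro y hy
      have hy : y ∈ s.Kset I u := hKu.2 (by simpa using hy)
      exact ⟨hf.Kset_subset huV hy, (hf.Kset_eq_of_mem huV hy).trans
        (hf.Kset_eq_of_mem huV hb).symm⟩

/-- The search is never extended into a maximal normal blossom that is labeled already: the vertices
of such a blossom with edges to the outside, and its bud, are labeled or have `ρ` assigned. -/
theorem Invariant.sign_none_of_cand (h : Invariant I B₀ s) {v u : Vtx V} {i : ℕ}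
    (hu : s.Cand4 I v u) (hi : s.IsMax i) (hn : s.IsNormal I i) (hui : u ∈ s.cell I i) :
    s.sign i = none := by
  obtain ⟨hul, hadj, hK, hru⟩ := hu
  have hf := h.frame
  have hvV : v ∈ s.Vstar I := hadj.adj.symm.mem_right hf
  have hvi : v ∉ s.cell I i := fun hv =>
    hK ((hf.Kset_of_cell hi hui).trans (hf.Kset_of_cell hi hv).symm)
  have hbul : u ∈ s.H i → u ≠ .tip i → u ∈ s.Hbul I i := fun h1 h2 =>
    mem_Hbul.2 ⟨h1, Or.inr ⟨h2, v, hvV, fun h' => hvi (H_subset_cell h'), hadj.adj.symm⟩⟩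
  rcases hs : s.sign i with - | _ | _
  · rfl
  · exfalso
    obtain ⟨c1, c2, c3⟩ := h.plus i hi hn hs
    rcases mem_cell.1 hui with hui | ⟨-, rfl⟩
    · by_cases e : u = .tip i
      · subst e; exact hul c2
      · exact hul (c3 u (hbul hui e))
    · exact c1 hru
  · exfalso
    obtain ⟨c1, c2, c3, c4, c5⟩ := h.minus i hi hs
    rcases mem_cell.1 hui with hui | ⟨-, rfl⟩
    · by_cases e : u = .tip i
      · subst e
        exact h.tip_closed i hi hn (by rw [hs]; simp) ⟨v, hvV, hvi, hadj.adj.symm⟩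
      · exact (c3 u (hbul hui e)).elim hul fun h' => h' hru
    · exact hul c2

theorem Invariant.untouched (h : Invariant I B₀ s) {i : ℕ} (hi : s.IsMax i)
    (hs : s.sign i = none) {x y : Vtx V} (hx : x ∈ s.labeled) (hy : y ∈ s.P x) :
    y ∉ s.cell I i := fun hyi => (h.touched x hx y hy).1 i hi hyi hs

/-- The invariants persist when a blossom without labeled vertices is entered from `v` and labeled
`⊖`: it becomes a leaf of the search forest, whose only labeled vertex is its bud. -/
theorem Invariant.growBlossom (h : Invariant I B₀ s) {v u y : Vtx V} {i : ℕ}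
    (hv : v ∈ s.labeled) (hu : s.Cand4 I v u) (hi : s.IsMax i) (hn : s.IsNormal I i)
    (hui : u ∈ s.cell I i) (hy : y ∈ s.Hbul I i) : Invariant I B₀ (s.growBlossom I v i y) := by
  have hsi := h.sign_none_of_cand hu hi hn hui
  have hf := h.frame
  have hunt := fun x hx z hz => h.untouched hi hsi (x := x) (y := z) hx hz
  have hb := Frame.bud_mem_cell hn
  obtain ⟨r1, r2, r3, r4⟩ := h.route i hi (by rw [hsi]; simp) y hy
  have hhead := r4 hn
  obtain ⟨l, hl⟩ : ∃ l, s.R i y = .tip i :: l := by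
    cases e : s.R i y with
    | nil => rw [e] at hhead; simp at hhead
    | cons a l => rw [e] at hhead; simp at hhead; exact ⟨l, by rw [hhead]⟩
  have huniq : ∀ j, s.IsMax j → s.cell I j = s.cell I i → j = i := fun j hj e => by
    obtain ⟨y, hy⟩ := hf.H_nonempty hj.1
    have hy := H_subset_cell (I := I) hy
    exact hf.eq_of_mem_cell hj hi hy (e ▸ hy)
  have hbl : Vtx.bud i ∉ s.labeled := fun hb' =>
    hunt _ hb' _ (h.paths.self_mem hb') hb
  have hPb : (s.growBlossom I v i y).P (.bud i) = s.P v ++ ((s.R i y).reverse ++ [.bud i]) := by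
    rw [← List.append_assoc]; exact if_pos (by simp)
  have hsg : ∀ {z}, z ∈ s.cell I i → ¬ s.Single I z := fun hz hsz => hsz i hi hz
  refine h.explore (s.cell I i) [.bud i] rfl rfl rfl rfl (by simpa using hb)
    (fun j hj => ?_) (fun z hz hsz => absurd hsz (hsg hz))
    (fun y hy => if_neg hy) (fun z hz => ?_) (fun j => ?_) (fun j hj => ?_)
    (fun j hj e hn => ?_) (fun j hj e hs => ?_) (fun j hj e => ?_) (fun x hx z hz => ?_)
    (fun z hz hsz => absurd hsz (hsg hz)) (fun z hz hsz => absurd hsz (hsg hz))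
    (fun z hz _ hsz => absurd hsz (hsg hz)) ?_
  · by_cases e : j = i
    · subst e; exact Or.inl rfl
    · exact Or.inr (hf.cell_disjoint hj hi e)
  · refine if_neg fun hz' => hz (H_subset_cell (Hbul_subset hz'.1))
  · by_cases e : j = i
    · subst e; exact Or.inr ⟨hi, rfl⟩
    · exact Or.inl (Function.update_of_ne e _ _)
  · have : j ≠ i := by rintro rfl; rw [hsi] at hj; cases hj
    exact (Function.update_of_ne this _ _).trans hj
  · have := huniq j hj e
    subst this
    simp [SearchState.growBlossom]
  · have := huniq j hj e
    subst this
    refine ⟨hn, by simp [SearchState.growBlossom, labelAll], fun x hx => ?_, fun x hx hxc => ?_,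
      s.P v ++ l.reverse, by rw [hPb, hl]; simp⟩
    · right
      have hxl : x ∉ s.labeled := fun hxl =>
        hunt x hxl x (h.paths.self_mem hxl) (H_subset_cell (Hbul_subset hx))
      simp [SearchState.growBlossom, hx, hxl]
    · have : x ∈ s.labeled ∨ x = .bud j := by
        simpa [SearchState.growBlossom, labelAll] using hx
      exact this.resolve_left fun hxl => hunt x hxl x (h.paths.self_mem hxl) hxc
  · have := huniq j hj e
    subst this
    simp [SearchState.growBlossom]
  · rw [List.mem_singleton] at hx
    subst hx
    rw [hPb, List.mem_append] at hz
    rcases hz with hz | hz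
    · exact Or.inr ⟨v, hv, hz⟩
    · left
      simp only [List.mem_append, List.mem_reverse, List.mem_singleton] at hz
      rcases hz with hz | rfl
      · exact H_subset_cell (r2 z hz)
      · exact hb
  · obtain ⟨par, rk, hp⟩ := h.paths
    have hKb := hf.Kset_of_cell hi hb
    have hmem : ∀ z ∈ (s.R i y).reverse ++ [.bud i], z ∈ s.cell I i := fun z hz => by
      simp only [List.mem_append, List.mem_reverse, List.mem_singleton] at hz
      rcases hz with hz | rfl
      · exact H_subset_cell (r2 z hz)
      · exact hb
    refine ⟨_, _, hp.grow (x₀ := .bud i) (l := (s.R i y).reverse ++ [.bud i]) hv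
      (hf.root_normal hi hn hb) (fun x => ?_) (fun x hx => ?_) (fun x hx e => ?_)
      (hf.cell_subset hi.1 hb) hPb ?_ ?_ ?_⟩
    · simp [SearchState.growBlossom, labelAll]
    · exact if_neg fun hxb => hbl (by rw [List.mem_singleton] at hxb; rwa [← hxb])
    · refine hunt x hx x (hp.self_mem hx) ?_
      rw [← hKb, ← e]; exact hf.mem_Kset_self x
    · rw [hPb, List.nodup_append]
      refine ⟨hp.nodup v hv, ?_, fun a ha b hb' e => ?_⟩
      · rw [List.nodup_append]
        refine ⟨List.nodup_reverse.2 r1, by simp, ?_⟩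
        rintro a ha b hb' rfl
        rw [List.mem_singleton] at hb'
        subst hb'
        exact hf.bud_notMem hn (r2 _ (List.mem_reverse.1 ha))
      · subst e
        exact hunt v hv a ha (hmem a hb')
    · rw [hPb]; simp
    · intro z hz
      have := hmem z hz
      exact ⟨hf.cell_subset hi.1 this, (hf.Kset_of_cell hi this).trans hKb.symm⟩

end SearchState

namespace SearchState

open Config

variable {I : ParityInstance K U V} {s s' : SearchState K V} {B₀ : Finset V} {S : Finset (Vtx V)}

/-! ### Merging nodes -/

theorem _root_.MatroidParity.Config.AddNode.Vstar_eq {c c' : Config K V} {n : ℕ}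
    (a : AddNode I c c' n S) (hs : c.HasSource I S) : c'.Vstar I = c.Vstar I := by
  ext x; simp [a.mem_Vstar, hs]

theorem _root_.MatroidParity.Config.AddNode.exits {c c' : Config K V} {n : ℕ}
    (a : AddNode I c c' n S) (hs : c.HasSource I S) (hB : c'.Bs = c.Bs) (hC : c'.C = c.C)
    {F : Finset (Vtx V)} {x : Vtx V} (h : c'.Exits I F x) : c.Exits I F x := by
  obtain ⟨y, h1, h2, h3⟩ := h
  rw [adj_iff, hB, hC, a.Vstar_eq hs] at h3
  rw [a.Vstar_eq hs] at h1
  exact ⟨y, h1, h2, h3⟩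

/-- Completing the blossom formed from the union `S` of nodes merges these nodes, provided that its
paths and its labels are as they should be and no edges between other nodes arise. -/
theorem Merge.of_addNode (h : Invariant I B₀ s) (a : AddNode I s.toConfig s'.toConfig s.next S)
    (hnext : s'.next = s.next + 1) (hrep : Represents I (s'.Vstar I) s'.Bs s'.C)
    (hexits : ∀ F ⊆ s.Vstar I, Disjoint F S → ∀ x ∈ F, s'.Exits I F x → s.Exits I F x)
    (hR : ∀ j, j ≠ s.next → s'.R j = s.R j) (hsn : s'.sign s.next = some .plus)
    (hs : ∀ j, j ≠ s.next → s'.sign j = s.sign j) (hlab : ∀ x ∈ s.labeled, x ∈ s'.labeled)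
    (hlab' : ∀ x ∈ s'.labeled, x ∉ s'.cell I s.next → x ∈ s.labeled)
    (hrho : ∀ x ∉ s'.cell I s.next, s'.rho x = s.rho x)
    (hq : ∀ x ∈ s'.queue, x ∈ s'.labeled)
    (hnormal : ¬ s.HasSource I S → s'.rho (.bud s.next) ≠ none ∧ .tip s.next ∈ s'.labeled ∧
      ∀ x ∈ s'.Hbul I s.next, x ∈ s'.labeled)
    (ht : ∀ x ∈ s'.labeled, ∀ y ∈ s'.P x, y ∈ s'.cell I s.next ∨ ∃ x₀ ∈ s.labeled, y ∈ s.P x₀)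
    (hm : ∀ i, s.IsMax i → Disjoint (s.cell I i) S → s.sign i = some .minus →
      ∃ l, s'.P (.bud i) = l ++ [.tip i, .bud i])
    (hpaths : PathInv I s') : Merge I s s' s.next := by
  have hf := h.frame
  have hold : ∀ i ∈ s'.ids, i ≠ s.next → i ∈ s.ids := fun i hi hin =>
    (a.mem_ids.1 hi).resolve_left hin
  have hmax : ∀ i, s'.IsMax i → i ≠ s.next → s.IsMax i ∧ Disjoint (s.cell I i) S :=
    fun i hi hin => ((a.max_iff hf).1 hi).resolve_left hin
  refine ⟨a.frame hf, fun i hi => ?_, a.base_eq, hrep, hq, a.max_new hf, hsn,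
    fun hn => hnormal (a.normal_new.1 hn), fun i hi hin => ?_, fun i hi hin => ?_,
    fun i hi hin F hF x hx => ?_, fun x hx hxn => ?_, hlab, ht, fun i hi hin => ?_, hpaths⟩
  · rw [hnext]
    rcases a.mem_ids.1 hi with rfl | hi
    · exact Nat.lt_succ_self _
    · exact (h.lt_next i hi).trans (Nat.lt_succ_self _)
  · have hi' := hold i hi hin
    exact ⟨hi', a.H_old hi', hs i hin⟩
  · have hi' := hold i hi.1 hin
    exact ⟨(hmax i hi hin).1, a.cell_old hi', a.normal_old hi', hR i hin⟩
  · obtain ⟨h1, h2⟩ := hmax i hi hin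
    exact hexits F (hF.trans (hf.cell_subset h1.1)) (h2.mono_left hF) x hx
  · refine ⟨(a.mem_Vstar.1 hx).resolve_right fun h' => hxn (a.mem_cell_new.2 (Or.inr h')),
      fun hsx => ((a.single_iff hf).1 hsx).1, fun hxl => hlab' x hxl hxn, hrho x hxn⟩
  · obtain ⟨h1, h2⟩ := hmax i hi hin
    exact hm i h1 h2

theorem Invariant.fresh (h : Invariant I B₀ s) : s.next ∉ s.ids := fun hn =>
  (h.lt_next _ hn).false

/-- A source line of two adjacent single vertices becomes a blossom. -/
theorem Invariant.newSource_merge (h : Invariant I B₀ s) {x : Vtx V} (hx : s.IsSource I x)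
    (hs : s.Single I x) :
    Merge I s ((s.addBlossom {x, I.bar x}).finishBlossom I s.next fun y => [y]) s.next := by
  have hf := h.frame
  have hxV := hx.mem_Vstar
  have hsb := hf.single_bar hxV hs
  have hK : ∀ y ∈ ({x, I.bar x} : Finset (Vtx V)), y ∈ s.Vstar I ∧ s.Kset I y = {x, I.bar x} := by
    intro y hy
    rw [Finset.mem_insert, Finset.mem_singleton] at hy
    rcases hy with rfl | rfl
    · exact ⟨hxV, Kset_single hs⟩
    · exact ⟨bar_mem_Vstar.2 hxV, by rw [Kset_single hsb, bar_bar, Finset.pair_comm]⟩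
  have hS : s.HasSource I {x, I.bar x} := ⟨x, by simp, hx⟩
  have a : AddNode I s.toConfig
      ((s.addBlossom {x, I.bar x}).finishBlossom I s.next fun y => [y]).toConfig s.next
      {x, I.bar x} := by
    refine ⟨h.fresh, rfl, by rw [if_pos hS]; rfl, rfl, fun _ _ => Iff.rfl,
      fun y hy => Or.inl (hf.Bs_subset hy), fun h' => absurd hS h',
      fun y hy => ⟨(hK y hy).1, (hK y hy).2.subset⟩, fun y hy z hz _ _ => ?_,
      fun _ j hj hsub => ?_⟩
    · simp only [Finset.mem_insert, Finset.mem_singleton] at hy hz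
      rcases hy with rfl | rfl <;> rcases hz with rfl | rfl <;> simp
    · obtain ⟨m, hm, -, h2⟩ := hf.exists_max_cell hj
      exact hs m hm (h2 (H_subset_cell (hsub (by simp))))
  refine Merge.of_addNode h a rfl ?_ (fun F _ _ y _ => a.exits hS rfl rfl)
    (fun j hj => Function.update_of_ne hj _ _) (Function.update_self ..)
    (fun j hj => Function.update_of_ne hj _ _) (fun _ => id) (fun _ h' _ => h') (fun _ _ => rfl)
    h.queue (fun h' => absurd hS h') (fun y hy z hz => Or.inr ⟨y, hy, hz⟩)
    (fun i hi _ hm => (h.minus i hi hm).2.2.2.2) ?_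
  · rw [a.Vstar_eq hS]; exact h.represents
  · obtain ⟨par, rk, hp⟩ := h.paths
    refine ⟨par, rk, ?_⟩
    rw [a.Vstar_eq hS]
    have hc : ∀ {y}, y ∈ Config.cell I ((s.addBlossom {x, I.bar x}).finishBlossom I s.next
        fun y => [y]).toConfig s.next ↔ y ∈ ({x, I.bar x} : Finset (Vtx V)) := by
      intro y; rw [a.mem_cell_new]; simp [hS]
    have hcl : ∀ y z, y ∈ ({x, I.bar x} : Finset (Vtx V)) → s.Kset I y = s.Kset I z →
        z ∈ ({x, I.bar x} : Finset (Vtx V)) := fun y z hy e => by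
      rw [← (hK y hy).2, e]; exact hf.mem_Kset_self z
    refine hp.congr_nodes (fun y z hy hz => ?_) (fun y hy => ?_)
    · rw [a.Kset_eq_iff hf, hc, hc]
      constructor
      · rintro (⟨h1, h2⟩ | ⟨-, -, e⟩)
        · rw [(hK y h1).2, (hK z h2).2]
        · exact e
      · intro e
        by_cases h1 : y ∈ ({x, I.bar x} : Finset (Vtx V))
        · exact Or.inl ⟨h1, hcl y z h1 e⟩
        · exact Or.inr ⟨h1, fun h2 => h1 (hcl z y h2 e.symm), e⟩
    · rw [a.root_iff hf, hc]
      by_cases h1 : y ∈ ({x, I.bar x} : Finset (Vtx V))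
      · simp only [h1, hS, true_and, not_true, false_and, or_false, true_iff]
        refine ⟨x, ?_, hx⟩
        rw [(hK y h1).2]; simp
      · simp [h1]

/-! ### The paths of the vertices of a new blossom -/

/-- The path of a vertex `w` traverses a maximal blossom labeled `⊖` up to its bud, which is the
only vertex of the path after the tip. -/
theorem Invariant.notMem_after_tip (h : Invariant I B₀ s) {w : Vtx V} {i : ℕ}
    (hw : w ∈ s.labeled) (hi : s.IsMax i) (hm : s.sign i = some .minus)
    (ht : .tip i ∈ s.P w) : ∀ y ∈ after (.tip i) (s.P w), y ∉ s.H i := by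
  intro y hy hyH
  obtain ⟨hn, -, -, h4, l', h5⟩ := h.minus i hi hm
  have hf := h.frame
  obtain ⟨par, rk, hp⟩ := h.paths
  have htc := H_subset_cell (I := I) (hf.tip_self hn)
  obtain ⟨x', Lx', kx', l, e, hl⟩ := hp.exists_prefix hw ht
  have hx' : x' ∈ s.cell I i := by
    rw [← hf.Kset_of_cell hi htc, ← kx']; exact hf.mem_Kset_self x'
  obtain rfl := h4 x' Lx' hx'
  have hnd := hp.nodup w hw
  have e' : s.P w = l' ++ .tip i :: (.bud i :: l) := by rw [e, h5]; simp
  rw [e', after_append_cons (by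
    intro hc
    rw [e', List.nodup_append] at hnd
    exact hnd.2.2 _ hc _ (by simp) rfl), List.mem_cons] at hy
  rcases hy with rfl | hy
  · exact hf.bud_notMem hn hyH
  · refine (hl y hy).ne (hp.rk_congr _ _ (hf.cell_subset hi.1 htc) (hf.H_subset i hi.1 hyH) ?_)
    rw [hf.Kset_of_cell hi htc, hf.Kset_of_cell hi (H_subset_cell hyH)]

/-- The path `path` of `x` follows the path `A` of one end of the edge that closes the cycle, and
then goes back along the part `l` of the path of the other end. -/
def Backward (I : ParityInstance K U V) (s : SearchState K V) (A l : List (Vtx V)) (x : Vtx V)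
    (path : List (Vtx V)) : Prop :=
  (x ∈ l ∧ path = A ++ (after x l).reverse ++ [x]) ∨
    ∃ i, s.IsMax i ∧ s.IsNormal I i ∧ s.sign i = some .minus ∧ x ∈ s.Hbul I i ∧ .tip i ∈ l ∧
      path = A ++ (after (.tip i) l).reverse ++ s.R i x

/-- The paths that `Blossom` assigns run along the cycle backwards. -/
theorem PathRule.backward {P : Vtx V → List (Vtx V)} {Pu l₁ l₂ path : List (Vtx V)}
    {v u c d x : Vtx V} (hr : PathRule I s P Pu v u c d x path) (hf : s.Frame I)
    (hx : x ∈ s.Vstar I)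
    (h1 : ∀ y ∈ s.Vstar I, y ∈ after c (P v) → y ∈ l₁ ∧ after y (P v) = after y l₁)
    (h2 : ∀ y ∈ s.Vstar I, y ∈ after d (P u) → y ∈ l₂ ∧ after y (P u) = after y l₂) :
    Backward I s (P v) l₂ x path ∨ Backward I s Pu l₁ x path := by
  rcases hr with ⟨-, ⟨hxu, e⟩ | ⟨hxv, e⟩⟩ | ⟨i, hi, hn, hm, hxi, ⟨hxu, e⟩ | ⟨hxv, e⟩⟩
  · obtain ⟨m, e'⟩ := h2 x hx hxu
    exact Or.inl (Or.inl ⟨m, by rw [e, e']⟩)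
  · obtain ⟨m, e'⟩ := h1 x hx hxv
    exact Or.inr (Or.inl ⟨m, by rw [e, e']⟩)
  · obtain ⟨m, e'⟩ := h2 _ (hf.H_subset i hi.1 (hf.tip_self hn)) hxu
    exact Or.inl (Or.inr ⟨i, hi, hn, hm, hxi, m, by rw [e, e']⟩)
  · obtain ⟨m, e'⟩ := h1 _ (hf.H_subset i hi.1 (hf.tip_self hn)) hxv
    exact Or.inr (Or.inr ⟨i, hi, hn, hm, hxi, m, by rw [e, e']⟩)

theorem Invariant.backward_path (h : Invariant I B₀ s) {w x : Vtx V} {A pre l path : List (Vtx V)}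
    (hb : Backward I s A l x path) (hw : w ∈ s.labeled) (hA : A.Nodup) (e : s.P w = pre ++ l)
    (hd : ∀ y ∈ A, y ∈ s.Vstar I → ∀ z ∈ l, s.Kset I y ≠ s.Kset I z) :
    path.Nodup ∧ path.getLast? = some x ∧
      ∃ q, path = A ++ q ∧ ∀ y ∈ q, y ∈ s.Vstar I ∧ ∃ z ∈ l, s.Kset I y = s.Kset I z := by
  have hf := h.frame
  obtain ⟨par, rk, hp⟩ := id h.paths
  have hnd := hp.nodup w hw
  have hWl : ∀ y ∈ l, y ∈ s.Vstar I := fun y hy => hp.mem_W w hw y (by rw [e]; simp [hy])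
  have hl : l.Nodup := (List.nodup_append.1 (e ▸ hnd)).2.1
  have hAl : ∀ y ∈ A, y ∉ l := fun y hy hyl => hd y hy (hWl y hyl) y hyl rfl
  rcases hb with ⟨hx, rfl⟩ | ⟨i, hi, hn, hm, hxi, ht, rfl⟩
  · refine ⟨nodup_reverse_after hA hl hx hAl, by simp, _, List.append_assoc .., fun y hy => ?_⟩
    have : y ∈ l := by
      simp only [List.mem_append, List.mem_reverse, List.mem_singleton] at hy
      rcases hy with hy | rfl
      · exact mem_of_mem_after hy
      · exact hx
    exact ⟨hWl y this, y, this, rfl⟩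
  · obtain ⟨r1, r2, r3, -⟩ := h.route i hi (by rw [hm]; simp) x hxi
    have htc := H_subset_cell (I := I) (hf.tip_self hn)
    have hK : ∀ y ∈ s.H i, s.Kset I y = s.Kset I (.tip i) := fun y hy => by
      rw [hf.Kset_of_cell hi htc, hf.Kset_of_cell hi (H_subset_cell hy)]
    have htw : .tip i ∈ s.P w := by rw [e]; simp [ht]
    have haft : after (.tip i) (s.P w) = after (.tip i) l := by
      rw [e]
      refine after_append_right fun hc => ?_
      rw [e, List.nodup_append] at hnd
      exact hnd.2.2 _ hc _ ht rfl
    refine ⟨nodup_reverse_after_append hA hl r1 hAl (fun y hy hyA => ?_) (fun y hy hya => ?_),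
      getLast?_append_eq r3, _, List.append_assoc .., fun y hy => ?_⟩
    · exact hd y hyA (hf.H_subset i hi.1 (r2 y hy)) _ ht (hK y (r2 y hy))
    · exact h.notMem_after_tip hw hi hm htw y (haft ▸ hya) (r2 y hy)
    · simp only [List.mem_append, List.mem_reverse] at hy
      rcases hy with hy | hy
      · have := mem_of_mem_after hy
        exact ⟨hWl y this, y, this, rfl⟩
      · exact ⟨hf.H_subset i hi.1 (r2 y hy), _, ht, hK y (r2 y hy)⟩

end SearchState

namespace SearchState

open Config

variable {I : ParityInstance K U V} {s s' : SearchState K V} {B₀ : Finset V} {S : Finset (Vtx V)}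

/-! ### Forming a blossom from a cycle -/

/-- The sets formed by `Blossom` in terms of the search forest. -/
theorem Invariant.blossom_fork (h : Invariant I B₀ s) {par rk}
    (hp : PathSys (· ∈ s.Vstar I) (s.Kset I) (s.Root I) (· ∈ s.labeled) s.P par rk)
    {v u c d : Vtx V} (hv : v ∈ s.labeled) (hu : u ∈ s.labeled)
    (hc : IsLastWith (s.P v) (fun x => ∃ y ∈ s.P u, y ∈ s.Kset I x) c)
    (hd : IsLastWith (s.P u) (fun x => x ∈ s.Kset I c) d) :
    ∃ l₁ l₂, Fork (s.Kset I) (· ∈ s.labeled) s.P rk v u c d l₁ l₂ ∧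
      after c (s.P v) = l₁ ∧ after d (s.P u) = l₂ ∧
      ∀ y, y ∈ s.blossomSet I v u c d ↔
        y ∈ s.Vstar I ∧ ∃ z ∈ l₁ ++ l₂ ++ (if c = d then [] else [c]), s.Kset I y = s.Kset I z := by
  have hf := h.frame
  have hcV := hp.mem_W v hv c hc.mem
  obtain ⟨l₁, l₂, f⟩ := hp.fork hv hu
    (hc.congr fun x hx => by simp only [hf.mem_Kset_iff (hp.mem_W v hv x hx)])
    (hd.congr fun x hx => by rw [hf.mem_Kset_iff hcV])
  refine ⟨l₁, l₂, f, hp.fork_after_left f, hp.fork_after_right f, fun y => ?_⟩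
  rw [blossomSet, hp.fork_after_left f, hp.fork_after_right f, Finset.mem_biUnion]
  have hz : ∀ z ∈ l₁ ++ l₂ ++ (if c = d then [] else [c]), z ∈ s.Vstar I := by
    intro z hz
    simp only [List.mem_append] at hz
    rcases hz with (hz | hz) | hz
    · exact hp.mem_W v hv z (by rw [f.eq_left]; simp [hz])
    · exact hp.mem_W u hu z (by rw [f.eq_right]; simp [hz])
    · split_ifs at hz
      · simp at hz
      · rw [List.mem_singleton] at hz; rwa [hz]
  constructor
  · rintro ⟨z, hzm, hy⟩
    have hzm := List.mem_toFinset.1 hzm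
    exact ⟨hf.Kset_subset (hz z hzm) hy, z, hzm, hf.Kset_eq_of_mem (hz z hzm) hy⟩
  · rintro ⟨hy, z, hzm, e⟩
    exact ⟨z, List.mem_toFinset.2 hzm, (hf.mem_Kset_iff (hz z hzm)).2 e⟩

/-- If the cycle contains a source line, then its nodes are merged into a root of the search
forest. -/
theorem Invariant.blossom_source_merge (h : Invariant I B₀ s) {v u c d : Vtx V}
    (hv : v ∈ s.labeled) (hu : u ∈ s.labeled) (hne : s.Kset I u ≠ s.Kset I v)
    (hc : IsLastWith (s.P v) (fun x => ∃ y ∈ s.P u, y ∈ s.Kset I x) c)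
    (hd : IsLastWith (s.P u) (fun x => x ∈ s.Kset I c) d)
    (hS : s.HasSource I (s.blossomSet I v u c d)) {xs : List (Vtx V)} {f : Vtx V → List (Vtx V)}
    (hl : LabelRule I s (s.addBlossom (s.blossomSet I v u c d)) (s.P u) v u c d xs f)
    (hs' : s' = (((s.addBlossom (s.blossomSet I v u c d)).labelAll xs f).finishBlossom I s.next
      ((s.addBlossom (s.blossomSet I v u c d)).labelAll xs f).P)) :
    Merge I s s' s.next := by
  have hf := h.frame
  obtain ⟨par, rk, hp⟩ := id h.paths
  obtain ⟨l₁, l₂, k, a1, a2, hmem⟩ := h.blossom_fork hp hv hu hc hd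
  set S := s.blossomSet I v u c d with hSdef
  obtain ⟨y₀, hy₀, hsy₀⟩ := id hS
  obtain ⟨hcd, hsc, hcS, hvS, huS, hPS, hrkS, hsrcS⟩ := hp.fork_root k hmem
    ⟨y₀, hy₀, hf.root_source hsy₀⟩
  have hSV : ∀ y ∈ S, y ∈ s.Vstar I := fun y hy => ((hmem y).1 hy).1
  have hScongr : ∀ y z, y ∈ S → z ∈ s.Vstar I → s.Kset I z = s.Kset I y → z ∈ S := by
    intro y z hy hz e
    obtain ⟨-, w, hw, ew⟩ := (hmem y).1 hy
    exact (hmem z).2 ⟨hz, w, hw, e.trans ew⟩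
  have a : AddNode I s.toConfig s'.toConfig s.next S := by
    subst hs'
    refine ⟨h.fresh, rfl, by rw [if_pos hS]; rfl, rfl, fun _ _ => Iff.rfl,
      fun y hy => Or.inl (hf.Bs_subset hy), fun h' => absurd hS h',
      fun y hy => ⟨hSV y hy, fun z hz => hScongr y z hy (hf.Kset_subset (hSV y hy) hz)
        (hf.Kset_eq_of_mem (hSV y hy) hz)⟩, fun y hy z hz sy sz => ?_,
      fun _ j hj hsub => ?_⟩
    · have hcV := hSV c hcS
      exact hf.one_source_Kset
        ((hf.mem_Kset_iff hcV).2 (hsrcS y hy (hf.root_source sy)))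
        ((hf.mem_Kset_iff hcV).2 (hsrcS z hz (hf.root_source sz))) sy sz
    · obtain ⟨m, hm, -, h2⟩ := hf.exists_max_cell hj
      have key : ∀ w ∈ S, s.Kset I w = s.cell I m := fun w hw =>
        hf.Kset_of_cell hm (h2 (H_subset_cell (hsub hw)))
      exact hne ((key u (huS u (hp.self_mem hu))).trans (key v (hvS v (hp.self_mem hv))).symm)
  have hcell : ∀ {y}, y ∈ s'.cell I s.next ↔ y ∈ S := by
    intro y; rw [a.mem_cell_new]; simp [hS]
  have hxs : ∀ x, x ∈ xs ↔ x ∈ s'.Hbul I s.next ∧ x ∉ s.labeled := by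
    intro x
    rw [← List.mem_toFinset, hl.2.1, Finset.mem_filter]
    subst hs'; rfl
  have hxS : ∀ x ∈ xs, x ∈ S := fun x hx =>
    hcell.1 (H_subset_cell (Hbul_subset ((hxs x).1 hx).1))
  have hlab : ∀ x, x ∈ s'.labeled ↔ x ∈ s.labeled ∨ x ∈ xs := by
    intro x; subst hs'; exact List.mem_append
  have hPold : ∀ x ∈ s.labeled, s'.P x = s.P x := by
    intro x hx; subst hs'; exact if_neg fun hx' => ((hxs x).1 hx').2 hx
  have hPnew : ∀ x ∈ xs, (s'.P x).Nodup ∧ (s'.P x).getLast? = some x ∧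
      ∀ y ∈ s'.P x, y ∈ S := by
    intro x hx
    have hxV := hSV x (hxS x hx)
    have hPx : s'.P x = f x := by subst hs'; exact if_pos hx
    rw [hPx]
    have haft : ∀ (w c' : Vtx V) (l : List (Vtx V)), w ∈ s.labeled → s.P w = s.P c' ++ l →
        ∀ y ∈ l, after y (s.P w) = after y l := by
      intro w c' l hw e y hy
      have hnd := hp.nodup w hw
      rw [e] at hnd ⊢
      exact after_append_right fun hc' => (List.nodup_append.1 hnd).2.2 _ hc' _ hy rfl
    have hl1 : ∀ z ∈ l₁, z ∈ S := fun z hz => hvS z (by rw [k.eq_left]; simp [hz])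
    have hl2 : ∀ z ∈ l₂, z ∈ S := fun z hz => huS z (by rw [k.eq_right]; simp [hz])
    have hr : PathRule I s s.P (s.P u) v u c d x (f x) := hl.2.2.1 x hx
    rcases hr.backward hf hxV
      (fun y _ hy => ⟨a1 ▸ hy, haft v c l₁ hv k.eq_left y (a1 ▸ hy)⟩)
      (fun y _ hy => ⟨a2 ▸ hy, haft u d l₂ hu k.eq_right y (a2 ▸ hy)⟩) with hb | hb
    · obtain ⟨b1, b2, q, b3, b4⟩ := h.backward_path hb hu (hp.nodup v hv) k.eq_right
        fun y hy _ z hz => k.disj_right z hz y hy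
      refine ⟨b1, b2, fun y hy => ?_⟩
      rw [b3, List.mem_append] at hy
      rcases hy with hy | hy
      · exact hvS y hy
      · obtain ⟨m1, z, hz, e⟩ := b4 y hy
        exact hScongr z y (hl2 z hz) m1 e
    · obtain ⟨b1, b2, q, b3, b4⟩ := h.backward_path hb hv (hp.nodup u hu) k.eq_left
        fun y hy _ z hz => k.disj_left z hz y hy
      refine ⟨b1, b2, fun y hy => ?_⟩
      rw [b3, List.mem_append] at hy
      rcases hy with hy | hy
      · exact huS y hy
      · obtain ⟨m1, z, hz, e⟩ := b4 y hy
        exact hScongr z y (hl1 z hz) m1 e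
  have hB : s'.Bs = s.Bs ∧ s'.C = s.C := by subst hs'; exact ⟨rfl, rfl⟩
  refine Merge.of_addNode h a (by subst hs'; rfl) ?_
    (fun F _ _ y _ => a.exits hS hB.1 hB.2)
    (fun j hj => by subst hs'; exact Function.update_of_ne hj _ _)
    (by subst hs'; exact Function.update_self ..)
    (fun j hj => by subst hs'; exact Function.update_of_ne hj _ _)
    (fun x hx => (hlab x).2 (Or.inl hx))
    (fun x hx hxn => ((hlab x).1 hx).resolve_right fun hx' => hxn (hcell.2 (hxS x hx')))
    (fun _ _ => by subst hs'; rfl) (fun x hx => ?_) (fun h' => absurd hS h') (fun x hx y hy => ?_)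
    (fun i hi _ hm => ?_) ?_
  · rw [a.Vstar_eq hS, hB.1, hB.2]; exact h.represents
  · rw [hlab]
    have : x ∈ s.queue ∨ x ∈ xs := by subst hs'; exact List.mem_append.1 hx
    exact this.imp_left (h.queue x)
  · rcases (hlab x).1 hx with hx | hx
    · exact Or.inr ⟨x, hx, by rwa [hPold x hx] at hy⟩
    · exact Or.inl (hcell.2 ((hPnew x hx).2.2 y hy))
  · obtain ⟨-, m2, -, -, m5⟩ := h.minus i hi hm
    rwa [hPold _ m2]
  · unfold PathInv
    rw [a.Vstar_eq hS]
    refine ⟨_, _, hp.merge_root (D := (· ∈ S)) (c := c) (fun x y _ _ => ?_)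
      (fun x y _ hy e hx => hScongr x y hx hy e.symm) (fun x _ => ?_)
      (fun x hx => (hlab x).2 (Or.inl hx))
      (fun x hx hxS' => ((hlab x).1 hx).resolve_right fun hx' => hxS' (hxS x hx'))
      (fun x hx y hy => ?_) (fun x _ hx => hrkS x hx) hPold (fun x hx hxS' => ?_)⟩
    · rw [a.Kset_eq_iff hf, hcell, hcell]
    · rw [a.root_iff hf, hcell]; simp only [hS, and_true]; tauto
    · rcases (hlab x).1 hx with hx | hx
      · rw [hPold x hx] at hy; exact hp.mem_W x hx y hy
      · exact hSV y ((hPnew x hx).2.2 y hy)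
    · rcases (hlab x).1 hx with hx | hx
      · rw [hPold x hx]
        exact ⟨hp.nodup x hx, hp.last x hx, hPS x hx hxS'⟩
      · exact hPnew x hx

end SearchState

/-- Inserting `pre` after the prefix `A` of a path does not change its parts after elements
of `l`. -/
theorem after_detour {X : Type*} {A pre s l : List X} {r c : X}
    (hn : (A ++ pre ++ (s ++ l)).Nodup) (hA : A.getLast? = some r)
    (h : (r = c ∧ s = []) ∨ s.getLast? = some c) :
    (∀ y ∈ after c (A ++ pre ++ (s ++ l)), y ∈ pre ∨ y ∈ l) ∧
      ∀ y ∈ l, after y (A ++ pre ++ (s ++ l)) = after y l := by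
  have e : A ++ pre ++ (s ++ l) = A ++ pre ++ s ++ l := by simp
  constructor
  · rcases h with ⟨rfl, rfl⟩ | h
    · intro y
      rw [List.nil_append, List.append_assoc] at hn ⊢
      rw [after_append hn hA, List.mem_append]
      exact id
    · intro y
      rw [e] at hn ⊢
      rw [after_append hn (getLast?_append_eq h)]
      exact Or.inr
  · intro y hy
    rw [e] at hn ⊢
    exact after_append_right fun hc => (List.nodup_append.1 hn).2.2 _ hc _ hy rfl

theorem nodup_detour {X : Type*} {A pre q : List X} (h : (A ++ q).Nodup) (hp : pre.Nodup)
    (hd : ∀ y ∈ pre, y ∉ A ++ q) : (A ++ pre ++ q).Nodup := by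
  simp only [List.nodup_append, List.mem_append] at h hd ⊢
  refine ⟨⟨h.1, hp, ?_⟩, h.2.1, ?_⟩
  · rintro a ha b hb rfl; exact hd a hb (Or.inl ha)
  · rintro a (ha | ha) b hb rfl
    · exact h.2.2 a ha a hb rfl
    · exact hd a ha (Or.inr hb)

namespace SearchState

open Config

variable {I : ParityInstance K U V} {s s' : SearchState K V} {B₀ : Finset V} {S : Finset (Vtx V)}

theorem AttachBud.fields {r g : Vtx V} (ha : AttachBud I s S r g s') :
    (∀ x, x ∈ s'.labeled ↔ x ∈ s.labeled ∨ x = .tip s.next) ∧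
    s'.P = Function.update s.P (.tip s.next) (s.P r ++ [.bud s.next, .tip s.next]) ∧
    s'.rho = Function.update s.rho (.bud s.next) (some r) ∧ s'.queue = s.queue ∧ s'.R = s.R ∧
    s'.sign = s.sign ∧ s'.next = s.next + 1 := by
  obtain ⟨-, C', m₁, m₂, -, hl, rfl⟩ := ha
  refine ⟨fun x => ?_, rfl, rfl, rfl, rfl, rfl, rfl⟩
  rw [hl]
  simp only [List.mem_append, List.mem_cons]
  tauto

/-- If the cycle contains no source line, then its nodes are merged into a child of the node of `r`,
which is entered through the new bud and tip. -/
theorem Invariant.blossom_child_merge (h : Invariant I B₀ s) {v u c d r g : Vtx V}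
    (hv : v ∈ s.labeled) (hu : u ∈ s.labeled)
    (hc : IsLastWith (s.P v) (fun x => ∃ y ∈ s.P u, y ∈ s.Kset I x) c)
    (hd : IsLastWith (s.P u) (fun x => x ∈ s.Kset I c) d)
    (hS : ¬ s.HasSource I (s.blossomSet I v u c d))
    (hr : if c = d then r = c else IsLastWith (s.P v) (fun x => x ∉ s.blossomSet I v u c d) r)
    (hg : IsNextIn (s.P v) r g) {s₀ : SearchState K V}
    (ha : AttachBud I s (s.blossomSet I v u c d) r g s₀) {xs : List (Vtx V)}
    {f rt : Vtx V → List (Vtx V)} {s₁ : SearchState K V}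
    (hs₁ : s₁ = reroute s s₀ (s.blossomSet I v u c d) r)
    (hl : LabelRule I s s₁ (if u = r then s₁.P (.tip s.next) else s₁.P u) v u c d xs f)
    (hs' : s' = (s₁.labelAll xs f).finishBlossom I s.next rt) :
    Merge I s s' s.next := by
  have hf := h.frame
  obtain ⟨par, rk, hp⟩ := id h.paths
  obtain ⟨l₁, l₂, k, a1, a2, hmem⟩ := h.blossom_fork hp hv hu hc hd
  set S := s.blossomSet I v u c d with hSdef
  have hSV : ∀ y ∈ S, y ∈ s.Vstar I := fun y hy => ((hmem y).1 hy).1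
  have hScongr : ∀ y z, y ∈ S → z ∈ s.Vstar I → s.Kset I z = s.Kset I y → z ∈ S := by
    intro y z hy hz e
    obtain ⟨-, w, hw, ew⟩ := (hmem y).1 hy
    exact (hmem z).2 ⟨hz, w, hw, e.trans ew⟩
  have hcl : ∀ y ∈ S, y ∈ s.Vstar I ∧ s.Kset I y ⊆ S := fun y hy =>
    ⟨hSV y hy, fun z hz => hScongr y z hy (hf.Kset_subset (hSV y hy) hz)
      (hf.Kset_eq_of_mem (hSV y hy) hz)⟩
  obtain ⟨Lr, hrS, hrk, ⟨t₁, t₂, e1, e2, T1, T2, A1, A2⟩, ext, ext'⟩ := hp.fork_child k hmem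
    (fun y hy ⟨z, hz, hsz⟩ => hS ⟨z, (hcl y hy).2 hz, hsz⟩) hr
  have hrV := hp.self_W Lr
  have hrP := hp.self_mem Lr
  have hrlast := hp.last r Lr
  -- the parts of paths after the exit `r` of the cycle
  have haft : ∀ x q, x ∈ s.labeled → s.P x = s.P r ++ q → after r (s.P x) = q := by
    intro x q hx e
    rw [e]; exact after_append (e ▸ hp.nodup x hx) hrlast
  have e1' : s.P v = s.P r ++ (t₁ ++ l₁) := by rw [e1, List.append_assoc]
  have e2' : s.P u = s.P r ++ (t₂ ++ l₂) := by rw [e2, List.append_assoc]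
  have hgS : g ∈ S := by
    obtain ⟨w₁, w₂, ew⟩ := hg
    refine T1 g ?_
    have hnd := hp.nodup v hv
    rw [← haft v _ hv e1', ew, after_append_cons]
    · simp
    · intro hc
      rw [ew, List.nodup_append] at hnd
      exact hnd.2.2 _ hc _ (by simp) rfl
  have hgv : g ∈ s.P v := by obtain ⟨w₁, w₂, ew⟩ := hg; rw [ew]; simp
  have hH : AttachHyp I s S r g := ⟨hf, h.fresh, hcl, hS, hrV, hgS⟩
  obtain ⟨q1, q2, q3, q4, q5, q6, q7⟩ := ha.fields
  set b : Vtx V := .bud s.next with hb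
  set t : Vtx V := .tip s.next with ht
  have nb : ∀ {y}, y ∈ s.Vstar I → y ≠ b ∧ y ≠ t := fun hy => hH.ne_new hy
  have a0 := ha.addNode hH
  have a : AddNode I s.toConfig s'.toConfig s.next S := by
    subst hs' hs₁
    exact ⟨a0.fresh, a0.ids_eq, a0.H_eq, a0.base_eq, a0.Bs_old, a0.Bs_new, a0.bud_tip, a0.closed,
      a0.one_source, a0.strict⟩
  have hcell : ∀ {y}, y ∈ s'.cell I s.next ↔ y ∈ S ∨ y = b ∨ y = t := by
    intro y; rw [a.mem_cell_new]; simp [hS, hb, ht]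
  have hcellS : ∀ {y}, y ∈ s.Vstar I → y ∈ s'.cell I s.next → y ∈ S := fun hy hyc =>
    (hcell.1 hyc).resolve_right fun h' => h'.elim (nb hy).1 (nb hy).2
  have hVs : ∀ {y}, y ∈ s'.Vstar I ↔ y ∈ s.Vstar I ∨ y = b ∨ y = t := by
    intro y; rw [a.mem_Vstar]; simp [hS, hb, ht]
  have htl : t ∉ s.labeled := fun h' => (nb (hp.self_W h')).2 rfl
  have hbS : b ∉ S := fun h' => (nb (hSV b h')).1 rfl
  have hL1 : ∀ x, x ∈ s₁.labeled ↔ x ∈ s.labeled ∨ x = t := by subst hs₁; exact q1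
  have hxs : ∀ x, x ∈ xs ↔ x ∈ s'.Hbul I s.next ∧ x ∉ s.labeled ∧ x ≠ t := by
    intro x
    rw [← not_or, ← hL1, ← List.mem_toFinset, hl.2.1, Finset.mem_filter]
    subst hs'; rfl
  have hxS : ∀ x ∈ xs, x ∈ S := fun x hx => by
    obtain ⟨x1, x2, x3⟩ := (hxs x).1 hx
    exact (a.mem_H_new.1 (Hbul_subset x1)).resolve_right fun h' => x3 h'.2
  have hlab : ∀ x, x ∈ s'.labeled ↔ x ∈ s.labeled ∨ x = t ∨ x ∈ xs := by
    intro x; rw [← or_assoc, ← hL1]; subst hs'; exact List.mem_append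
  -- the new paths of the vertices that are already labeled
  have hP1 : ∀ x ∈ s.labeled, (∀ y ∈ s.P x, y ∉ S) → s₁.P x = s.P x := by
    intro x hx hxS'
    subst hs₁
    have : (reroute s s₀ S r).P x = s₀.P x :=
      if_neg fun ⟨_, y, hy, hyS⟩ => hxS' y hy hyS
    rw [this, q2, Function.update_of_ne]
    exact (nb (hp.self_W hx)).2
  have hP2 : ∀ x q, x ∈ s.labeled → (∃ y ∈ s.P x, y ∈ S) → s.P x = s.P r ++ q →
      s₁.P x = s.P r ++ [b, t] ++ q := by
    intro x q hx hm e
    subst hs₁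
    have : (reroute s s₀ S r).P x = s.P r ++ [b, t] ++ after r (s.P x) := if_pos ⟨hx, hm⟩
    rw [this, haft x q hx e]
  have hPt : s₁.P t = s.P r ++ [b, t] := by
    subst hs₁
    have : (reroute s s₀ S r).P t = s₀.P t := if_neg fun h' => htl h'.1
    rw [this, q2, Function.update_self]
  have hP' : ∀ x, x ∉ xs → s'.P x = s₁.P x := by
    intro x hx; subst hs'; exact if_neg hx
  have hxl : ∀ x ∈ s.labeled, x ∉ xs := fun x hx hx' => ((hxs x).1 hx').2.1 hx
  have htx : t ∉ xs := fun hx' => ((hxs t).1 hx').2.2 rfl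
  have hPv : s₁.P v = s.P r ++ [b, t] ++ (t₁ ++ l₁) := hP2 v _ hv ⟨g, hgv, hgS⟩ e1'
  -- the path that leads to `u` through the new bud and tip
  have hPu : (if u = r then s₁.P t else s₁.P u) = s.P r ++ [b, t] ++ (t₂ ++ l₂) ∧
      (s₁.P u = s.P r ++ [b, t] ++ (t₂ ++ l₂) ∨ after d (s₁.P u) = []) := by
    by_cases hur : u = r
    · rw [if_pos hur, hPt]
      have e0 : t₂ ++ l₂ = [] := by
        rw [hur] at e2'
        exact List.append_right_eq_self.1 e2'.symm
      rw [e0, List.append_nil]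
      refine ⟨rfl, Or.inr ?_⟩
      have ht₂ : t₂ = [] := (List.append_eq_nil_iff.1 e0).1
      have hcd : c = d := by
        by_contra hcd
        have := (A2 hcd).2
        rw [ht₂] at this; simp at this
      rw [hP1 u hu (by rw [hur]; exact hrS), hur, ← hcd, ← (A1 hcd).1]
      exact haft r [] Lr (by simp)
    · rw [if_neg hur]
      have : s₁.P u = s.P r ++ [b, t] ++ (t₂ ++ l₂) := by
        refine hP2 u _ hu ?_ e2'
        cases e0 : t₂ ++ l₂ with
        | nil =>
          rw [e0, List.append_nil] at e2'
          exact absurd (hp.eq_of_path_eq hu Lr e2') hur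
        | cons y m =>
          exact ⟨y, by rw [e2', e0]; simp, T2 y (by rw [e0]; simp)⟩
      exact ⟨this, Or.inl this⟩
  have hnd : ∀ x q, x ∈ s.labeled → s.P x = s.P r ++ q → (s.P r ++ [b, t] ++ q).Nodup := by
    intro x q hx e
    refine nodup_detour (e ▸ hp.nodup x hx) (by simp [hb, ht]) fun y hy hy' => ?_
    rw [← e] at hy'
    have := nb (hp.mem_W x hx y hy')
    simp only [List.mem_cons, List.not_mem_nil, or_false] at hy
    exact hy.elim this.1 this.2
  have hcd : (c = d ∧ r = c ∧ t₁ = [] ∧ t₂ = []) ∨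
      (t₁.getLast? = some c ∧ t₂.getLast? = some d) := by
    by_cases e : c = d
    · exact Or.inl ⟨e, A1 e⟩
    · exact Or.inr (A2 e)
  have hold : ∀ x q, x ∈ s.labeled → s.P x = s.P r ++ q → ∀ y ∈ s.P r ++ [b, t] ++ q,
      y ∈ s.Vstar I → y ∈ s.P x := by
    intro x q hx e y hy hyV
    rw [e]
    simp only [List.mem_append, List.mem_cons, List.not_mem_nil, or_false] at hy ⊢
    rcases hy with (hy | hy) | hy
    · exact Or.inl hy
    · exact absurd hy (not_or.2 (nb hyV))
    · exact Or.inr hy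
  have hPnew : ∀ x ∈ xs, (s'.P x).Nodup ∧ (s'.P x).getLast? = some x ∧
      ∃ q, s'.P x = s.P r ++ q ∧ ∀ y ∈ q, y ∈ s'.cell I s.next := by
    intro x hx
    have hxV := hSV x (hxS x hx)
    have hPx : s'.P x = f x := by subst hs'; exact if_pos hx
    rw [hPx]
    have hrule := hl.2.2.1 x hx
    rw [hPu.1] at hrule
    have hl1 : ∀ z ∈ l₁, z ∈ S := fun z hz => T1 z (by simp [hz])
    have hl2 : ∀ z ∈ l₂, z ∈ S := fun z hz => T2 z (by simp [hz])
    have dv := after_detour (hnd v _ hv e1') hrlast (c := c)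
      (hcd.imp (fun h' => ⟨h'.2.1, h'.2.2.1⟩) fun h' => h'.1)
    have du := after_detour (hnd u _ hu e2') hrlast (c := d)
      (hcd.imp (fun h' => ⟨h'.2.1.trans h'.1, h'.2.2.2⟩) fun h' => h'.2)
    have npre : ∀ {y}, y ∈ s.Vstar I → y ∉ [b, t] := fun hy hy' => by
      simp only [List.mem_cons, List.not_mem_nil, or_false] at hy'
      exact hy'.elim (nb hy).1 (nb hy).2
    have fin : ∀ (m q : List (Vtx V)), (∀ y ∈ m, y ∈ S) →
        (∀ y ∈ q, y ∈ s.Vstar I ∧ ∃ z ∈ l₁ ++ l₂, s.Kset I y = s.Kset I z) →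
        ∃ q', s.P r ++ [b, t] ++ m ++ q = s.P r ++ q' ∧ ∀ y ∈ q', y ∈ s'.cell I s.next := by
      intro m q hm hq
      refine ⟨[b, t] ++ m ++ q, by simp, fun y hy => ?_⟩
      simp only [List.mem_append, List.mem_cons, List.not_mem_nil, or_false] at hy
      rw [hcell]
      rcases hy with (hy | hy) | hy
      · exact Or.inr hy
      · exact Or.inl (hm y hy)
      · obtain ⟨m1, z, hz, e⟩ := hq y hy
        have hzS : z ∈ S := (List.mem_append.1 hz).elim (hl1 z) (hl2 z)
        exact Or.inl (hScongr z y hzS m1 e)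
    rcases hrule.backward hf hxV (l₁ := l₁) (l₂ := l₂)
      (fun y hyV hy => by
        rw [hPv] at hy ⊢
        have := (dv.1 y hy).resolve_left (npre hyV)
        exact ⟨this, dv.2 y this⟩)
      (fun y hyV hy => by
        rcases hPu.2 with e | e
        · rw [e] at hy ⊢
          have := (du.1 y hy).resolve_left (npre hyV)
          exact ⟨this, du.2 y this⟩
        · rw [e] at hy; simp at hy) with hb' | hb'
    · rw [hPv] at hb'
      obtain ⟨b1, b2, q, b3, b4⟩ := h.backward_path hb' hu (hnd v _ hv e1') k.eq_right
        fun y hy hyV z hz => k.disj_right z hz y (hold v _ hv e1' y hy hyV)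
      refine ⟨b1, b2, ?_⟩
      rw [b3]
      exact fin _ _ T1 fun y hy => (b4 y hy).imp_right fun ⟨z, hz, e⟩ => ⟨z, by simp [hz], e⟩
    · obtain ⟨b1, b2, q, b3, b4⟩ := h.backward_path hb' hv (hnd u _ hu e2') k.eq_left
        fun y hy hyV z hz => k.disj_left z hz y (hold u _ hu e2' y hy hyV)
      refine ⟨b1, b2, ?_⟩
      rw [b3]
      exact fin _ _ T2 fun y hy => (b4 y hy).imp_right fun ⟨z, hz, e⟩ => ⟨z, by simp [hz], e⟩
  have hPold : ∀ x ∈ s.labeled, s'.P x = s.P x ∧ (∀ y ∈ s.P x, y ∉ S) ∨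
      (∃ y ∈ s.P x, y ∈ S) ∧ ∃ q, s.P x = s.P r ++ q ∧ s'.P x = s.P r ++ [b, t] ++ q := by
    intro x hx
    rw [hP' x (hxl x hx)]
    by_cases hm : ∃ y ∈ s.P x, y ∈ S
    · obtain ⟨q, e⟩ := ext' x hx hm
      exact Or.inr ⟨hm, q, e, hP2 x q hx hm e⟩
    · push Not at hm
      exact Or.inl ⟨hP1 x hx hm, hm⟩
  have hbc : b ∈ s'.cell I s.next := hcell.2 (Or.inr (Or.inl rfl))
  have htc : t ∈ s'.cell I s.next := hcell.2 (Or.inr (Or.inr rfl))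
  refine Merge.of_addNode h a (by subst hs' hs₁; exact q7) ?_ (fun F hF hFS x hx he => ?_)
    (fun j hj => by subst hs' hs₁; exact (Function.update_of_ne hj _ _).trans (congrFun q5 j))
    (by subst hs'; exact Function.update_self ..)
    (fun j hj => by subst hs' hs₁; exact (Function.update_of_ne hj _ _).trans (congrFun q6 j))
    (fun x hx => (hlab x).2 (Or.inl hx))
    (fun x hx hxn => ?_) (fun x hx => ?_) (fun x hx => ?_) (fun _ => ⟨?_, ?_, fun x hx => ?_⟩)
    (fun x hx y hy => ?_) (fun i hi hiS hm => ?_) ?_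
  · have := ha.represents hH h.represents
    subst hs' hs₁; exact this
  · refine ha.exits hH hF hFS hx ?_
    subst hs' hs₁; exact he
  · rcases (hlab x).1 hx with hx | rfl | hx
    · exact hx
    · exact absurd htc hxn
    · exact absurd (hcell.2 (Or.inl (hxS x hx))) hxn
  · have hx' := fun h' => hx (hcell.2 h')
    have e : s'.rho x = s₀.rho x := by subst hs' hs₁; exact if_neg fun h' => hx' (Or.inl h'.1)
    rw [e, q3, Function.update_of_ne]
    exact fun h' => hx' (Or.inr (Or.inl h'))
  · rw [hlab]
    have : x ∈ s₀.queue ∨ x ∈ xs := by subst hs' hs₁; exact List.mem_append.1 hx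
    rw [q4] at this
    exact this.imp (h.queue x) Or.inr
  · have e : s'.rho b = s₀.rho b := by subst hs' hs₁; exact if_neg fun h' => hbS h'.1
    rw [e, q3, Function.update_self]; simp
  · exact (hlab t).2 (Or.inr (Or.inl rfl))
  · rw [hlab]
    by_contra hcon
    push Not at hcon
    exact hcon.2.2 ((hxs x).2 ⟨hx, hcon.1, hcon.2.1⟩)
  · rcases (hlab x).1 hx with hx | rfl | hx
    · rcases hPold x hx with ⟨e, -⟩ | ⟨-, q, e, e'⟩
      · exact Or.inr ⟨x, hx, by rwa [e] at hy⟩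
      · rw [e'] at hy
        by_cases hyV : y ∈ s.Vstar I
        · exact Or.inr ⟨x, hx, hold x q hx e y hy hyV⟩
        · left
          simp only [List.mem_append, List.mem_cons, List.not_mem_nil, or_false] at hy
          rcases hy with (hy | rfl | rfl) | hy
          · exact absurd (hp.mem_W r Lr y hy) hyV
          · exact hbc
          · exact htc
          · exact absurd (hp.mem_W x hx y (by rw [e]; simp [hy])) hyV
    · rw [hP' t htx, hPt] at hy
      simp only [List.mem_append, List.mem_cons, List.not_mem_nil, or_false] at hy
      rcases hy with hy | rfl | rfl
      · exact Or.inr ⟨r, Lr, hy⟩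
      · exact Or.inl hbc
      · exact Or.inl htc
    · obtain ⟨-, -, q, e, hq⟩ := hPnew x hx
      rw [e, List.mem_append] at hy
      exact hy.elim (fun hy => Or.inr ⟨r, Lr, hy⟩) fun hy => Or.inl (hq y hy)
  · obtain ⟨hn, m2, -, -, l, hl'⟩ := h.minus i hi hm
    rcases hPold _ m2 with ⟨e, -⟩ | ⟨⟨y, hy, hyS⟩, q, e, e'⟩
    · exact ⟨l, by rw [e, hl']⟩
    · have hyi : y ≠ .tip i ∧ y ≠ .bud i := by
        constructor <;> rintro rfl
        · exact Finset.disjoint_left.1 hiS (H_subset_cell (hf.tip_self hn)) hyS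
        · exact Finset.disjoint_left.1 hiS (Frame.bud_mem_cell hn) hyS
      have hyq : y ∈ q := by
        rw [e, List.mem_append] at hy
        exact hy.resolve_left fun hy => hrS y hy hyS
      rw [hl'] at e
      rcases List.append_eq_append_iff.1 e with ⟨z, e3, e4⟩ | ⟨z, e3, e4⟩
      · have : y ∈ [Vtx.tip i, Vtx.bud i] := by rw [e4]; simp [hyq]
        simp [hyi] at this
      · exact ⟨s.P r ++ [b, t] ++ z, by rw [e', e4]; simp⟩
  · refine ⟨_, _, hp.merge_child (D := (· ∈ s'.cell I s.next)) (r := r) (pre := [b, t]) Lr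
      (fun y hy hyc => hrS y hy (hcellS (hp.mem_W r Lr y hy) hyc))
      ⟨by simp [hb, ht], fun y hy => ?_⟩ (fun x y _ _ => a.Kset_eq_iff hf)
      (fun x y hx _ _ _ e hxc => a.mem_cell_congr hf hx e hxc)
      (fun x hx hxc => (hVs.1 hx).resolve_right fun h' => hxc (hcell.2 (Or.inr h')))
      (fun x _ => ?_) (fun x hx => (hlab x).2 (Or.inl hx)) (fun x hx hxc => ?_)
      (fun x hx y hy => a.Vstar_subset (hp.mem_W x hx y hy))
      (fun x hx hxc => hrk x (hcellS (hp.self_W hx) hxc)) (fun x hx hxc => ?_)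
      (fun x hx hm => ?_) (fun x hx hxc => ?_)⟩
    · simp only [List.mem_cons, List.not_mem_nil, or_false] at hy
      rcases hy with rfl | rfl
      · exact ⟨hbc, hVs.2 (by simp), fun h' => (nb h').1 rfl⟩
      · exact ⟨htc, hVs.2 (by simp), fun h' => (nb h').2 rfl⟩
    · rw [a.root_iff hf]; simp only [hS, and_false, false_or]
    · rcases (hlab x).1 hx with hx | rfl | hx
      · exact hx
      · exact absurd htc hxc
      · exact absurd (hcell.2 (Or.inl (hxS x hx))) hxc
    · rcases hPold x hx with ⟨e, -⟩ | ⟨⟨y, hy, hyS⟩, -⟩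
      · exact e
      · exact absurd (hcell.2 (Or.inl hyS)) (hxc y hy)
    · obtain ⟨y, hy, hyc⟩ := hm
      rcases hPold x hx with ⟨-, e⟩ | ⟨-, q, e, e'⟩
      · exact absurd (hcellS (hp.mem_W x hx y hy) hyc) (e y hy)
      · exact ⟨q, e, e'⟩
    · have hsub := (a.frame hf).cell_subset (i := s.next) (a.mem_ids.2 (Or.inl rfl))
      refine ⟨hsub hxc, ?_⟩
      rcases (hlab x).1 hx with hx | rfl | hx
      · have hxS' := hcellS (hp.self_W hx) hxc
        obtain ⟨q, e, hq⟩ := ext x hx hxS'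
        have hm : ∃ y ∈ s.P x, y ∈ S := ⟨x, hp.self_mem hx, hxS'⟩
        have hq0 : q.getLast? = some x := by
          have hl' := hp.last x hx
          have : q ≠ [] := by
            rintro rfl
            rw [List.append_nil] at e
            exact hrS x (by rw [← e]; exact hp.self_mem hx) hxS'
          rwa [e, List.getLast?_append_of_ne_nil _ this] at hl'
        rw [hP' x (hxl x hx), hP2 x q hx hm e]
        refine ⟨hnd x q hx e, getLast?_append_eq hq0, [b, t] ++ q, by simp, fun y hy => ?_⟩
        have : y ∈ s'.cell I s.next := by
          simp only [List.mem_append, List.mem_cons, List.not_mem_nil, or_false] at hy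
          exact hcell.2 (hy.symm.imp_left (hq y))
        exact ⟨hsub this, this⟩
      · rw [hP' t htx, hPt]
        have := hnd r [] Lr (by simp)
        rw [List.append_nil] at this
        refine ⟨this, by simp, [b, t], rfl, fun y hy => ?_⟩
        have : y ∈ s'.cell I s.next := by
          simp only [List.mem_cons, List.not_mem_nil, or_false] at hy
          exact hcell.2 (Or.inr hy)
        exact ⟨hsub this, this⟩
      · obtain ⟨p1, p2, q, e, hq⟩ := hPnew x hx
        exact ⟨p1, p2, q, e, fun y hy => ⟨hsub (hq y hy), hq y hy⟩⟩

theorem Blossom.merge {v u : Vtx V} (hb : s.Blossom I v u s') (h : Invariant I B₀ s)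
    (hv : v ∈ s.labeled) (hu : u ∈ s.labeled) (hne : s.Kset I u ≠ s.Kset I v) :
    Merge I s s' s.next := by
  obtain ⟨c, d, hc, hd, ⟨hS, xs, f, hl, hs'⟩ | ⟨hS, r, g, s₀, xs, f, hr, hg, ha, hl, -, hs'⟩⟩ := hb
  · exact h.blossom_source_merge hv hu hne hc hd hS hl hs'
  · exact h.blossom_child_merge hv hu hc hd hS hr hg ha rfl hl hs'

end SearchState

namespace SearchState

open Config

variable {I : ParityInstance K U V} {s s' : SearchState K V} {B₀ : Finset V} {S : Finset (Vtx V)}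

/-! ### Replacing a blossom -/

/-- The procedure `Graft`, applied to a maximal normal blossom without labeled vertices. -/
theorem Graft.merge {v : Vtx V} {i : ℕ} (hgr : s.Graft I v i s') (h : Invariant I B₀ s)
    (hv : v ∈ s.labeled) (hi : s.IsMax i) (hn : s.IsNormal I i) (hsi : s.sign i = none) :
    Merge I s s' s.next := by
  obtain ⟨s₁, xs, C', ha, hl, hpiv, hs'⟩ := hgr
  have hf := h.frame
  obtain ⟨par, rk, hp⟩ := id h.paths
  have hunt : ∀ x ∈ s.labeled, ∀ y ∈ s.P x, y ∉ s.cell I i := fun x hx y hy =>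
    h.untouched hi hsi hx hy
  have hvV := hp.self_W hv
  have hvc : v ∉ s.cell I i := hunt v hv v (hp.self_mem hv)
  have hS : insert (.bud i) (s.H i) = s.cell I i := (if_pos hn).symm
  rw [hS] at ha
  have hbc := Frame.bud_mem_cell hn
  have htH := hf.tip_self hn
  have htc := H_subset_cell (I := I) htH
  have hcV := hf.cell_subset hi.1
  have hH : AttachHyp I s (s.cell I i) v (.bud i) :=
    ⟨hf, h.fresh, fun x hx => ⟨hcV hx, (hf.Kset_of_cell hi hx).subset⟩,
      fun ⟨x, hx, hsx⟩ => hn.not_source hx hsx, hvV, hbc⟩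
  have a0 := ha.addNode hH
  obtain ⟨q1, q2, q3, q4, q5, q6, q7⟩ := ha.fields
  have hne : i ≠ s.next := by rintro e; exact h.fresh (e ▸ hi.1)
  set b : Vtx V := .bud s.next with hb
  set t : Vtx V := .tip s.next with ht
  set D : Finset (Vtx V) := {.bud i, .tip i} with hD
  have hDiff : ∀ {y}, y ∈ D ↔ y = .bud i ∨ y = .tip i := by intro y; simp [hD]
  have hbD : b ∉ D := by rw [hDiff]; simp [hb, hne.symm]
  have htD : t ∉ D := by rw [hDiff]; simp [ht, hne.symm]
  have nb : ∀ {y}, y ∈ s.Vstar I → y ≠ b ∧ y ≠ t := fun hy => hH.ne_new hy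
  have hV1 : s₁.Vstar I = s.Vstar I ∪ {b, t} := ha.Vstar_eq hH
  have hV3 : (((s₁.labelAll xs fun x => s.P v ++ [b, t, .bud i] ++ s.R i x).finishBlossom
      I s.next fun x => after b ((s₁.labelAll xs
        fun x => s.P v ++ [b, t, .bud i] ++ s.R i x).P x))).Vstar I = s₁.Vstar I := rfl
  have hB1 : ∀ {x}, x ∈ s'.Bs ↔ x ∈ s₁.Bs ∧ x ∉ D := by
    intro x
    subst hs'
    show x ∈ symmDiff s₁.Bs D \ D ↔ _
    simp only [Finset.mem_sdiff, Finset.mem_symmDiff]; tauto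
  have hH1 : ∀ j, j ≠ s.next → s₁.H j = s.H j := by
    intro j hj; rw [a0.H_eq, Function.update_of_ne hj]
  have a : Replace I s.toConfig s'.toConfig s.next i := by
    refine ⟨h.fresh, hi, hn, ?_, fun j hj => ?_, ?_, ?_, fun x hx h1 h2 => ?_, fun x hx => ?_, ?_⟩
    · subst hs'
      show s₁.ids.erase i = _
      rw [a0.ids_eq, Finset.erase_insert_of_ne hne.symm]
    · subst hs'
      exact (Function.update_of_ne hj _ _).trans (hH1 j hj)
    · have : s'.H s.next = s₁.H s.next \ D := by subst hs'; exact Function.update_self ..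
      rw [this]
      ext x
      rw [Finset.mem_sdiff, a0.mem_H_new, hDiff, mem_cell]
      simp only [hH.normal, Finset.mem_insert, Finset.mem_sdiff, Finset.mem_singleton]
      have hbH := hf.bud_notMem hn
      constructor
      · tauto
      · rintro (rfl | ⟨h1, h2⟩)
        · exact ⟨Or.inr ⟨not_false, rfl⟩, by rw [← hDiff]; exact htD⟩
        · refine ⟨Or.inl (Or.inl h1), not_or.2 ⟨?_, h2⟩⟩
          rintro rfl; exact hbH h1
    · ext w
      have := (a0.Bs_old (.orig w) (by simp))
      simp [base, hB1, this, hDiff]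
    · rw [hB1, a0.Bs_old x hx, hDiff]; simp [h1, h2]
    · rw [hB1, hDiff, not_or] at hx
      rcases a0.Bs_new x hx.1 with h' | ⟨-, h'⟩
      · exact Or.inl ⟨h', hx.2⟩
      · exact Or.inr h'
    · rw [hB1, hB1]
      exact (and_iff_left hbD).trans
        ((a0.bud_tip hH.normal).trans (not_congr (and_iff_left htD).symm))
  have hV' : s'.Vstar I = s₁.Vstar I \ D := by
    ext x
    rw [a.mem_Vstar, hV1, Finset.mem_sdiff, hDiff]
    simp only [Finset.mem_union, Finset.mem_insert, Finset.mem_singleton]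
    constructor
    · rintro (⟨h1, h2, h3⟩ | rfl | rfl)
      · exact ⟨Or.inl h1, by tauto⟩
      · exact ⟨Or.inr (Or.inl rfl), by rw [← hDiff]; exact hbD⟩
      · exact ⟨Or.inr (Or.inr rfl), by rw [← hDiff]; exact htD⟩
    · tauto
  have hcell : ∀ {y}, y ∈ s'.cell I s.next ↔ y = b ∨ y = t ∨ (y ∈ s.H i ∧ y ≠ .tip i) :=
    a.mem_cell_new
  have hcellS : ∀ {y}, y ∈ s.Vstar I → y ∈ s'.cell I s.next → y ∈ s.cell I i := fun hy hyc => by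
    rcases hcell.1 hyc with rfl | rfl | h'
    · exact absurd rfl (nb hy).1
    · exact absurd rfl (nb hy).2
    · exact H_subset_cell h'.1
  -- edges after the expansion of the old blossom
  have hbt1 : (.bud i ∈ s₁.Bs ∧ .tip i ∈ s₁.Vstar I \ s₁.Bs) ∨
      (.tip i ∈ s₁.Bs ∧ .bud i ∈ s₁.Vstar I \ s₁.Bs) := by
    have h1 := a0.Bs_old _ (hcV hbc)
    have h2 := a0.Bs_old _ (hcV htc)
    have h3 := hf.bud_tip i hn
    have h4 := a0.Vstar_subset (hcV hbc)
    have h5 := a0.Vstar_subset (hcV htc)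
    simp only [Finset.mem_sdiff, h1, h2, h4, h5]
    tauto
  have hadj : ∀ {x y}, s'.Adj I x y → x ∈ s'.Vstar I → y ∈ s'.Vstar I → s₁.Adj I x y ∨
      s₁.Adj I x (.bud i) ∨ (s₁.Adj I x (.tip i) ∧ (y = .bud i ∨ s₁.Adj I (.bud i) y)) := by
    intro x y hxy hx hy
    have hxD : x ∉ D := by rw [hV'] at hx; exact (Finset.mem_sdiff.1 hx).2
    have hyD : y ∉ D := by rw [hV'] at hy; exact (Finset.mem_sdiff.1 hy).2
    have hm : MatAdj (s₁.Vstar I) (symmDiff s₁.Bs D) C' x y := by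
      have hC : s'.C = C' := by subst hs'; rfl
      have hB2 : ∀ z, z ∉ D → (z ∈ s'.Bs ↔ z ∈ symmDiff s₁.Bs D) := by
        intro z hz; rw [hB1, Finset.mem_symmDiff]; tauto
      rw [adj_iff] at hxy
      unfold MatAdj at hxy ⊢
      simp only [Finset.mem_sdiff, hB2 x hxD, hB2 y hyD, hC, hV', hxD, hyD, not_false_iff,
        and_true] at hxy ⊢
      exact hxy
    rw [hDiff, not_or] at hxD
    rcases hbt1 with ⟨k1, k2⟩ | ⟨k1, k2⟩
    · rcases IsPivot.adj hpiv k1 k2 hxD hm with h' | h' | h'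
      · exact Or.inl h'
      · exact Or.inr (Or.inr h')
      · exact Or.inr (Or.inl h'.1)
    · rw [hD, Finset.pair_comm] at hpiv hm
      rcases IsPivot.adj hpiv k1 k2 hxD.symm hm with h' | h' | h'
      · exact Or.inl h'
      · exact Or.inr (Or.inl h'.1)
      · exact Or.inr (Or.inr h')
  have hf' := a.frame hf
  -- the vertices of the old blossom that get labels
  have hxs : ∀ x, x ∈ xs ↔ x ∈ s₁.Hbul I i := fun x => by rw [← hl.2.1]; simp
  have hxs' : ∀ x ∈ xs, x ∈ s.Hbul I i ∧ x ≠ .tip i := by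
    intro x hx
    have hx := (hxs x).1 hx
    rw [mem_Hbul, hH1 i hne] at hx
    have hxc := H_subset_cell (I := I) hx.1
    refine ⟨mem_Hbul.2 ⟨hx.1, hx.2.imp_right ?_⟩, ?_⟩
    · rintro ⟨h1, y, hy, hyH, hxy⟩
      refine ⟨h1, ?_⟩
      rcases ha.adj_mem hH hxc hxy with h' | h'
      · exact ⟨y, h'.1, hyH, h'.2⟩
      · exact ⟨v, hvV, fun hvH => hvc (H_subset_cell hvH), h'⟩
    · rcases hx.2 with ⟨w, rfl⟩ | h'
      · simp
      · exact h'.1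
  have hxc : ∀ x ∈ xs, x ∈ s'.cell I s.next := fun x hx =>
    hcell.2 (Or.inr (Or.inr ⟨Hbul_subset (hxs' x hx).1, (hxs' x hx).2⟩))
  have hbc' : b ∈ s'.cell I s.next := hcell.2 (Or.inl rfl)
  have htc' : t ∈ s'.cell I s.next := hcell.2 (Or.inr (Or.inl rfl))
  have hlab : ∀ x, x ∈ s'.labeled ↔ x ∈ s.labeled ∨ x = t ∨ x ∈ xs := by
    intro x
    have : x ∈ s'.labeled ↔ x ∈ s₁.labeled ∨ x ∈ xs := by subst hs'; exact List.mem_append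
    rw [this, q1, or_assoc]
  have hPfil : ∀ x, s'.P x = ((s₁.labelAll xs fun x => s.P v ++ [b, t, .bud i] ++ s.R i x).P
      x).filter fun y => y ∉ D := by subst hs'; exact fun x => rfl
  have hid : ∀ x ∈ s.labeled, (s.P x).filter (fun y => y ∉ D) = s.P x := by
    intro x hx
    refine List.filter_eq_self.2 fun y hy => decide_eq_true fun hyD => ?_
    rcases hDiff.1 hyD with rfl | rfl
    · exact hunt x hx _ hy hbc
    · exact hunt x hx _ hy htc
  have hxl : ∀ x ∈ s.labeled, x ∉ xs := fun x hx hx' =>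
    hunt x hx x (hp.self_mem hx) (H_subset_cell (Hbul_subset (hxs' x hx').1))
  have htl : t ∉ s.labeled := fun h' => (nb (hp.self_W h')).2 rfl
  have htx : t ∉ xs := fun h' =>
    (nb (hcV (H_subset_cell (Hbul_subset (hxs' _ h').1)))).2 rfl
  have hPold : ∀ x ∈ s.labeled, s'.P x = s.P x := by
    intro x hx
    have e : (s₁.labelAll xs fun x => s.P v ++ [b, t, .bud i] ++ s.R i x).P x = s₁.P x :=
      if_neg (hxl x hx)
    rw [hPfil, e, q2, Function.update_of_ne (nb (hp.self_W hx)).2, hid x hx]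
  have hPt : s'.P t = s.P v ++ [b, t] := by
    have e : (s₁.labelAll xs fun x => s.P v ++ [b, t, .bud i] ++ s.R i x).P t = s₁.P t :=
      if_neg htx
    rw [hPfil, e, q2, Function.update_self, List.filter_append, hid v hv]
    simp [hbD, htD]
  have hPx : ∀ x ∈ xs, s'.P x = s.P v ++ ([b, t] ++ (s.R i x).filter fun y => y ∉ D) := by
    intro x hx
    have e : (s₁.labelAll xs fun x => s.P v ++ [b, t, .bud i] ++ s.R i x).P x =
        s.P v ++ [b, t, .bud i] ++ s.R i x := if_pos hx
    rw [hPfil, e, List.filter_append, List.filter_append, hid v hv]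
    have hbi : Vtx.bud i ∈ D := hDiff.2 (Or.inl rfl)
    simp [hbD, htD, hbi]
  have hroute := fun x hx => h.route i hi (by rw [hsi]; simp) x (hxs' x hx).1
  have hsub : ∀ x ∈ xs, ∀ y ∈ [b, t] ++ (s.R i x).filter (fun y => y ∉ D),
      y ∈ s'.cell I s.next := by
    intro x hx y hy
    rw [List.mem_append, List.mem_filter] at hy
    rcases hy with hy | ⟨hy, hyD⟩
    · simp only [List.mem_cons, List.not_mem_nil, or_false] at hy
      rcases hy with rfl | rfl
      · exact hbc'
      · exact htc'
    · have hyD := of_decide_eq_true hyD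
      rw [hDiff, not_or] at hyD
      exact hcell.2 (Or.inr (Or.inr ⟨(hroute x hx).2.1 y hy, hyD.2⟩))
  have hmax : ∀ j, s'.IsMax j → j ≠ s.next → s.IsMax j ∧ j ≠ i := fun j hj hjn =>
    ((a.max_iff hf).1 hj).resolve_left hjn
  have hlab' : ∀ x ∈ s'.labeled, x ∉ s'.cell I s.next → x ∈ s.labeled := by
    intro x hx hxn
    rcases (hlab x).1 hx with hx | rfl | hx
    · exact hx
    · exact absurd htc' hxn
    · exact absurd (hxc x hx) hxn
  have hrho : s'.rho = Function.update s.rho b (some v) := by subst hs'; exact q3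
  refine ⟨hf', fun j hj => ?_, a.base_eq, ?_, fun x hx => ?_, a.max_new hf, ?_,
    fun _ => ⟨?_, (hlab t).2 (Or.inr (Or.inl rfl)), fun x hx => ?_⟩, fun j hj hjn => ?_,
    fun j hj hjn => ?_, fun j hj hjn F hF x hx hex => ?_, fun x hx hxn => ?_,
    fun x hx => (hlab x).2 (Or.inl hx), fun x hx y hy => ?_, fun j hj hjn hm => ?_, ?_⟩
  · have : s'.next = s.next + 1 := by subst hs'; exact q7
    rw [this]
    rcases a.mem_ids.1 hj with rfl | hj
    · exact Nat.lt_succ_self _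
    · exact (h.lt_next j hj.1).trans (Nat.lt_succ_self _)
  · have hr := ha.represents hH h.represents
    have hB3 : s'.Bs = symmDiff s₁.Bs D \ D := by subst hs'; rfl
    have hC : s'.C = C' := by subst hs'; rfl
    rw [hV', hB3, hC]
    rcases hbt1 with ⟨k1, k2⟩ | ⟨k1, k2⟩
    · exact hr.expand (a0.frame hf).Bs_subset k1 k2 (by simp) (by simp) hpiv
    · rw [hD, Finset.pair_comm] at hpiv ⊢
      exact hr.expand (a0.frame hf).Bs_subset k1 k2 (by simp) (by simp) hpiv
  · have : x ∈ s₁.queue ∨ x ∈ xs := by subst hs'; exact List.mem_append.1 hx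
    rw [q4] at this
    rw [hlab]
    exact this.imp (h.queue x) Or.inr
  · subst hs'; exact Function.update_self ..
  · rw [hrho, Function.update_self]; simp
  · rw [hlab]
    rw [mem_Hbul] at hx
    obtain ⟨hx1, hx2⟩ := hx
    rcases a.mem_H_new.1 hx1 with rfl | ⟨hxH, hxt⟩
    · exact Or.inr (Or.inl rfl)
    · refine Or.inr (Or.inr ((hxs x).2 (mem_Hbul.2 ⟨by rwa [hH1 i hne], ?_⟩)))
      refine hx2.imp_right ?_
      rintro ⟨-, y, hyV, hyH, hxy⟩
      refine ⟨hxt, ?_⟩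
      rw [hH1 i hne]
      have hyV' := hyV
      rw [hV', Finset.mem_sdiff, hDiff, not_or] at hyV'
      rw [a.mem_H_new] at hyH
      push Not at hyH
      have hyi : y ∉ s.H i := fun hyi => hyV'.2.2 (hyH.2 hyi)
      rcases hadj hxy (hf'.H_subset _ (a.mem_ids.2 (Or.inl rfl)) hx1) hyV with
        h' | h' | ⟨-, h' | h'⟩
      · exact ⟨y, hyV'.1, hyi, h'⟩
      · exact ⟨_, a0.Vstar_subset (hcV hbc), hf.bud_notMem hn, h'⟩
      · exact absurd h' hyV'.2.1
      · exfalso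
        rcases ha.adj_g hH h' with h'' | h''
        · rcases mem_cell.1 h'' with h3 | ⟨-, h3⟩
          · exact hyi h3
          · exact hyV'.2.1 h3
        · exact hyH.1 h''
  · obtain ⟨h1, h2⟩ := (a.mem_ids.1 hj).resolve_left hjn
    refine ⟨h1, a.H_old h1, ?_⟩
    subst hs'
    exact (Function.update_of_ne hjn _ _).trans (congrFun q6 j)
  · obtain ⟨h1, h2⟩ := hmax j hj hjn
    refine ⟨h1, a.cell_old h1.1 h2, a.normal_old h1.1 h2, ?_⟩
    subst hs'
    exact (Function.update_of_ne hjn _ _).trans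
      ((Function.update_of_ne hjn _ _).trans (congrFun q5 j))
  · obtain ⟨h1, h2⟩ := hmax j hj hjn
    obtain ⟨y, hyV, hyF, hxy⟩ := hex
    have hd := hf.cell_disjoint h1 hi h2
    have hFi : ∀ z ∈ s.cell I i, z ∉ F := fun z hz hzF =>
      Finset.disjoint_left.1 hd (hF hzF) hz
    have hxi : x ∉ s.cell I i := fun hxi => hFi x hxi hx
    have hxV := hf.cell_subset h1.1 (hF hx)
    have hxV' : x ∈ s'.Vstar I := by
      rw [a.mem_Vstar]
      refine Or.inl ⟨hxV, ?_, ?_⟩ <;> rintro rfl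
      · exact hxi hbc
      · exact hxi htc
    have key : ∀ z, s₁.Adj I x z → z ∉ F → s.Exits I F x := by
      intro z hxz hzF
      rcases ha.adj hH hxV hxi hxz with h' | h'
      · exact ⟨z, h'.1, hzF, h'.2⟩
      · exact ⟨_, hcV hbc, hFi _ hbc, h'⟩
    rcases hadj hxy hxV' hyV with h' | h' | ⟨h', -⟩
    · exact key y h' hyF
    · exact key _ h' (hFi _ hbc)
    · exact key _ h' (hFi _ htc)
  · have hxb : x ≠ b := by rintro rfl; exact hxn hbc'
    have hxt : x ≠ t := by rintro rfl; exact hxn htc'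
    refine ⟨?_, fun hsx => ((a.single_iff hf hx).1 hsx).1, fun hxl => hlab' x hxl hxn, ?_⟩
    · rcases a.mem_Vstar.1 hx with h' | h' | h'
      · exact h'.1
      · exact absurd h' hxb
      · exact absurd h' hxt
    · rw [hrho, Function.update_of_ne hxb]
  · rcases (hlab x).1 hx with hx | rfl | hx
    · exact Or.inr ⟨x, hx, by rwa [hPold x hx] at hy⟩
    · rw [hPt, List.mem_append] at hy
      refine hy.elim (fun hy => Or.inr ⟨v, hv, hy⟩) fun hy => Or.inl ?_
      simp only [List.mem_cons, List.not_mem_nil, or_false] at hy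
      rcases hy with rfl | rfl
      · exact hbc'
      · exact htc'
    · rw [hPx x hx, List.mem_append] at hy
      exact hy.elim (fun hy => Or.inr ⟨v, hv, hy⟩) fun hy => Or.inl (hsub x hx y hy)
  · obtain ⟨-, m2, -, -, m5⟩ := h.minus j (hmax j hj hjn).1 hm
    rwa [hPold _ m2]
  · have hVold : ∀ x ∈ s.labeled, ∀ y ∈ s.P x, y ∈ s'.Vstar I := by
      intro x hx y hy
      rw [a.mem_Vstar]
      refine Or.inl ⟨hp.mem_W x hx y hy, ?_, ?_⟩ <;> rintro rfl
      · exact hunt x hx _ hy hbc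
      · exact hunt x hx _ hy htc
    have hlc : ∀ x ∈ s.labeled, ∀ y ∈ s.P x, y ∉ s'.cell I s.next := fun x hx y hy hyc =>
      hunt x hx y hy (hcellS (hp.mem_W x hx y hy) hyc)
    have hcsub := hf'.cell_subset (i := s.next) (a.mem_ids.2 (Or.inl rfl))
    have hrev : ∀ {x}, x ∈ s'.Vstar I → x ∉ s'.cell I s.next →
        x ∈ s.Vstar I ∧ x ≠ .bud i ∧ x ≠ .tip i := by
      intro x hx hxc'
      rcases a.mem_Vstar.1 hx with h' | rfl | rfl
      · exact h'
      · exact absurd hbc' hxc'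
      · exact absurd htc' hxc'
    refine ⟨_, _, hp.merge_child (D := (· ∈ s'.cell I s.next)) (r := v) (pre := [b, t]) hv
      (hlc v hv) ⟨by simp [hb, ht], fun y hy => ?_⟩ (fun x y hx hy => a.Kset_eq_iff hf hx hy)
      (fun x y hx hy hx' hy' e hxc' => ?_) (fun x hx hxc' => (hrev hx hxc').1)
      (fun x hx => a.root_iff hf hx) (fun x hx => (hlab x).2 (Or.inl hx)) hlab' hVold
      (fun x hx hxc' => absurd hxc' (hlc x hx x (hp.self_mem hx))) (fun x hx _ => hPold x hx)
      (fun x hx ⟨y, hy, hyc⟩ => absurd hyc (hlc x hx y hy)) (fun x hx hxc' => ?_)⟩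
    · simp only [List.mem_cons, List.not_mem_nil, or_false] at hy
      rcases hy with rfl | rfl
      · exact ⟨hbc', hcsub hbc', fun h' => (nb h').1 rfl⟩
      · exact ⟨htc', hcsub htc', fun h' => (nb h').2 rfl⟩
    · have hxi := hcellS hx hxc'
      have hyi : y ∈ s.cell I i := by
        rw [← hf.Kset_of_cell hi hxi, e]; exact hf.mem_Kset_self y
      rcases a.mem_Vstar.1 hy' with h' | rfl | rfl
      · exact (a.mem_cell_iff hy h'.2.1 h'.2.2).2 hyi
      · exact hbc'
      · exact htc'
    · refine ⟨hcsub hxc', ?_⟩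
      have hnd : (s.P v ++ [b, t]).Nodup := by
        have := nodup_detour (A := s.P v) (pre := [b, t]) (q := [])
          (by rw [List.append_nil]; exact hp.nodup v hv) (by simp [hb, ht]) fun y hy hy' => by
            rw [List.append_nil] at hy'
            have := nb (hp.mem_W v hv y hy')
            simp only [List.mem_cons, List.not_mem_nil, or_false] at hy
            exact hy.elim this.1 this.2
        rwa [List.append_nil] at this
      rcases (hlab x).1 hx with hx | rfl | hx
      · exact absurd hxc' (hlc x hx x (hp.self_mem hx))
      · rw [hPt]
        refine ⟨hnd, by simp, [b, t], rfl, fun y hy => ?_⟩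
        simp only [List.mem_cons, List.not_mem_nil, or_false] at hy
        rcases hy with rfl | rfl
        · exact ⟨hcsub hbc', hbc'⟩
        · exact ⟨hcsub htc', htc'⟩
      · rw [hPx x hx]
        obtain ⟨r1, r2, r3, -⟩ := hroute x hx
        refine ⟨?_, ?_, _, rfl, fun y hy => ⟨hcsub (hsub x hx y hy), hsub x hx y hy⟩⟩
        · rw [← List.append_assoc, List.nodup_append]
          refine ⟨hnd, r1.filter _, ?_⟩
          rintro y hy z hz rfl
          have hyH := r2 y (List.mem_filter.1 hz).1
          simp only [List.mem_append, List.mem_cons, List.not_mem_nil, or_false] at hy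
          rcases hy with hy | hy
          · exact hunt v hv y hy (H_subset_cell hyH)
          · exact hy.elim (nb (hf.H_subset i hi.1 hyH)).1 (nb (hf.H_subset i hi.1 hyH)).2
        · refine getLast?_append_eq (getLast?_append_eq ?_)
          obtain ⟨l, e⟩ := List.getLast?_eq_some_iff.1 r3
          have hxD : x ∉ D := by
            rw [hDiff, not_or]
            refine ⟨?_, (hxs' x hx).2⟩
            rintro rfl
            exact hf.bud_notMem hn (Hbul_subset (hxs' _ hx).1)
          rw [e, List.filter_append]
          simp [hxD]

end SearchState

namespace SearchState

open Config

variable {I : ParityInstance K U V} {s s' : SearchState K V} {B₀ : Finset V}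

/-! ### The invariants hold in all states of the search -/

theorem SourcesLabeled.mono (h : SourcesLabeled I s) (hcfg : s'.toConfig = s.toConfig)
    (hl : ∀ x ∈ s.labeled, x ∈ s'.labeled) : SourcesLabeled I s' := by
  intro x hx hs
  rw [hcfg] at hx hs
  exact hl x (h x hx hs)

theorem SourceBlossomsLabeled.mono (h : SourceBlossomsLabeled I s)
    (hcfg : s'.toConfig = s.toConfig) (hs : ∀ i, s.sign i ≠ none → s'.sign i ≠ none) :
    SourceBlossomsLabeled I s' := by
  intro i hi hn
  rw [hcfg] at hi hn
  exact hs i (h i hi hn)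

/-- The invariants, depending on where the control of the procedure is. -/
def PhaseInvariant (I : ParityInstance K U V) (B₀ : Finset V) :
    Phase V × SearchState K V → Prop
  | (.step1a, s) => Invariant I B₀ s
  | (.step1b, s) => Invariant I B₀ s ∧ SourcesLabeled I s
  | (.step1c, s) => Invariant I B₀ s ∧ SourcesLabeled I s
  | (.step2, s) => Invariant I B₀ s ∧ SourcesLabeled I s ∧ SourceBlossomsLabeled I s
  | (.step3 v, s) =>
      Invariant I B₀ s ∧ SourcesLabeled I s ∧ SourceBlossomsLabeled I s ∧ v ∈ s.labeled
  | (.step4 v, s) =>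
      Invariant I B₀ s ∧ SourcesLabeled I s ∧ SourceBlossomsLabeled I s ∧ v ∈ s.labeled
  | (.returnEmpty, s) => Invariant I B₀ s ∧ SourcesLabeled I s ∧ SourceBlossomsLabeled I s
  | (.returnPath _, _) => True

theorem Merge.phaseInvariant {n : ℕ} {v : Vtx V} (m : Merge I s s' n) (h : Invariant I B₀ s)
    (hs : SourcesLabeled I s) (hb : SourceBlossomsLabeled I s) (hv : v ∈ s.labeled) :
    Invariant I B₀ s' ∧ SourcesLabeled I s' ∧ SourceBlossomsLabeled I s' ∧ v ∈ s'.labeled :=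
  ⟨m.invariant h, m.sourcesLabeled hs, m.sourceBlossomsLabeled hb, m.labeled_mono v hv⟩

theorem Step.phaseInvariant {a b : Phase V × SearchState K V} (h : Step I a b)
    (ha : PhaseInvariant I B₀ a) : PhaseInvariant I B₀ b := by
  have happ : ∀ (s : SearchState K V) (xs : List (Vtx V)), ∀ x ∈ s.labeled,
      x ∈ s.labeled ++ xs := fun s xs x hx => List.mem_append_left _ hx
  cases h with
  | labelSingle s x hx hs hl => exact Invariant.labelSingle ha hx hs hl
  | endStep1a s hs => exact ⟨ha, fun x hx hs' => hs x hx hs'⟩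
  | newSource s x hx hs hsb hadj =>
    have m := Invariant.newSource_merge ha.1 hx hs
    exact ⟨m.invariant ha.1, m.sourcesLabeled ha.2⟩
  | endStep1b s hs => exact ha
  | labelSource s i xs hi hsb hsi hl =>
    exact ⟨ha.1.labelSource hi hsb hsi hl, ha.2.mono rfl (happ s xs)⟩
  | endStep1c s hs =>
    exact ⟨ha.1, ha.2, fun i hi hn => hs i hi ((normal_or_source hi.1).resolve_left hn)⟩
  | queueEmpty s hq => exact ha
  | dequeue s v l hq =>
    obtain ⟨h, h1, h2⟩ := ha
    have hm : ∀ x ∈ v :: l, x ∈ s.labeled := fun x hx => h.queue x (hq ▸ hx)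
    exact ⟨⟨h.frame, h.lt_next, h.base_eq, h.represents, fun x hx => hm x (by simp [hx]),
      h.sign_mono, h.plus, h.minus, h.route, h.tip_closed, h.touched, h.single_rho,
      h.single_labeled, h.bud_rho, h.paths⟩, h1, h2, hm v (by simp)⟩
  | augmenting s v u _ _ _ => trivial
  | blossom s s' v u hu _ _ hb =>
    obtain ⟨h, h1, h2, h3⟩ := ha
    exact (hb.merge h h3 hu.1 hu.2.2).phaseInvariant h h1 h2 h3
  | endStep3 s v _ => exact ha
  | single s v u hu hs _ =>
    obtain ⟨h, h1, h2, h3⟩ := ha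
    exact ⟨h.growSingle h1 h3 hu hs, h1.mono rfl (happ s _), h2.mono rfl fun _ => id,
      happ s _ v h3⟩
  | singleBlossom s s' v u hu hs _ hb =>
    obtain ⟨h, h1, h2, h3⟩ := ha
    have h' := h.growSingle h1 h3 hu hs
    have hK : s.Kset I (I.bar u) = s.Kset I u := by
      have hsb := h.frame.single_bar (hu.2.1.adj.mem_right h.frame) hs
      rw [Kset_single hs, Kset_single hsb, bar_bar, Finset.pair_comm]
    refine (hb.merge h' (by simp [SearchState.growSingle, labelAll]) (happ s _ v h3)
      ?_).phaseInvariant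
      h' (h1.mono rfl (happ s _)) (h2.mono rfl fun _ => id) (happ s _ v h3)
    show s.Kset I v ≠ s.Kset I (I.bar u)
    rw [hK]; exact hu.2.2.1.symm
  | graft s s' v u i hu hi hn hui _ hg =>
    obtain ⟨h, h1, h2, h3⟩ := ha
    exact (hg.merge h h3 hi hn (h.sign_none_of_cand hu hi hn hui)).phaseInvariant h h1 h2 h3
  | growMinus s v u i y hu hi hn hui _ hy _ _ =>
    obtain ⟨h, h1, h2, h3⟩ := ha
    refine ⟨h.growBlossom h3 hu hi hn hui hy, h1.mono rfl (happ s _), h2.mono rfl fun j hj => ?_,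
      happ s _ v h3⟩
    by_cases e : j = i
    · subst e; simp [SearchState.growBlossom]
    · have : (s.growBlossom I v i y).sign j = s.sign j := Function.update_of_ne e _ _
      rwa [this]
  | endStep4 s v _ => exact ⟨ha.1, ha.2.1, ha.2.2.1⟩

theorem ReturnsEmpty.invariant {c : Config K V} (hc : c.Admissible I) (h : s.ReturnsEmpty I c) :
    Invariant I c.base s ∧ SourcesLabeled I s ∧ SourceBlossomsLabeled I s := by
  obtain ⟨s₀, h0, hr⟩ := h
  have : PhaseInvariant I c.base (.step1a, s₀) := h0.invariant hc
  have key : ∀ a, Relation.ReflTransGen (Step I) (.step1a, s₀) a → PhaseInvariant I c.base a := by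
    intro a ha
    induction ha with
    | refl => exact this
    | tail _ hs ih => exact hs.phaseInvariant ih
  exact key _ hr

end SearchState

/-! ### A perfect matching from a parity base -/

theorem even_card_of_involution {X : Type*} {Q : Finset X} (f : X → X) (h1 : ∀ x ∈ Q, f x ∈ Q)
    (h2 : ∀ x ∈ Q, f (f x) = x) (h3 : ∀ x ∈ Q, f x ≠ x) : Even Q.card := by
  have : ∑ _x ∈ Q, (1 : ZMod 2) = 0 :=
    Finset.sum_involution (fun x _ => f x) (fun _ _ => by decide) (fun x hx _ => h3 x hx)
      (fun x hx => h1 x hx) (fun x hx => h2 x hx)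
  rw [Finset.sum_const, nsmul_one] at this
  exact (ZMod.natCast_eq_zero_iff_even).1 this

/-- If the columns of `(1 C)` in `N` form a nonsingular matrix, then the bipartite graph of the
nonzero entries of `C` has a perfect matching between `B \ N` and `N \ B`. -/
theorem exists_matching {K X : Type*} [Field K] {W B N : Finset X} {C : X → X → K}
    (hN : N ⊆ W) (hcard : B.card = N.card)
    (hker : ∀ x : X → K, (∀ y, y ∉ N → x y = 0) → InKer W B C x → ∀ y, x y = 0) :
    ∃ m : X → X, ∀ y ∈ symmDiff B N,
      m y ∈ symmDiff B N ∧ m (m y) = y ∧ MatAdj W B C y (m y) := by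
  have hc : (N \ B).card = (B \ N).card := by
    have h1 := Finset.card_sdiff_add_card_inter B N
    have h2 := Finset.card_sdiff_add_card_inter N B
    rw [Finset.inter_comm] at h2
    omega
  let e : {x // x ∈ N \ B} ≃ {x // x ∈ B \ N} := Fintype.equivOfCardEq (by simpa using hc)
  let M : Matrix {x // x ∈ N \ B} {x // x ∈ N \ B} K := fun i j => C (e i) j
  have hdet : M.det ≠ 0 := by
    intro h0
    obtain ⟨y, hy0, hy⟩ := Matrix.exists_mulVec_eq_zero_iff.2 h0
    -- the vector `y` extends to a vector in the kernel of `(1 C)` with support in `N`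
    let z : X → K := fun v => if hv : v ∈ N \ B then y ⟨v, hv⟩ else 0
    have hz : ∀ u, ∑ v ∈ N \ B, C u v * z v = ∑ j : {x // x ∈ N \ B}, C u j * y j := by
      intro u
      rw [← Finset.sum_coe_sort (N \ B)]
      refine Finset.sum_congr rfl fun j _ => ?_
      simp only [z, j.2, dif_pos]
    let x : X → K := fun v =>
      if v ∈ B then (if v ∈ N then - ∑ w ∈ N \ B, C v w * z w else 0) else z v
    have hx1 : ∀ v, v ∉ N → x v = 0 := by
      intro v hv
      simp only [x, z, hv, if_false]
      split_ifs with h1 h2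
      · rfl
      · exact absurd (Finset.mem_sdiff.1 h2).1 hv
      · rfl
    have hx2 : InKer W B C x := by
      intro u hu
      have hs : ∑ v ∈ W \ B, C u v * x v = ∑ v ∈ N \ B, C u v * z v := by
        refine (Finset.sum_subset_zero_on_sdiff (Finset.sdiff_subset_sdiff hN subset_rfl)
          (fun v hv => ?_) (fun v hv => ?_)).symm
        · simp only [Finset.mem_sdiff, not_and, not_not] at hv
          have : z v = 0 := dif_neg fun h' => by
            rw [Finset.mem_sdiff] at h'; exact hv.1.2 (hv.2 h'.1)
          simp only [x, hv.1.2, if_false, this, mul_zero]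
        · simp only [x, (Finset.mem_sdiff.1 hv).2, if_false]
      rw [hs]
      by_cases huN : u ∈ N
      · simp only [x, hu, huN, if_true, neg_add_cancel]
      · have hu' : u ∈ B \ N := Finset.mem_sdiff.2 ⟨hu, huN⟩
        have := congrFun hy (e.symm ⟨u, hu'⟩)
        simp only [Matrix.mulVec, dotProduct, M, Equiv.apply_symm_apply, Pi.zero_apply] at this
        simp only [x, hu, huN, if_true, if_false, zero_add]
        rw [hz]; exact this
    refine hy0 (funext fun j => ?_)
    have e : x j = y j := (if_neg (Finset.mem_sdiff.1 j.2).2).trans (dif_pos j.2)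
    rw [← e]; exact hker x hx1 hx2 j
  rw [Matrix.det_apply] at hdet
  obtain ⟨σ, -, hσ⟩ := Finset.exists_ne_zero_of_sum_ne_zero hdet
  have hσ' : ∀ i, C (e (σ i)) i ≠ 0 := fun i h0 => hσ (by
    rw [Finset.prod_eq_zero (Finset.mem_univ i) h0, smul_zero])
  let τ := σ.trans e
  have hτ : ∀ i, C (τ i) i ≠ 0 := hσ'
  refine ⟨fun y => if hy : y ∈ N \ B then τ ⟨y, hy⟩
    else if hy : y ∈ B \ N then τ.symm ⟨y, hy⟩ else y, fun y hy => ?_⟩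
  have hdisj : ∀ z, z ∈ B \ N → z ∉ N \ B := fun z hz hz' =>
    (Finset.mem_sdiff.1 hz).2 (Finset.mem_sdiff.1 hz').1
  by_cases hy1 : y ∈ N \ B
  · have h2 := (τ ⟨y, hy1⟩).2
    simp only [dif_pos hy1, dif_neg (hdisj _ h2), dif_pos h2]
    refine ⟨Finset.mem_symmDiff.2 (Or.inl (Finset.mem_sdiff.1 h2)), by simp, Or.inr
      ⟨(Finset.mem_sdiff.1 h2).1, Finset.sdiff_subset_sdiff hN subset_rfl hy1, hτ ⟨y, hy1⟩⟩⟩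
  · have hy2 : y ∈ B \ N := by
      rw [Finset.mem_symmDiff] at hy
      exact Finset.mem_sdiff.2 (hy.resolve_right fun h' => hy1 (Finset.mem_sdiff.2 h'))
    have h2 := (τ.symm ⟨y, hy2⟩).2
    simp only [dif_neg hy1, dif_pos hy2, dif_pos h2]
    refine ⟨Finset.mem_symmDiff.2 (Or.inr (Finset.mem_sdiff.1 h2)), by simp, Or.inl
      ⟨(Finset.mem_sdiff.1 hy2).1, Finset.sdiff_subset_sdiff hN subset_rfl h2, ?_⟩⟩
    have := hτ (τ.symm ⟨y, hy2⟩)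
    rwa [Equiv.apply_symm_apply] at this

namespace SearchState

open Config

variable {I : ParityInstance K U V} {s : SearchState K V} {B₀ : Finset V}

theorem _root_.MatroidParity.ParityInstance.IsBase.card_eq {B B' : Finset V} (h : I.IsBase B)
    (h' : I.IsBase B') : B.card = B'.card := by
  have key : ∀ {B : Finset V}, I.IsBase B →
      Submodule.span K (I.A.col '' (B : Set V)) = Submodule.span K (Set.range I.A.col) := by
    intro B h
    refine le_antisymm (Submodule.span_mono (Set.image_subset_range _ _))
      (Submodule.span_le.2 ?_)
    rintro _ ⟨v, rfl⟩
    by_contra hv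
    have hvB : v ∉ B := fun hvB => hv (Submodule.subset_span ⟨v, hvB, rfl⟩)
    have hi : LinearIndepOn K I.A.col ((insert v B : Finset V) : Set V) := by
      rw [Finset.coe_insert]
      exact (linearIndepOn_insert (by simpa using hvB)).2 ⟨h.1, hv⟩
    exact hvB (h.2 hi (Finset.subset_insert v B) (Finset.mem_insert_self v B))
  have hr : ∀ {B : Finset V}, I.IsBase B →
      Module.finrank K (Submodule.span K (I.A.col '' (B : Set V))) = B.card := by
    intro B h
    have := finrank_span_eq_card (R := K) (b := fun v : B => I.A.col v) h.1
    rw [Fintype.card_coe] at this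
    have e : I.A.col '' (B : Set V) = Set.range fun v : B => I.A.col v := by ext; simp
    rw [e, this]
  rw [← hr h, ← hr h', key h, key h']

/-- A base `B'` gives a perfect matching of `F*` on `(B △ B') ∪ T`: a vector in the kernel of
`(1 C*)` that is supported on `B'` and the buds and tips outside of `B*` gives a linear relation
between the columns in `B'`, and hence vanishes. -/
theorem Invariant.exists_matching (h : Invariant I B₀ s) (hB₀ : I.IsBase B₀) {B' : Finset V}
    (hB' : I.IsBase B') : ∃ m : Vtx V → Vtx V, ∃ W : Finset (Vtx V), W ⊆ s.Vstar I ∧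
      (∀ v, .orig v ∈ W ↔ ¬ (v ∈ s.base ↔ v ∈ B')) ∧ s.T I ⊆ W ∧
      ∀ x ∈ W, m x ∈ W ∧ m (m x) = x ∧ s.Adj I x (m x) := by
  have hf := h.frame
  set N : Finset (Vtx V) := B'.image .orig ∪ (s.T I \ s.Bs) with hNdef
  have hBs : s.Bs = s.base.image .orig ∪ (s.T I ∩ s.Bs) := by
    ext x
    rw [Finset.mem_union, Finset.mem_inter, mem_T]
    cases x with
    | orig v => simp [base]
    | bud i =>
      refine ⟨fun hx => Or.inr ⟨⟨hf.Bs_subset hx, by simp⟩, hx⟩, fun hx => ?_⟩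
      rcases hx with hx | hx
      · simp at hx
      · exact hx.2
    | tip i =>
      refine ⟨fun hx => Or.inr ⟨⟨hf.Bs_subset hx, by simp⟩, hx⟩, fun hx => ?_⟩
      rcases hx with hx | hx
      · simp at hx
      · exact hx.2
  have hTo : ∀ (A : Finset V) (D : Finset (Vtx V)), D ⊆ s.T I → Disjoint (A.image .orig) D := by
    intro A D hD
    rw [Finset.disjoint_left]
    intro x hx hxD
    obtain ⟨v, -, rfl⟩ := Finset.mem_image.1 hx
    exact (mem_T.1 (hD hxD)).2 v rfl
  have horig : Function.Injective (Vtx.orig : V → Vtx V) := fun _ _ h => by simpa using h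
  have hTcard : (s.T I ∩ s.Bs).card = (s.T I \ s.Bs).card := by
    have hbt : ∀ x ∈ s.T I, (I.bar x ∈ s.T I ∧ (I.bar x ∈ s.Bs ↔ x ∉ s.Bs)) := by
      intro x hx
      have hxV := (mem_T.1 hx).1
      have hbV := bar_mem_Vstar.2 hxV
      cases x with
      | orig v => exact absurd rfl ((mem_T.1 hx).2 v)
      | bud i =>
        have := hf.bud_tip i (bud_mem_Vstar.1 hxV)
        refine ⟨mem_T.2 ⟨hbV, by simp [ParityInstance.bar]⟩, ?_⟩
        simp only [ParityInstance.bar]; tauto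
      | tip i =>
        have := hf.bud_tip i (tip_mem_Vstar.1 hxV)
        refine ⟨mem_T.2 ⟨hbV, by simp [ParityInstance.bar]⟩, ?_⟩
        simp only [ParityInstance.bar]; tauto
    refine Finset.card_bij (fun x _ => I.bar x) (fun x hx => ?_)
      (fun x _ y _ e => bar_injective e) (fun x hx => ⟨I.bar x, ?_, bar_bar x⟩)
    · rw [Finset.mem_inter] at hx
      have := hbt x hx.1
      rw [Finset.mem_sdiff]; tauto
    · rw [Finset.mem_sdiff] at hx
      have := hbt x hx.1
      rw [Finset.mem_inter]; tauto
  have hNV : N ⊆ s.Vstar I := by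
    intro x hx
    rcases Finset.mem_union.1 hx with hx | hx
    · obtain ⟨v, -, rfl⟩ := Finset.mem_image.1 hx; simp
    · exact (mem_T.1 (Finset.mem_sdiff.1 hx).1).1
  have hbc := h.base_eq
  have hcard : s.Bs.card = N.card := by
    rw [hBs, Finset.card_union_of_disjoint (hTo _ _ Finset.inter_subset_left),
      Finset.card_union_of_disjoint (hTo _ _ Finset.sdiff_subset), hTcard,
      Finset.card_image_of_injective _ horig, Finset.card_image_of_injective _ horig, hbc,
      hB₀.card_eq hB']
  obtain ⟨m, hm⟩ := MatroidParity.exists_matching (W := s.Vstar I) (C := s.C) hNV hcard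
    fun x hx hk => by
      obtain ⟨h1, h2⟩ := h.represents x hk fun y hy hyo => hx y fun hyN => by
        rcases Finset.mem_union.1 hyN with hyN | hyN
        · obtain ⟨v, -, rfl⟩ := Finset.mem_image.1 hyN; exact hyo v rfl
        · exact (Finset.mem_sdiff.1 hyN).2 hy
      have hout : ∀ v, v ∉ B' → x (.orig v) = 0 := fun v hv => hx _ fun hyN => by
        rcases Finset.mem_union.1 hyN with hyN | hyN
        · simp [hv] at hyN
        · exact (mem_T.1 (Finset.mem_sdiff.1 hyN).1).2 v rfl
      have hV : ∀ v, x (.orig v) = 0 := by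
        intro v
        by_cases hv : v ∈ B'
        · refine linearIndepOn_finset_iff.1 hB'.1 (fun v => x (.orig v)) ?_ v hv
          ext i
          rw [Finset.sum_apply, Pi.zero_apply, ← h1 i]
          refine Finset.sum_subset_zero_on_sdiff (Finset.subset_univ _) (fun v hv => ?_)
            (fun v _ => ?_)
          · rw [hout v (Finset.mem_sdiff.1 hv).2, mul_zero]
          · simp [Matrix.col, mul_comm]
        · exact hout v hv
      intro y
      by_cases hy : y ∈ s.Vstar I
      · exact h2 hV y hy
      · exact hx y fun hyN => hy (hNV hyN)
  refine ⟨m, symmDiff s.Bs N, ?_, fun v => ?_, fun x hx => ?_, fun x hx => hm x hx⟩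
  · intro x hx
    rcases Finset.mem_symmDiff.1 hx with hx | hx
    · exact hf.Bs_subset hx.1
    · exact hNV hx.1
  · have h1 : (.orig v ∈ N) ↔ v ∈ B' := by
      rw [hNdef, Finset.mem_union]
      have : Vtx.orig v ∉ s.T I := fun h' => (mem_T.1 h').2 v rfl
      simp [this]
    have h2 : .orig v ∈ s.Bs ↔ v ∈ s.base := by simp [base]
    rw [Finset.mem_symmDiff, h1, h2]; tauto
  · have h1 : x ∈ N ↔ x ∉ s.Bs := by
      rw [hNdef, Finset.mem_union, Finset.mem_sdiff]
      have : x ∉ B'.image Vtx.orig := fun h' => by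
        obtain ⟨v, -, rfl⟩ := Finset.mem_image.1 h'
        exact (mem_T.1 hx).2 v rfl
      simp [this, hx]
    rw [Finset.mem_symmDiff, h1]; tauto

end SearchState

namespace SearchState

open Config

variable {I : ParityInstance K U V} {s : SearchState K V} {B₀ : Finset V}

/-! ### The barrier -/

/-- If the step size is infinite, then edges leave an explored node only to the unlabeled vertices
that have been examined. -/
structure Closed (I : ParityInstance K U V) (s : SearchState K V) : Prop where
  inner : ∀ x y, s.Adj I x y → x ∈ s.Rplus I ∪ s.Zplus → y ∈ s.Rplus I ∪ s.Zplus →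
    s.Kset I y = s.Kset I x
  outer : ∀ x y, s.Adj I x y → x ∈ s.Rplus I ∪ s.Zplus → y ∉ s.Y I
  minus : ∀ i, s.IsMax i → s.sign i ≠ some .minus

theorem closed_of_eps (h : s.eps I = ⊤) : s.Closed I := by
  unfold eps at h
  rw [min_eq_top, min_eq_top, min_eq_top] at h
  obtain ⟨⟨h1, h2⟩, h3, h4⟩ := h
  refine ⟨fun x y hxy hx hy => ?_, fun x y hxy hx hy => ?_, fun i hi hm => ?_⟩
  · by_contra hne
    rcases hxy with hxy | hxy
    · exact EReal.coe_ne_top _ (sInf_eq_top.1 h1 _ ⟨(x, y), hxy, hx, hy, fun e => hne e.symm, rfl⟩)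
    · exact EReal.coe_ne_top _ (sInf_eq_top.1 h1 _ ⟨(y, x), hxy, hy, hx, hne, rfl⟩)
  · rcases hxy with hxy | hxy
    · exact EReal.coe_ne_top _ (sInf_eq_top.1 h2 _ ⟨(x, y), hxy, hx, hy, rfl⟩)
    · exact EReal.coe_ne_top _ (sInf_eq_top.1 h3 _ ⟨(y, x), hxy, hy, hx, rfl⟩)
  · exact EReal.coe_ne_top _ (sInf_eq_top.1 h4 _ ⟨i, hi, hm, rfl⟩)

/-- The barrier: the vertices that have been examined but not labeled, which are the buds of the
maximal normal blossoms labeled `⊕`, and single vertices with a labeled mate. -/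
def Barrier (I : ParityInstance K U V) (s : SearchState K V) (x : Vtx V) : Prop :=
  (s.Single I x ∧ x ∉ s.labeled ∧ I.bar x ∈ s.labeled) ∨
    ∃ i, s.IsMax i ∧ s.IsNormal I i ∧ s.sign i = some .plus ∧ x = .bud i

theorem Closed.sign_max_plus (hc : s.Closed I) {i : ℕ}
    (hi : s.IsMax i) (hs : s.sign i ≠ none) : s.sign i = some .plus := by
  rcases e : s.sign i with - | _ | _
  · exact absurd e hs
  · rfl
  · exact absurd e (hc.minus i hi)

/-- Edges leave an explored node only to the barrier. -/
theorem Invariant.barrier_of_adj (h : Invariant I B₀ s) (hc : s.Closed I) {x y : Vtx V}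
    (hxy : s.Adj I x y) (hx : x ∈ s.Rplus I ∪ s.Zplus) :
    s.Barrier I y ∨ s.Kset I y = s.Kset I x := by
  have hf := h.frame
  have hyV := hxy.mem_right hf
  have hY := hc.outer x y hxy hx
  by_cases hZ : y ∈ s.Z
  · obtain ⟨i, hi, hs, hyi⟩ := hZ
    obtain ⟨m, hm, him⟩ := exists_max hi
    have hsm : s.sign m ≠ none := by
      rcases him.eq_or_ssubset with e | hlt
      · by_cases e' : i = m
        · exact e' ▸ hs
        · exfalso
          obtain ⟨z, hz⟩ := hf.H_nonempty hi
          rcases hf.laminar i hi m hm.1 e' with h' | h' | h'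
          · exact Finset.disjoint_left.1 h' hz (him hz)
          · exact h'.2 e.symm.subset
          · exact h'.2 e.subset
      · exact h.sign_mono i hi m hm.1 hlt hs
    exact Or.inr (hc.inner x y hxy hx (Or.inr ⟨m, hm, hc.sign_max_plus hm hsm, him hyi⟩))
  · have hR : y ∈ s.Reached I := by
      by_contra hR; exact hY ⟨hyV, hR, hZ⟩
    by_cases hyl : y ∈ s.labeled
    · exact Or.inr (hc.inner x y hxy hx (Or.inl ⟨hR, hyl⟩))
    · have hrho := hR.2.1.resolve_left hyl
      left
      rcases single_or (I := I) (c := s.toConfig) (x := y) with hsy | ⟨i, hi, hyi⟩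
      · exact Or.inl ⟨hsy, hyl, h.single_rho y hyV hsy hrho⟩
      · rcases mem_cell.1 hyi with hyi | ⟨hn, rfl⟩
        · exact absurd hyi (hR.2.2 i hi.1)
        · exact Or.inr ⟨i, hi, hn, hc.sign_max_plus hi (h.bud_rho i hi hn hrho), rfl⟩

/-- Representatives of the odd components: a labeled single vertex whose mate is not labeled or
which is a source vertex, the tip of a maximal normal blossom labeled `⊕`, or a source vertex in a
maximal source blossom. -/
def OddRep (I : ParityInstance K U V) (s : SearchState K V) (x : Vtx V) : Prop :=
  (s.Single I x ∧ x ∈ s.labeled ∧ (s.IsSource I x ∨ I.bar x ∉ s.labeled)) ∨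
  (∃ i, s.IsMax i ∧ s.IsNormal I i ∧ s.sign i = some .plus ∧ x = .tip i) ∨
  ∃ i, s.IsMax i ∧ ¬ s.IsNormal I i ∧ x ∈ s.H i ∧ s.IsSource I x

/-- A vertex set that contains both or none of the vertices of every normal line and every dummy
line, and one vertex of every source line. -/
structure ParitySet (I : ParityInstance K U V) (s : SearchState K V) (W : Finset (Vtx V)) :
    Prop where
  subset : W ⊆ s.Vstar I
  bar_mem : ∀ x ∈ W, ¬ s.IsSource I x → I.bar x ∈ W
  source : ∀ x, s.IsSource I x → (x ∈ W ↔ I.bar x ∉ W)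

variable {W : Finset (Vtx V)}

/-- A matching edge leaves every blossom: exactly one of the vertices of `W` in the blossom has its
mate outside of it, namely the tip or the source vertex `x₀`, so the number of these vertices is
odd. -/
theorem ParitySet.exists_leaving (hW : ParitySet I s W) (hf : s.Frame I) {i : ℕ} (hi : i ∈ s.ids)
    {x₀ : Vtx V} (hx₀ : x₀ ∈ W) (hx₀i : x₀ ∈ s.H i)
    (h0 : (s.IsNormal I i ∧ x₀ = .tip i) ∨ (¬ s.IsNormal I i ∧ s.IsSource I x₀))
    {m : Vtx V → Vtx V} (hm : ∀ x ∈ W, m x ∈ W ∧ m (m x) = x ∧ m x ≠ x) :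
    ∃ x ∈ W, x ∈ s.H i ∧ m x ∉ s.H i := by
  by_contra hcon
  push Not at hcon
  have hQ : ∀ {x}, x ∈ s.H i ∩ W ↔ x ∈ s.H i ∧ x ∈ W := Finset.mem_inter
  have h1 : Even (s.H i ∩ W).card :=
    even_card_of_involution m
      (fun x hx => hQ.2 ⟨hcon x (hQ.1 hx).2 (hQ.1 hx).1, (hm x (hQ.1 hx).2).1⟩)
      (fun x hx => (hm x (hQ.1 hx).2).2.1) fun x hx => (hm x (hQ.1 hx).2).2.2
  have hj : ∀ j, s.IsNormal I j → Vtx.tip j ≠ x₀ → (.tip j ∈ s.H i ↔ .bud j ∈ s.H i) := by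
    intro j hn hne
    rw [hf.tip_mem i hi j hn, hf.bud_mem i hi j hn]
    refine ⟨fun hsub => ?_, fun h' => h'.1⟩
    have hji : j ≠ i := by
      rintro rfl
      rcases h0 with ⟨-, e⟩ | ⟨hn', -⟩
      · exact hne e.symm
      · exact hn' hn
    obtain ⟨z, hz⟩ := hf.H_nonempty hn.1
    rcases hf.laminar j hn.1 i hi hji with h' | h' | h'
    · exact absurd (hsub hz) (Finset.disjoint_left.1 h' hz)
    · exact h'
    · exact absurd hsub h'.2
  have h2 : Even ((s.H i ∩ W).erase x₀).card := by
    refine even_card_of_involution I.bar (fun x hx => ?_) (fun x _ => bar_bar x)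
      fun x _ => bar_ne x
    rw [Finset.mem_erase, hQ] at hx
    obtain ⟨hne, hxi, hxW⟩ := hx
    have hns : ¬ s.IsSource I x := by
      intro hsx
      rcases h0 with ⟨hn, -⟩ | ⟨-, hs⟩
      · exact hn.2 ⟨x, hxi, hsx⟩
      · rcases hf.one_source i hi x₀ hx₀i x hxi hs hsx with e | e
        · exact hne e
        · exact (hW.source x₀ hs).1 hx₀ (e ▸ hxW)
    rw [Finset.mem_erase, hQ]
    refine ⟨?_, ?_, hW.bar_mem x hxW hns⟩
    · intro e
      rcases h0 with ⟨hn, e'⟩ | ⟨-, hs⟩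
      · have : x = .bud i := by rw [← bar_bar (I := I) x, e, e']; rfl
        exact hf.bud_notMem hn (this ▸ hxi)
      · exact hns (by rw [← bar_bar (I := I) x, e]; exact hs.bar)
    · have hxV := hf.H_subset i hi hxi
      cases x with
      | orig v => exact hf.lines i hi v hxi
      | bud j =>
        refine (hj j (bud_mem_Vstar.1 hxV) fun e => ?_).2 hxi
        rcases h0 with ⟨hn, e'⟩ | ⟨-, v, hv, -⟩
        · rw [e'] at e
          obtain rfl : j = i := by simpa using e
          exact hf.bud_notMem hn hxi
        · rw [hv] at e; cases e
      | tip j => exact (hj j (tip_mem_Vstar.1 hxV) hne).1 hxi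
  rw [Finset.card_erase_of_mem (hQ.2 ⟨hx₀i, hx₀⟩)] at h2
  have h3 : 0 < (s.H i ∩ W).card := Finset.card_pos.2 ⟨x₀, hQ.2 ⟨hx₀i, hx₀⟩⟩
  rcases h1 with ⟨a, ha⟩
  rcases h2 with ⟨b, hb⟩
  omega

/-- A matching edge leads from every odd component to the barrier. -/
theorem Invariant.exists_barrier (h : Invariant I B₀ s) (hb : SourceBlossomsLabeled I s)
    (hc : s.Closed I) (hW : ParitySet I s W) {m : Vtx V → Vtx V}
    (hm : ∀ x ∈ W, m x ∈ W ∧ m (m x) = x ∧ s.Adj I x (m x)) {j : Vtx V} (hjW : j ∈ W)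
    (hj : s.OddRep I j) : ∃ x ∈ W, s.Kset I x = s.Kset I j ∧ s.Barrier I (m x) := by
  have hf := h.frame
  have blossom : ∀ i, s.IsMax i → s.sign i = some .plus → j ∈ s.H i →
      ((s.IsNormal I i ∧ j = .tip i) ∨ (¬ s.IsNormal I i ∧ s.IsSource I j)) →
      ∃ x ∈ W, s.Kset I x = s.Kset I j ∧ s.Barrier I (m x) := by
    intro i hi hs hji h0
    obtain ⟨x, hxW, hxi, hmx⟩ := hW.exists_leaving hf hi.1 hjW hji h0 (m := m)
      fun x hx => ⟨(hm x hx).1, (hm x hx).2.1, (hm x hx).2.2.ne.symm⟩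
    have hxc := H_subset_cell (I := I) hxi
    refine ⟨x, hxW, ?_, ?_⟩
    · rw [hf.Kset_of_cell hi hxc, hf.Kset_of_cell hi (H_subset_cell hji)]
    · rcases h.barrier_of_adj hc (hm x hxW).2.2 (Or.inr ⟨i, hi, hs, hxi⟩) with h' | h'
      · exact h'
      · have : m x ∈ s.cell I i := by
          rw [← hf.Kset_of_cell hi hxc, ← h']; exact hf.mem_Kset_self _
        obtain ⟨hn, e⟩ := (mem_cell.1 this).resolve_left hmx
        exact Or.inr ⟨i, hi, hn, hs, e⟩
  rcases hj with ⟨hsj, hjl, hj'⟩ | ⟨i, hi, hn, hs, rfl⟩ | ⟨i, hi, hn, hji, hsj⟩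
  · refine ⟨j, hjW, rfl, ?_⟩
    have hjV := hW.subset hjW
    have hjR : j ∈ s.Rplus I := ⟨⟨hjV, Or.inl hjl, fun i hi hji => by
      obtain ⟨k, hk, hik⟩ := exists_max hi
      exact hsj k hk (H_subset_cell (hik hji))⟩, hjl⟩
    obtain ⟨m1, m2, m3⟩ := hm j hjW
    rcases h.barrier_of_adj hc m3 (Or.inl hjR) with h' | h'
    · exact h'
    · have e := (hf.single_of_Kset_eq hsj h').resolve_left m3.ne.symm
      rw [e] at m1 ⊢
      have hjb : I.bar j ∉ s.labeled := hj'.resolve_left fun hs => (hW.source j hs).1 hjW m1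
      exact Or.inl ⟨hf.single_bar hjV hsj, hjb, by rwa [bar_bar]⟩
  · exact blossom i hi hs (hf.tip_self hn) (Or.inl ⟨hn, rfl⟩)
  · exact blossom i hi (hc.sign_max_plus hi (hb i hi hn)) hji (Or.inr ⟨hn, hsj⟩)

/-- Different representatives lie in different components. -/
theorem OddRep.eq_of_Kset_eq (hf : s.Frame I) (hW : ParitySet I s W) {j k : Vtx V}
    (hj : s.OddRep I j) (hk : s.OddRep I k) (hjW : j ∈ W) (hkW : k ∈ W)
    (e : s.Kset I j = s.Kset I k) : j = k := by
  have single : ∀ j k, (s.Single I j ∧ j ∈ s.labeled ∧ (s.IsSource I j ∨ I.bar j ∉ s.labeled)) →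
      s.OddRep I k → j ∈ W → k ∈ W → s.Kset I j = s.Kset I k → j = k := by
    rintro j k ⟨h1, h2, h3⟩ hk hjW hkW e
    rcases hf.single_of_Kset_eq h1 e.symm with e' | e'
    · exact e'.symm
    · exfalso
      have hsk := hf.single_bar (hW.subset hjW) h1
      rw [← e'] at hsk
      rcases hk with ⟨-, k2, -⟩ | ⟨i, hi, hn, -, rfl⟩ | ⟨i, hi, -, hki, -⟩
      · rcases h3 with h3 | h3
        · exact (hW.source j h3).1 hjW (e' ▸ hkW)
        · exact h3 (e' ▸ k2)
      · exact hsk i hi (H_subset_cell (hf.tip_self hn))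
      · exact hsk i hi (H_subset_cell hki)
  have idx : ∀ i i', s.IsMax i → s.IsMax i' → j ∈ s.H i → k ∈ s.H i' → i = i' := by
    intro i i' hi hi' hji hki
    refine hf.eq_of_mem_cell hi hi' (H_subset_cell hji) ?_
    rw [← hf.Kset_of_cell hi' (H_subset_cell hki), ← e]
    exact hf.mem_Kset_self j
  rcases hj with hj' | hj'
  · exact single j k hj' hk hjW hkW e
  · rcases hk with hk' | hk'
    · exact (single k j hk' (Or.inr hj') hkW hjW e.symm).symm
    · rcases hj' with ⟨i, hi, hn, -, rfl⟩ | ⟨i, hi, hn, hji, hsj⟩ <;>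
        rcases hk' with ⟨i', hi', hn', -, rfl⟩ | ⟨i', hi', hn', hki, hsk⟩
      · rw [idx i i' hi hi' (hf.tip_self hn) (hf.tip_self hn')]
      · exact absurd (idx i i' hi hi' (hf.tip_self hn) hki ▸ hn) hn'
      · exact absurd (idx i i' hi hi' hji (hf.tip_self hn') ▸ hn') hn
      · have := idx i i' hi hi' hji hki
        subst this
        rcases hf.one_source i hi.1 j hji k hki hsj hsk with e' | e'
        · exact e'.symm
        · exact absurd hkW (e' ▸ (hW.source j hsj).1 hjW)

/-- There are more odd components than vertices in the barrier, since the mates of the vertices in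
the barrier represent different odd components without source lines. -/
theorem Invariant.no_perfect_matching (h : Invariant I B₀ s) (hl : SourcesLabeled I s)
    (hb : SourceBlossomsLabeled I s) (hc : s.Closed I) (hW : ParitySet I s W)
    (hsource : ∃ x, s.IsSource I x) :
    ¬ ∃ m : Vtx V → Vtx V, ∀ x ∈ W, m x ∈ W ∧ m (m x) = x ∧ s.Adj I x (m x) := by
  rintro ⟨m, hm⟩
  have hf := h.frame
  set J := W.filter (s.OddRep I) with hJ
  set β := W.filter (s.Barrier I) with hβ
  have hJβ : J.card ≤ β.card := by
    have hex := fun j (hj : j ∈ J) => h.exists_barrier hb hc hW hm (Finset.mem_filter.1 hj).1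
      (Finset.mem_filter.1 hj).2
    choose! f hf1 hf2 hf3 using hex
    -- `f j` is a vertex in the component of `j` that is matched to the barrier
    refine Finset.card_le_card_of_injOn (fun j => m (f j)) (fun j hj => ?_)
      fun j hj k hk e => ?_
    · exact Finset.mem_filter.2 ⟨(hm _ (hf1 j hj)).1, hf3 j hj⟩
    · have e : m (f j) = m (f k) := e
      have e' : f j = f k := by
        rw [← (hm _ (hf1 j hj)).2.1, e, (hm _ (hf1 k hk)).2.1]
      have hj' := Finset.mem_filter.1 (Finset.mem_coe.1 hj)
      have hk' := Finset.mem_filter.1 (Finset.mem_coe.1 hk)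
      exact hj'.2.eq_of_Kset_eq hf hW hk'.2 hj'.1 hk'.1 (by rw [← hf2 j hj, e', hf2 k hk])
  have hns : ∀ x ∈ β, ¬ s.IsSource I x := by
    intro x hx hsx
    rcases (Finset.mem_filter.1 hx).2 with ⟨h1, h2, -⟩ | ⟨i, -, -, -, rfl⟩
    · exact h2 (hl x hsx h1)
    · obtain ⟨v, hv, -⟩ := hsx; cases hv
  obtain ⟨x, hxs⟩ := hsource
  -- the source vertex `y` represents a component that is not the mate of a barrier vertex
  obtain ⟨y, hys, hyW⟩ : ∃ y, s.IsSource I y ∧ y ∈ W := by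
    by_cases hx : x ∈ W
    · exact ⟨x, hxs, hx⟩
    · exact ⟨_, hxs.bar, (hW.source _ hxs.bar).2 (by rwa [bar_bar])⟩
  have hyJ : y ∈ J := by
    refine Finset.mem_filter.2 ⟨hyW, ?_⟩
    rcases single_or (I := I) (c := s.toConfig) (x := y) with hsy | ⟨i, hi, hyi⟩
    · exact Or.inl ⟨hsy, hl y hys hsy, Or.inl hys⟩
    · rcases mem_cell.1 hyi with hyi | ⟨-, rfl⟩
      · exact Or.inr (Or.inr ⟨i, hi, fun hn => hn.2 ⟨y, hyi, hys⟩, hyi, hys⟩)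
      · obtain ⟨v, hv, -⟩ := hys; cases hv
  have hβJ : (β.image I.bar).card < J.card := by
    refine Finset.card_lt_card ⟨fun z hz => ?_, fun hsub => ?_⟩
    · obtain ⟨x, hx, rfl⟩ := Finset.mem_image.1 hz
      have hxW := (Finset.mem_filter.1 hx).1
      refine Finset.mem_filter.2 ⟨hW.bar_mem x hxW (hns x hx), ?_⟩
      rcases (Finset.mem_filter.1 hx).2 with ⟨h1, h2, h3⟩ | ⟨i, hi, hn, hs, rfl⟩
      · exact Or.inl ⟨hf.single_bar (hW.subset hxW) h1, h3, Or.inr (by rwa [bar_bar])⟩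
      · exact Or.inr (Or.inl ⟨i, hi, hn, hs, rfl⟩)
    · obtain ⟨x, hx, e⟩ := Finset.mem_image.1 (hsub hyJ)
      refine hns x hx ?_
      rw [← bar_bar (I := I) x, e]; exact hys.bar
  rw [Finset.card_image_of_injective _ bar_injective] at hβJ
  omega

/-- The set `(B △ B') ∪ T` for a parity base `B'`. -/
theorem paritySet_of_isParityBase {B' : Finset V} (hB' : I.IsParityBase B')
    (hV : W ⊆ s.Vstar I) (hW : ∀ v, .orig v ∈ W ↔ ¬ (v ∈ s.base ↔ v ∈ B')) (hT : s.T I ⊆ W) :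
    ParitySet I s W := by
  have hpar : ∀ v, I.mate v ∈ B' ↔ v ∈ B' := fun v =>
    ⟨fun hv => by have := hB'.2 _ hv; rwa [I.mate_mate] at this, hB'.2 v⟩
  refine ⟨hV, fun x hx hns => ?_, fun x hx => ?_⟩
  · have hxV := bar_mem_Vstar.2 (hV hx)
    cases x with
    | orig v =>
      have hns : v ∈ s.base ↔ I.mate v ∈ s.base := by
        by_contra h'; exact hns ⟨v, rfl, h'⟩
      have := hpar v
      change Vtx.orig (I.mate v) ∈ W
      rw [hW] at hx ⊢
      tauto
    | bud i => exact hT (mem_T.2 ⟨hxV, by simp [ParityInstance.bar]⟩)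
    | tip i => exact hT (mem_T.2 ⟨hxV, by simp [ParityInstance.bar]⟩)
  · obtain ⟨v, rfl, hv⟩ := hx
    have := hpar v
    change _ ↔ Vtx.orig (I.mate v) ∉ W
    rw [hW, hW]
    tauto

end SearchState
end MatroidParity

theorem mainTheorem6 {K U V : Type*} [Field K] [Fintype U] [Fintype V]
    (I : MatroidParity.ParityInstance K U V)
    (c : MatroidParity.Config K V) (hc : c.Admissible I)
    (s : MatroidParity.SearchState K V) (hs : s.ReturnsEmpty I c)
    (hsource : ∃ x, s.IsSource I x)
    (heps : s.eps I = ⊤) :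
    ¬ ∃ B, I.IsParityBase B := by
  rintro ⟨B', hB'⟩
  obtain ⟨h, hl, hb⟩ := hs.invariant hc
  obtain ⟨m, W, hV, hW, hT, hm⟩ := h.exists_matching hc.wellFormed.isBase hB'.1
  exact h.no_perfect_matching hl hb (MatroidParity.SearchState.closed_of_eps heps)
    (MatroidParity.SearchState.paritySet_of_isParityBase hB' hV hW hT) hsource ⟨m, hm⟩
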